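/- **Setting.** Let $X\in\mathbb R^p$ and $Y\in\{0,1\}$ satisfy $P(Y=1\mid X=x)=\exp(\alpha_0+\beta_0^\top x)/\{1+\exp(\alpha_0+\beta_0^\top x)\}$, and let $h:\mathbb R^p\to\mathbb R^q$ be measurable with $E[h(X)\mid Y=1]\neq E[h(X)\mid Y=0]$. Put $\gamma_0=\log\{P(Y=0)/P(Y=1)\}$, $\alpha_0^*=\gamma_0+\alpha_0$, $\mu_0=E[h(X)]$ and $\theta_0=(\gamma_0,\alpha_0^*,\beta_0,\mu_0)$. For each $n$, the internal data $(y_i,x_i)_{i\le n}$ consist of the first $n_1=n_1(n)$ members of an i.i.d. sequence from the law of $X$ given $Y=1$ (these have $y_i=1$) and the first $n_0=n-n_1$ members of an i.i.d. sequence, independent of the first, from the law of $X$ given $Y=0$ (these have $y_i=0$); $n_1/n$ and $n_0/n$ stay bounded away from $0$ as $n\to\infty$. Let $\tilde\mu=\tilde\mu_n$ be an external estimate of $\mu_0$ based on sample size $N=N(n)$, where $n/N\to c\in(0,\infty)$, and let $W$ be a positive definite $q\times q$ matrix. For $\theta=(\gamma,\alpha^*,\beta,\mu)$ and $\nu\in\mathbb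 R^{1+q}$ let $$H(x;\theta)=\Big(e^{\alpha^*+\beta^\top x}-1,\ \tfrac{e^{\alpha^*+\beta^\top x}+e^{\gamma}}{1+e^{\gamma}}h(x)-\mu\Big),$$ $$l_W(\theta,\nu)=\sum_{i=1}^n\big[y_i(\alpha^*+\beta^\top x_i)-\log(1+\nu^\top H(x_i;\theta))\big]-\tfrac N2(\tilde\mu-\mu)^\top W^{-1}(\tilde\mu-\mu),$$ the latter where $1+\nu^\top H(x_i;\theta)>0$ for all $i$. The estimator $\hat\theta_W$ is the $\theta$-component of a maximizer $(\hat\theta_W,\hat p)$ of $\sum_i[y_i(\alpha^*+\beta^\top x_i)+\log p_i]-\frac N2(\tilde\mu-\mu)^\top W^{-1}(\tilde\mu-\mu)$ over $\theta\in\Theta$ and $p_i>0$ subject to $\sum_ip_i=1$ and $\sum_ip_iH(x_i;\theta)=0$. **Conditions.** (1) $\Theta$ is compact and $\theta_0$ is an interior point of $\Theta$. (2) $E[H(X;\gamma_0,\alpha_0^*,\beta_0,\mu)\mid Y=0]=0$ has the unique solution $\mu=\mu_0$. (3) $E\|X\|^3<\infty$, $E\|h(X)\|^3<\infty$, and $X$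 is not concentrated on a proper affine subspace of $\mathbb R^p$. (4) $\sqrt N(\tilde\mu-\mu_0)\to N(0,V)$ in distribution, for some positive semidefinite $V$. **Theorem.** Let $G_n$ be the event that a maximizer exists and that every maximizer $(\hat\theta_W,\hat p)$ has $\hat\theta_W$ in the interior of $\{\theta:\|\theta-\theta_0\|\le n^{-1/3}\}$ and admits $\hat\nu_W$ such that $1+\hat\nu_W^\top H(x_i;\hat\theta_W)>0$ and $\hat p_i=n^{-1}(1+\hat\nu_W^\top H(x_i;\hat\theta_W))^{-1}$ for all $i$, and $\hat\eta_W=(\hat\theta_W,\hat\nu_W)$ satisfies $\partial l_W(\hat\eta_W)/\partial\eta=0$. Under the above assumptions: (i) $G_n$ holds with probability tending to one as $n\to\infty$. (ii) With probability one, if $n^{1/3}(\tilde\mu_n-\mu_0)\to0$, then $G_n$ holds for all sufficiently large $n$. (iii) Any estimator sequence $\hat\theta_W=(\hat\gamma_W,\hat\alpha^*_W,\hat\beta_W,\hat\mu_W)$ that is the $\theta$-component of a maximizer whenever one exists is consistent: in probability, $\hat\theta_W\to\theta_0$, $\hat\alpha^*_W-\hat\gamma_W\to\alpha_0$ and $1/(1+e^{\hat\gamma_W})\to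 P(Y=1)$. (iv) The intercept $\alpha_0$ and the case proportion $P(Y=1)$ are identified: any other law of $(X,Y)$ that follows a logistic model and has the same conditional laws of $X$ given $Y=1$ and given $Y=0$ and the same $E[h(X)]$ has the same intercept and the same case proportion. -/

import Mathlib

open MeasureTheory ProbabilityTheory Filter Topology

noncomputable section

namespace CaseControl

/-- Covariate and summary vectors, with the Euclidean norm. -/
abbrev Vec (d : ℕ) : Type := EuclideanSpace ℝ (Fin d)

/-- The finite-dimensional parameter `θ = (γ, α*, β, μ)` as one Euclidean vector; the four blocks
of coordinates are, in this order, `γ`, `α*`, `β`, `μ`. -/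
abbrev Param (p q : ℕ) : Type := EuclideanSpace ℝ (Unit ⊕ Unit ⊕ Fin p ⊕ Fin q)

/-- The Lagrange multiplier `ν`, a vector of dimension `1 + q`. -/
abbrev Mult (q : ℕ) : Type := EuclideanSpace ℝ (Unit ⊕ Fin q)

variable {p q : ℕ}

def mkParam (γ a : ℝ) (β : Vec p) (μ : Vec q) : Param p q :=
  WithLp.toLp 2 (Sum.elim (fun _ => γ) (Sum.elim (fun _ => a) (Sum.elim (fun j => β j)
    (fun j => μ j))))

def gam (θ : Param p q) : ℝ := θ (Sum.inl ())

def astar (θ : Param p q) : ℝ := θ (Sum.inr (Sum.inl ()))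

def bet (θ : Param p q) : Vec p := WithLp.toLp 2 fun j => θ (Sum.inr (Sum.inr (Sum.inl j)))

def mom (θ : Param p q) : Vec q := WithLp.toLp 2 fun j => θ (Sum.inr (Sum.inr (Sum.inr j)))

/-! ### The population -/

/-- The logistic model `P(Y = 1 | X = x) = exp(α + βᵀx) / (1 + exp(α + βᵀx))` for the joint law
`Pop` of `(X, Y)`; the response value `1` is `true`, the value `0` is `false`. -/
def IsLogistic (Pop : Measure (Vec p × Bool)) (α : ℝ) (β : Vec p) : Prop :=
  ∀ A : Set (Vec p), MeasurableSet A →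
    Pop (A ×ˢ {true}) = ∫⁻ x in A, ENNReal.ofReal
      (Real.exp (α + inner ℝ β x) / (1 + Real.exp (α + inner ℝ β x))) ∂Pop.fst

/-- The marginal case proportion `P(Y = 1)`. -/
def caseProp (Pop : Measure (Vec p × Bool)) : ℝ := Pop.real (Prod.snd ⁻¹' {true})

/-- The conditional law of `X` given `Y = b`. -/
def condLaw (Pop : Measure (Vec p × Bool)) (b : Bool) : Measure (Vec p) :=
  (ProbabilityTheory.cond Pop (Prod.snd ⁻¹' {b})).map Prod.fst

/-- The true value `γ₀ = log [P(Y = 0) / P(Y = 1)]`. -/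
def gammaTrue (Pop : Measure (Vec p × Bool)) : ℝ :=
  Real.log (Pop.real (Prod.snd ⁻¹' {false}) / Pop.real (Prod.snd ⁻¹' {true}))

/-- The true value `θ₀ = (γ₀, γ₀ + α₀, β₀, E[h(X)])`. -/
def thetaTrue (Pop : Measure (Vec p × Bool)) (α : ℝ) (β : Vec p) (h : Vec p → Vec q) :
    Param p q :=
  mkParam (gammaTrue Pop) (gammaTrue Pop + α) β (∫ x, h x ∂Pop.fst)

/-! ### The empirical likelihood -/

/-- The exponential tilt `exp(α* + βᵀx)`. -/
def tilt (θ : Param p q) (x : Vec p) : ℝ := Real.exp (astar θ + inner ℝ (bet θ) x)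

/-- The estimating function
`H(x; θ) = (exp(α* + βᵀx) - 1, (exp(α* + βᵀx) + exp γ) / (1 + exp γ) • h(x) - μ)`. -/
def H (h : Vec p → Vec q) (θ : Param p q) (x : Vec p) : Mult q :=
  WithLp.toLp 2 (Sum.elim (fun _ => tilt θ x - 1)
    (fun j => (tilt θ x + Real.exp (gam θ)) / (1 + Real.exp (gam θ)) * h x j - mom θ j))

/-- `N (μ̃ - μ)ᵀ W⁻¹ (μ̃ - μ) / 2`. -/
def penalty (W : Matrix (Fin q) (Fin q) ℝ) (N : ℕ) (mtilde : Vec q) (μ : Vec q) : ℝ :=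
  N * dotProduct (⇑(mtilde - μ)) (W⁻¹.mulVec (⇑(mtilde - μ))) / 2

variable {ι : Type*} [Fintype ι]

/-- The log-likelihood `∑ᵢ [yᵢ(α* + βᵀxᵢ) + log pᵢ] - N (μ̃ - μ)ᵀ W⁻¹ (μ̃ - μ) / 2`. -/
def objective (W : Matrix (Fin q) (Fin q) ℝ) (N : ℕ) (mtilde : Vec q) (y : ι → ℝ) (x : ι → Vec p)
    (θ : Param p q) (w : ι → ℝ) : ℝ :=
  ∑ i, (y i * (astar θ + inner ℝ (bet θ) (x i)) + Real.log (w i)) - penalty W N mtilde (mom θ)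

/-- The constraints on `(θ, p₁, …, pₙ)`. The weights are positive because `log 0` stands for `-∞`
in the objective. -/
structure Feasible (h : Vec p → Vec q) (Θ : Set (Param p q)) (x : ι → Vec p) (θ : Param p q)
    (w : ι → ℝ) : Prop where
  mem : θ ∈ Θ
  pos : ∀ i, 0 < w i
  total : ∑ i, w i = 1
  total_tilt : ∑ i, tilt θ (x i) * w i = 1
  moment : ∑ i, (((tilt θ (x i) + Real.exp (gam θ)) / (1 + Real.exp (gam θ))) * w i) • h (x i)
    = mom θ

/-- `(θ, p)` maximizes the objective subject to the constraints. -/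
structure IsMaximizer (h : Vec p → Vec q) (Θ : Set (Param p q)) (W : Matrix (Fin q) (Fin q) ℝ)
    (N : ℕ) (mtilde : Vec q) (y : ι → ℝ) (x : ι → Vec p) (θ : Param p q) (w : ι → ℝ) : Prop where
  feasible : Feasible h Θ x θ w
  le : ∀ θ' w', Feasible h Θ x θ' w' →
    objective W N mtilde y x θ' w' ≤ objective W N mtilde y x θ w

/-- The profile empirical log-likelihood `l_W(θ, ν)`, a function of `η = (θ, ν)`. It is meaningful
where `1 + νᵀH(xᵢ; θ) > 0` for all `i`. -/
def profileLogLik (h : Vec p → Vec q) (W : Matrix (Fin q) (Fin q) ℝ) (N : ℕ) (mtilde : Vec q)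
    (y : ι → ℝ) (x : ι → Vec p) (η : Param p q × Mult q) : ℝ :=
  ∑ i, (y i * (astar η.1 + inner ℝ (bet η.1) (x i))
      - Real.log (1 + inner ℝ η.2 (H h η.1 (x i))))
    - penalty W N mtilde (mom η.1)

/-- `η = (θ, ν)` lies in the domain of `l_W` and `∂l_W/∂η` vanishes there. -/
def IsStationary (h : Vec p → Vec q) (W : Matrix (Fin q) (Fin q) ℝ) (N : ℕ) (mtilde : Vec q)
    (y : ι → ℝ) (x : ι → Vec p) (η : Param p q × Mult q) : Prop :=
  (∀ i, 0 < 1 + inner ℝ η.2 (H h η.1 (x i))) ∧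
    HasFDerivAt (profileLogLik h W N mtilde y x) (0 : Param p q × Mult q →L[ℝ] ℝ) η

/-- The estimation problem has a solution, and every solution `(θ̂, p̂)` has `θ̂` in the interior
of the ball of radius `n^(-1/3)` about `θ₀` and comes with a multiplier `ν̂` such that
`p̂ᵢ = n⁻¹ (1 + ν̂ᵀH(xᵢ; θ̂))⁻¹` and `(θ̂, ν̂)` is a stationary point of `l_W`. -/
def GoodEstimator (h : Vec p → Vec q) (Θ : Set (Param p q)) (W : Matrix (Fin q) (Fin q) ℝ)
    (N : ℕ) (mtilde : Vec q) (y : ι → ℝ) (x : ι → Vec p) (θ₀ : Param p q) : Prop :=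
  (∃ θ w, IsMaximizer h Θ W N mtilde y x θ w) ∧
  ∀ θ w, IsMaximizer h Θ W N mtilde y x θ w →
    θ ∈ interior (Metric.closedBall θ₀ ((Fintype.card ι : ℝ) ^ (-(1 / 3) : ℝ))) ∧
    ∃ ν : Mult q,
      (∀ i, w i = (Fintype.card ι : ℝ)⁻¹ * (1 + inner ℝ ν (H h θ (x i)))⁻¹) ∧
      IsStationary h W N mtilde y x (θ, ν)

/-! ### The case-control sample -/

/-- The responses of a sample of `n₁` cases and `n₀` controls. -/
def response (n₁ n₀ : ℕ) : Fin n₁ ⊕ Fin n₀ → ℝ := Sum.elim (fun _ => 1) (fun _ => 0)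

/-- The covariates of `n₁` cases and `n₀` controls, the first members of the sequences
`X true` of cases and `X false` of controls. -/
def covariate {Ω : Type*} (X : Bool → ℕ → Ω → Vec p) (n₁ n₀ : ℕ) (ω : Ω) :
    Fin n₁ ⊕ Fin n₀ → Vec p :=
  Sum.elim (fun i => X true i ω) (fun i => X false i ω)

end CaseControl

end

/-!
By Lagrange multipliers, a maximizer in the interior of `Θ` is a stationary point of `l_W`; the
abnormal multipliers of F. John are excluded because `α*` and `μ` alone already move the mean of `H`
in every direction. It remains to localize the maximizers.

The pooled covariates have intensity `d(x) = n₀ + n₁ e^(α* + βᵀx)` relative to the law of the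
controls. At a feasible point the objective is the logistic log-likelihood plus `∑ log (pᵢ dᵢ)` less
the penalty, and `∑ pᵢ dᵢ = n`, so this sum is minus a divergence of the weights from `1 / dᵢ`. The
logistic log-likelihood is strongly concave in `(α*, β)`, as `X` is not concentrated on an affine
subspace. Conversely, a small change of `θ₀` is feasible together with weights proportional to
`1 / dᵢ` and nearly attains the value at the truth. So when the sample averages involved and the
external estimate are within `ε n^(-1/3)` of their means, then `α*`, `β`, the weights and `μ` of a
maximizer are within a multiple of that of the truth, and so is `γ`, since `μ` is a mixture of the
two distinct group means with proportion `1 / (1 + e^γ)`. Third moments give the rate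
`o(n^(-1/3))` for sample averages, almost surely and in probability, by truncation at `n^(1/3)` and
Bernstein's inequality.
-/

noncomputable section

namespace CaseControl

/-! ### Empirical likelihood with estimating functions -/

lemma hasStrictFDerivAt_snd_apply {ι E : Type*} [NormedAddCommGroup E] [NormedSpace ℝ E]
    (z : E × (ι → ℝ)) (i : ι) :
    HasStrictFDerivAt (fun z : E × (ι → ℝ) => z.2 i)
      ((ContinuousLinearMap.proj i).comp (ContinuousLinearMap.snd ℝ E (ι → ℝ))) z :=
  ((ContinuousLinearMap.proj (R := ℝ) i).comp
    (ContinuousLinearMap.snd ℝ E (ι → ℝ))).hasStrictFDerivAt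

section EmpiricalLikelihood

variable {ι : Type*} [Fintype ι] {E F : Type*}

/-- The constraint set of an empirical likelihood problem with estimating functions `g i`: a
parameter in `Θ` and positive weights summing to one under which the estimating functions have mean
zero. -/
def elFeasible [AddCommGroup F] [Module ℝ F] (Θ : Set E) (g : ι → E → F) : Set (E × (ι → ℝ)) :=
  {z | z.1 ∈ Θ ∧ (∀ i, 0 < z.2 i) ∧ ∑ i, z.2 i = 1 ∧ ∑ i, z.2 i • g i z.1 = 0}

/-- The empirical log-likelihood of a parameter and weights, with a parametric part `A`. -/
def elLogLik (A : E → ℝ) (z : E × (ι → ℝ)) : ℝ := A z.1 + ∑ i, Real.log (z.2 i)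

/-- The profile empirical log-likelihood, a function of the parameter and the Lagrange multiplier.
It lacks the constant `-n log n` by which it differs from `elLogLik` at the optimal weights. -/
def elProfile [NormedAddCommGroup F] [InnerProductSpace ℝ F] (A : E → ℝ) (g : ι → E → F)
    (η : E × F) : ℝ :=
  A η.1 - ∑ i, Real.log (1 + inner ℝ η.2 (g i η.1))

section Existence

variable [NormedAddCommGroup F] [NormedSpace ℝ F] {A : E → ℝ} {g : ι → E → F} {Θ : Set E}

lemma le_one_of_mem_elFeasible {z : E × (ι → ℝ)} (hz : z ∈ elFeasible Θ g) (i : ι) : z.2 i ≤ 1 :=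
  hz.2.2.1 ▸ Finset.single_le_sum (fun j _ => (hz.2.1 j).le) (Finset.mem_univ i)

lemma exp_sub_le_of_le_elLogLik {z : E × (ι → ℝ)} (hz : z ∈ elFeasible Θ g) {B c : ℝ}
    (hB : A z.1 ≤ B) (hc : c ≤ elLogLik A z) (i : ι) : Real.exp (c - B) ≤ z.2 i := by
  have hlog : ∑ j, Real.log (z.2 j) ≤ Real.log (z.2 i) := by
    classical
    rw [← Finset.add_sum_erase _ _ (Finset.mem_univ i), add_le_iff_nonpos_right]
    exact Finset.sum_nonpos fun j _ =>
      Real.log_nonpos (hz.2.1 j).le (le_one_of_mem_elFeasible hz j)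
  rw [← Real.le_log_iff_exp_le (hz.2.1 i)]
  unfold elLogLik at hc
  linarith

theorem exists_isMaxOn_elLogLik [TopologicalSpace E] (hΘ : IsCompact Θ) (hA : Continuous A)
    (hg : ∀ i, Continuous (g i)) (hne : (elFeasible Θ g).Nonempty) :
    ∃ z ∈ elFeasible Θ g, IsMaxOn (elLogLik A) (elFeasible Θ g) z := by
  obtain ⟨z₁, hz₁⟩ := hne
  obtain ⟨B, hB⟩ := hΘ.exists_bound_of_continuousOn hA.continuousOn
  set δ := Real.exp (elLogLik A z₁ - B)
  set K : Set (E × (ι → ℝ)) := (Θ ×ˢ Set.Icc (fun _ => δ) (fun _ => 1)) ∩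
    {z | ∑ i, z.2 i = 1 ∧ ∑ i, z.2 i • g i z.1 = 0}
  have hK : IsCompact K :=
    (hΘ.prod isCompact_Icc).inter_right <|
      (isClosed_eq (by fun_prop) continuous_const).and (isClosed_eq (by fun_prop) continuous_const)
  have hKf : K ⊆ elFeasible Θ g := fun z hz =>
    ⟨hz.1.1, fun i => (Real.exp_pos _).trans_le (hz.1.2.1 i), hz.2⟩
  have hfK : ∀ z ∈ elFeasible Θ g, elLogLik A z₁ ≤ elLogLik A z → z ∈ K := fun z hz hle =>
    ⟨⟨hz.1, fun i => exp_sub_le_of_le_elLogLik hz ((le_abs_self _).trans (hB _ hz.1)) hle i,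
      le_one_of_mem_elFeasible hz⟩, hz.2.2⟩
  have hcont : ContinuousOn (elLogLik A) K :=
    (hA.comp continuous_fst).continuousOn.add <| continuousOn_finsetSum _ fun i _ =>
      ContinuousOn.log (by fun_prop) fun z hz => ((hKf hz).2.1 i).ne'
  have hz₁K := hfK z₁ hz₁ le_rfl
  obtain ⟨z, hz, hmax⟩ := hK.exists_isMaxOn ⟨z₁, hz₁K⟩ hcont
  refine ⟨z, hKf hz, fun z' hz' => ?_⟩
  rcases le_total (elLogLik A z₁) (elLogLik A z') with hle | hle
  · exact hmax (hfK z' hz' hle)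
  · exact hle.trans (hmax hz₁K)

end Existence

section Multiplier

variable [NormedAddCommGroup E] [NormedSpace ℝ E] [NormedAddCommGroup F] [InnerProductSpace ℝ F]
  {A : E → ℝ} {A' : E →L[ℝ] ℝ} {g : ι → E → F} {g' : ι → E →L[ℝ] F} {θ : E} {w : ι → ℝ} {ν : F}

lemma hasStrictFDerivAt_elLogLik (hA : HasStrictFDerivAt A A' θ) (hw : ∀ i, 0 < w i) :
    HasStrictFDerivAt (elLogLik A)
      (A'.comp (ContinuousLinearMap.fst ℝ E (ι → ℝ)) + ∑ i, (w i)⁻¹ •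
        (ContinuousLinearMap.proj i).comp (ContinuousLinearMap.snd ℝ E (ι → ℝ))) (θ, w) :=
  (hA.comp (θ, w) hasStrictFDerivAt_fst).fun_add <| HasStrictFDerivAt.fun_sum fun i _ =>
    (hasStrictFDerivAt_snd_apply (θ, w) i).log (hw i).ne'

lemma hasStrictFDerivAt_elConstraint (hg : ∀ i, HasStrictFDerivAt (g i) (g' i) θ) :
    HasStrictFDerivAt (fun z : E × (ι → ℝ) => (∑ i, z.2 i, ∑ i, z.2 i • g i z.1))
      ((∑ i, (ContinuousLinearMap.proj i).comp (ContinuousLinearMap.snd ℝ E (ι → ℝ))).prod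
        (∑ i, (w i • (g' i).comp (ContinuousLinearMap.fst ℝ E (ι → ℝ)) +
          ((ContinuousLinearMap.proj i).comp
            (ContinuousLinearMap.snd ℝ E (ι → ℝ))).smulRight (g i θ)))) (θ, w) :=
  (HasStrictFDerivAt.fun_sum fun i _ => hasStrictFDerivAt_snd_apply (θ, w) i).prodMk <|
    HasStrictFDerivAt.fun_sum fun i _ =>
      (hasStrictFDerivAt_snd_apply (θ, w) i).smul ((hg i).comp (θ, w) hasStrictFDerivAt_fst)

lemma exists_eq_mul_add_inner [FiniteDimensional ℝ F] (L : Module.Dual ℝ (ℝ × F)) :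
    ∃ (a : ℝ) (u : F), ∀ s y, L (s, y) = a * s + inner ℝ u y := by
  refine ⟨L (1, 0), (InnerProductSpace.toDual ℝ F).symm
    (LinearMap.toContinuousLinearMap (L.comp (LinearMap.inr ℝ ℝ F))), fun s y => ?_⟩
  rw [InnerProductSpace.toDual_symm_apply, mul_comm, ← smul_eq_mul, ← map_smul]
  simp [← map_add]

/-- The Lagrange conditions of the empirical likelihood problem in the form of F. John, that is,
with a possibly vanishing factor `l` in front of the objective. -/
lemma exists_fritzJohn_multiplier [CompleteSpace E] [FiniteDimensional ℝ F]
    (hmax : IsLocalMaxOn (elLogLik A)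
      {z | ∑ i, z.2 i = 1 ∧ ∑ i, z.2 i • g i z.1 = 0} (θ, w))
    (hw : ∀ i, 0 < w i) (hw1 : ∑ i, w i = 1) (hg0 : ∑ i, w i • g i θ = 0)
    (hA : HasStrictFDerivAt A A' θ) (hg : ∀ i, HasStrictFDerivAt (g i) (g' i) θ) :
    ∃ (a l : ℝ) (u : F), (a, l, u) ≠ 0 ∧ (∀ i, a + inner ℝ u (g i θ) + l * (w i)⁻¹ = 0) ∧
      ∀ v, ∑ i, w i * inner ℝ u (g' i v) + l * A' v = 0 := by
  classical
  have hext : IsLocalExtrOn (elLogLik A)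
      {z : E × (ι → ℝ) | (∑ i, z.2 i, ∑ i, z.2 i • g i z.1) =
        (∑ i, w i, ∑ i, w i • g i θ)} (θ, w) := by
    simp only [hw1, hg0, Prod.mk.injEq]
    exact Or.inr hmax
  obtain ⟨L, l, hne, hL⟩ := hext.exists_linear_map_of_hasStrictFDerivAt
    (hasStrictFDerivAt_elConstraint hg) (hasStrictFDerivAt_elLogLik hA hw)
  obtain ⟨a, u, hau⟩ := exists_eq_mul_add_inner L
  refine ⟨a, l, u, fun h0 => hne ?_, fun i => ?_, fun v => ?_⟩
  · obtain ⟨rfl, rfl, rfl⟩ : a = 0 ∧ l = 0 ∧ u = 0 := by simpa using h0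
    exact Prod.ext (LinearMap.ext fun z => by simpa using hau z.1 z.2) rfl
  · simpa [hau, Pi.single_apply, inner_smul_right, _root_.sum_apply] using hL (0, Pi.single i 1)
  · simpa [hau, inner_sum, inner_smul_right, _root_.sum_apply] using hL (v, 0)

/-- If the mean derivative of the estimating functions is onto, the F. John factor is nonzero and
can be normalized; `1 + ⟪ν, g i θ⟫` is then the reciprocal of `n * w i`. -/
theorem exists_multiplier_of_isLocalMaxOn [CompleteSpace E] [FiniteDimensional ℝ F]
    (hmax : IsLocalMaxOn (elLogLik A)
      {z | ∑ i, z.2 i = 1 ∧ ∑ i, z.2 i • g i z.1 = 0} (θ, w))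
    (hw : ∀ i, 0 < w i) (hw1 : ∑ i, w i = 1) (hg0 : ∑ i, w i • g i θ = 0)
    (hA : HasStrictFDerivAt A A' θ) (hg : ∀ i, HasStrictFDerivAt (g i) (g' i) θ)
    (hsurj : Function.Surjective fun v => ∑ i, w i • g' i v) :
    ∃ ν : F, (∀ i, (1 + inner ℝ ν (g i θ))⁻¹ = Fintype.card ι * w i) ∧
      ∀ v, A' v = ∑ i, Fintype.card ι * w i * inner ℝ ν (g' i v) := by
  obtain ⟨a, l, u, hne, hwi, hv⟩ := exists_fritzJohn_multiplier hmax hw hw1 hg0 hA hg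
  have ha : a = -(l * Fintype.card ι) := by
    have hsum : ∑ i, w i * (a + inner ℝ u (g i θ) + l * (w i)⁻¹) = 0 :=
      Finset.sum_eq_zero fun i _ => by rw [hwi i, mul_zero]
    have hinner : ∑ i, w i * inner ℝ u (g i θ) = 0 := by
      simpa only [inner_sum, inner_smul_right, inner_zero_right] using congrArg (inner ℝ u) hg0
    have hcancel : ∀ i, w i * (l * (w i)⁻¹) = l := fun i => by field [(hw i).ne']
    simp only [mul_add, Finset.sum_add_distrib, ← Finset.sum_mul, hw1, hinner, hcancel,
      Finset.sum_const, Finset.card_univ, nsmul_eq_mul] at hsum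
    linarith
  have hl : l ≠ 0 := by
    rintro rfl
    obtain ⟨v, hu⟩ := hsurj u
    have hzero : inner ℝ u u = 0 := by
      nth_rw 2 [← hu]
      simpa only [inner_sum, inner_smul_right, zero_mul, add_zero] using hv v
    exact hne (by simp [ha, inner_self_eq_zero.1 hzero])
  have hn : (Fintype.card ι : ℝ) ≠ 0 := fun h0 => by
    have : IsEmpty ι := Fintype.card_eq_zero_iff.1 (Nat.cast_eq_zero.1 h0)
    simp at hw1
  refine ⟨-(Fintype.card ι * l)⁻¹ • u, fun i => ?_, fun v => ?_⟩
  · have hinner : inner ℝ u (g i θ) = l * Fintype.card ι - l * (w i)⁻¹ := by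
      linear_combination hwi i - ha
    rw [inner_smul_left, conj_trivial, hinner]
    have := (hw i).ne'
    field_simp
    ring
  · have hmul : ∀ i, Fintype.card ι * w i * inner ℝ (-(Fintype.card ι * l)⁻¹ • u) (g' i v) =
        -l⁻¹ * (w i * inner ℝ u (g' i v)) := fun i => by
      rw [inner_smul_left, conj_trivial]
      field_simp
    rw [Finset.sum_congr rfl fun i _ => hmul i, ← Finset.mul_sum,
      eq_neg_of_add_eq_zero_left (hv v)]
    field_simp

lemma hasFDerivAt_elProfile (hA : HasFDerivAt A A' θ) (hg : ∀ i, HasFDerivAt (g i) (g' i) θ)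
    (hpos : ∀ i, 0 < 1 + inner ℝ ν (g i θ)) :
    HasFDerivAt (elProfile A g)
      (A'.comp (ContinuousLinearMap.fst ℝ E F) - ∑ i, (1 + inner ℝ ν (g i θ))⁻¹ •
        (fderivInnerCLM ℝ (ν, g i θ)).comp ((ContinuousLinearMap.snd ℝ E F).prod
          ((g' i).comp (ContinuousLinearMap.fst ℝ E F)))) (θ, ν) := by
  have hH : ∀ i, HasFDerivAt (fun η : E × F => g i η.1)
      ((g' i).comp (ContinuousLinearMap.fst ℝ E F)) (θ, ν) :=
    fun i => (hg i).comp (θ, ν) hasFDerivAt_fst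
  exact (hA.comp (θ, ν) hasFDerivAt_fst).fun_sub <| HasFDerivAt.fun_sum fun i _ =>
    ((HasFDerivAt.inner ℝ hasFDerivAt_snd (hH i)).const_add 1).log (hpos i).ne'

lemma hasFDerivAt_elProfile_zero (hA : HasFDerivAt A A' θ)
    (hg : ∀ i, HasFDerivAt (g i) (g' i) θ) (hpos : ∀ i, 0 < 1 + inner ℝ ν (g i θ)) {n : ℝ}
    (hg0 : ∑ i, w i • g i θ = 0) (hwi : ∀ i, (1 + inner ℝ ν (g i θ))⁻¹ = n * w i)
    (hv : ∀ v, A' v = ∑ i, n * w i * inner ℝ ν (g' i v)) :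
    HasFDerivAt (elProfile A g) (0 : E × F →L[ℝ] ℝ) (θ, ν) := by
  convert hasFDerivAt_elProfile hA hg hpos using 1
  refine (ContinuousLinearMap.ext fun ⟨v, u⟩ => ?_).symm
  have hu : ∑ i, n * w i * inner ℝ u (g i θ) = 0 := by
    have := congrArg (fun z => n * inner ℝ u z) hg0
    simpa only [inner_sum, inner_smul_right, inner_zero_right, mul_zero, Finset.mul_sum,
      mul_assoc] using this
  simp [hwi, _root_.sum_apply, mul_add, Finset.sum_add_distrib, hu, hv]

end Multiplier

end EmpiricalLikelihood

/-! ### The empirical likelihood of a case-control sample -/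

variable {p q : ℕ}

section Blocks

variable (γ a : ℝ) (β : Vec p) (μ : Vec q) (θ θ' : Param p q)

@[simp] lemma gam_mkParam : gam (mkParam γ a β μ) = γ := rfl

@[simp] lemma astar_mkParam : astar (mkParam γ a β μ) = a := rfl

@[simp] lemma bet_mkParam : bet (mkParam γ a β μ) = β := rfl

@[simp] lemma mom_mkParam : mom (mkParam γ a β μ) = μ := rfl

lemma contDiff_gam : ContDiff ℝ ⊤ (gam : Param p q → ℝ) := by
  unfold gam
  fun_prop

lemma contDiff_astar : ContDiff ℝ ⊤ (astar : Param p q → ℝ) := by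
  unfold astar
  fun_prop

lemma contDiff_bet : ContDiff ℝ ⊤ (bet : Param p q → Vec p) :=
  contDiff_euclidean.2 fun i => by
    simp only [bet]
    fun_prop

lemma contDiff_mom : ContDiff ℝ ⊤ (mom : Param p q → Vec q) :=
  contDiff_euclidean.2 fun i => by
    simp only [mom]
    fun_prop

end Blocks

section EstimatingFunction

variable (h : Vec p → Vec q) (θ : Param p q) (x : Vec p)

lemma contDiff_linPred : ContDiff ℝ ⊤ fun θ : Param p q => astar θ + inner ℝ (bet θ) x :=
  contDiff_astar.add (contDiff_bet.inner ℝ contDiff_const)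

lemma contDiff_tilt : ContDiff ℝ ⊤ fun θ : Param p q => tilt θ x := (contDiff_linPred x).exp

lemma H_inl (i : Unit) : H h θ x (Sum.inl i) = tilt θ x - 1 := rfl

lemma H_inr (j : Fin q) :
    H h θ x (Sum.inr j) =
      (tilt θ x + Real.exp (gam θ)) / (1 + Real.exp (gam θ)) * h x j - mom θ j := rfl

lemma contDiff_H : ContDiff ℝ ⊤ fun θ : Param p q => H h θ x :=
  contDiff_euclidean.2 fun i => by
    rcases i with i | j
    · simpa only [H_inl] using (contDiff_tilt x).sub contDiff_const
    · simp only [H_inr]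
      exact ((((contDiff_tilt x).add contDiff_gam.exp).div (contDiff_const.add contDiff_gam.exp)
        fun θ => by positivity).mul contDiff_const).sub (contDiff_euclidean.1 contDiff_mom j)

lemma tilt_add_smul_mkParam (s t : ℝ) (u : Vec q) :
    tilt (θ + t • mkParam 0 s 0 u) x = Real.exp (t * s) * tilt θ x := by
  have hbet : bet (θ + t • mkParam 0 s 0 u) = bet θ := by ext j; simp [bet, mkParam]
  have hast : astar (θ + t • mkParam 0 s 0 u) = t * s + astar θ := by
    simp [astar, mkParam, add_comm]
  rw [tilt, hbet, hast, add_assoc, Real.exp_add, tilt]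

lemma H_add_smul_mkParam (s t : ℝ) (u : Vec q) :
    H h (θ + t • mkParam 0 s 0 u) x = H h θ x +
      ((Real.exp (t * s) - 1) • WithLp.toLp 2 (Sum.elim (fun _ => tilt θ x)
        fun j => tilt θ x / (1 + Real.exp (gam θ)) * h x j) -
      t • WithLp.toLp 2 (Sum.elim (fun _ => 0) u)) := by
  have hgam : gam (θ + t • mkParam 0 s 0 u) = gam θ := by simp [gam, mkParam]
  have hmom : ∀ j, mom (θ + t • mkParam 0 s 0 u) j = mom θ j + t * u j := fun j => by
    simp [mom, mkParam]
  ext (i | j)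
  · simp [H_inl, tilt_add_smul_mkParam]
    ring
  · simp [H_inr, tilt_add_smul_mkParam, hgam, hmom]
    ring

lemma fderiv_H_mkParam (s : ℝ) (u : Vec q) :
    fderiv ℝ (fun θ => H h θ x) θ (mkParam 0 s 0 u) =
      s • WithLp.toLp 2 (Sum.elim (fun _ => tilt θ x)
        fun j => tilt θ x / (1 + Real.exp (gam θ)) * h x j) -
      WithLp.toLp 2 (Sum.elim (fun _ => 0) u) := by
  refine (((contDiff_H h x).differentiable (by simp) θ).hasFDerivAt.hasLineDerivAt _).unique ?_
  unfold HasLineDerivAt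
  simp only [H_add_smul_mkParam]
  have hexp : HasDerivAt (fun t => Real.exp (t * s) - 1) s 0 := by
    simpa using (((hasDerivAt_id (0 : ℝ)).mul_const s).exp).sub_const 1
  simpa using ((hexp.smul_const _).sub ((hasDerivAt_id (0 : ℝ)).smul_const _)).const_add (H h θ x)

variable {ι : Type*} [Fintype ι]

/-- The directions `α*` and `μ` suffice: the mean tilt is positive. -/
lemma surjective_sum_smul_fderiv_H (x : ι → Vec p) {w : ι → ℝ} (hw : ∑ i, w i = 1)
    (ht : ∑ i, tilt θ (x i) * w i = 1) :
    Function.Surjective fun v => ∑ i, w i • fderiv ℝ (fun θ => H h θ (x i)) θ v := by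
  intro z
  set k : Fin q → ℝ := fun j => ∑ i, w i * (tilt θ (x i) / (1 + Real.exp (gam θ)) * h (x i) j)
  refine ⟨mkParam 0 (z (Sum.inl ())) 0
    (WithLp.toLp 2 fun j => z (Sum.inl ()) * k j - z (Sum.inr j)), ?_⟩
  simp only [fderiv_H_mkParam, smul_sub, Finset.sum_sub_distrib, ← Finset.sum_smul, hw, one_smul,
    smul_comm (w _) (z _), ← Finset.smul_sum]
  ext (i | j)
  · simp [mul_comm (w _), ht]
  · simp [k]

lemma sum_smul_H_eq_zero_iff (x : ι → Vec p) {w : ι → ℝ} (hw : ∑ i, w i = 1) :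
    ∑ i, w i • H h θ (x i) = 0 ↔ ∑ i, tilt θ (x i) * w i = 1 ∧
      ∑ i, (((tilt θ (x i) + Real.exp (gam θ)) / (1 + Real.exp (gam θ))) * w i) • h (x i)
        = mom θ := by
  have hinl : (∑ i, w i • H h θ (x i)) (Sum.inl ()) = ∑ i, tilt θ (x i) * w i - 1 := by
    simp [H_inl, sub_mul, Finset.sum_sub_distrib, hw, mul_comm (w _)]
  have hinr (j : Fin q) : (∑ i, w i • H h θ (x i)) (Sum.inr j) =
      (∑ i, (((tilt θ (x i) + Real.exp (gam θ)) / (1 + Real.exp (gam θ))) * w i) • h (x i)) j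
        - mom θ j := by
    simp [H_inr, mul_sub, Finset.sum_sub_distrib, ← Finset.sum_mul, hw, mul_left_comm (w _),
      mul_assoc]
  simp only [PiLp.ext_iff, Sum.forall, hinr, PiLp.zero_apply, forall_const, hinl, sub_eq_zero]

end EstimatingFunction

section Penalty

lemma contDiff_penalty (W : Matrix (Fin q) (Fin q) ℝ) (N : ℕ) (m : Vec q) :
    ContDiff ℝ ⊤ (penalty W N m) := by
  unfold penalty Matrix.mulVec dotProduct
  fun_prop

lemma exists_mul_sq_norm_bounds {E : Type*} [NormedAddCommGroup E] [NormedSpace ℝ E]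
    [FiniteDimensional ℝ E] {Q : E → ℝ} (hcont : Continuous Q) (hpos : ∀ v, v ≠ 0 → 0 < Q v)
    (hhom : ∀ (a : ℝ) v, Q (a • v) = a ^ 2 * Q v) :
    ∃ c C : ℝ, 0 < c ∧ 0 < C ∧ ∀ v, c * ‖v‖ ^ 2 ≤ Q v ∧ Q v ≤ C * ‖v‖ ^ 2 := by
  obtain ⟨c, C, hc, hC, hb⟩ : ∃ c C : ℝ, 0 < c ∧ 0 < C ∧ ∀ v ∈ Metric.sphere (0 : E) 1,
      c ≤ Q v ∧ Q v ≤ C := by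
    rcases (Metric.sphere (0 : E) 1).eq_empty_or_nonempty with hempty | hne
    · exact ⟨1, 1, one_pos, one_pos, by simp [hempty]⟩
    have : ProperSpace E := FiniteDimensional.proper ℝ E
    obtain ⟨v, hv, hmin⟩ := (isCompact_sphere (0 : E) 1).exists_isMinOn hne hcont.continuousOn
    obtain ⟨u, hu, hmax⟩ := (isCompact_sphere (0 : E) 1).exists_isMaxOn hne hcont.continuousOn
    exact ⟨Q v, Q u, hpos v (ne_zero_of_mem_unit_sphere ⟨v, hv⟩),
      hpos u (ne_zero_of_mem_unit_sphere ⟨u, hu⟩), fun z hz => ⟨hmin hz, hmax hz⟩⟩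
  refine ⟨c, C, hc, hC, fun v => ?_⟩
  rcases eq_or_ne v 0 with rfl | hv
  · have hzero : Q 0 = 0 := by simpa using hhom 0 0
    simp [hzero]
  have hn : ‖v‖ ≠ 0 := norm_ne_zero_iff.2 hv
  have hscale : Q v = Q (‖v‖⁻¹ • v) * ‖v‖ ^ 2 := by
    rw [hhom]
    field_simp
  have hunit := hb (‖v‖⁻¹ • v) (by simp [norm_smul, hn])
  rw [hscale]
  exact ⟨mul_le_mul_of_nonneg_right hunit.1 (sq_nonneg _),
    mul_le_mul_of_nonneg_right hunit.2 (sq_nonneg _)⟩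

lemma exists_penalty_bounds {W : Matrix (Fin q) (Fin q) ℝ} (hW : W.PosDef) :
    ∃ c C : ℝ, 0 < c ∧ 0 < C ∧ ∀ (N : ℕ) (m μ : Vec q),
      c * N * ‖m - μ‖ ^ 2 ≤ penalty W N m μ ∧ penalty W N m μ ≤ C * N * ‖m - μ‖ ^ 2 := by
  obtain ⟨c, C, hc, hC, hb⟩ := exists_mul_sq_norm_bounds
    (Q := fun v : Vec q => dotProduct v.ofLp (W⁻¹.mulVec v.ofLp))
    (by unfold Matrix.mulVec dotProduct; fun_prop)
    (fun v hv => by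
      simpa using hW.inv.dotProduct_mulVec_pos (x := v.ofLp) (by simpa using hv))
    (fun a v => by
      simp only [WithLp.ofLp_smul, Matrix.mulVec_smul, smul_dotProduct, dotProduct_smul,
        smul_eq_mul]
      ring)
  refine ⟨c / 2, C / 2, half_pos hc, half_pos hC, fun N m μ => ?_⟩
  have hlow := mul_le_mul_of_nonneg_left (hb (m - μ)).1 (Nat.cast_nonneg (α := ℝ) N)
  have hup := mul_le_mul_of_nonneg_left (hb (m - μ)).2 (Nat.cast_nonneg (α := ℝ) N)
  simp only [penalty]
  constructor <;> linarith

end Penalty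

section Maximizer

variable {ι : Type*} [Fintype ι] {h : Vec p → Vec q} {Θ : Set (Param p q)}
  {W : Matrix (Fin q) (Fin q) ℝ} {N : ℕ} {m : Vec q} {y : ι → ℝ} {x : ι → Vec p}
  {θ : Param p q} {w : ι → ℝ}

/-- The part of the log-likelihood that does not involve the weights. -/
def parametricLogLik (W : Matrix (Fin q) (Fin q) ℝ) (N : ℕ) (m : Vec q) (y : ι → ℝ)
    (x : ι → Vec p) (θ : Param p q) : ℝ :=
  ∑ i, y i * (astar θ + inner ℝ (bet θ) (x i)) - penalty W N m (mom θ)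

lemma contDiff_parametricLogLik : ContDiff ℝ ⊤ (parametricLogLik W N m y x) :=
  (ContDiff.sum fun i _ => contDiff_const.mul (contDiff_linPred (x i))).sub
    ((contDiff_penalty W N m).comp contDiff_mom)

lemma objective_eq_elLogLik :
    objective W N m y x θ w = elLogLik (parametricLogLik W N m y x) (θ, w) := by
  simp only [objective, elLogLik, parametricLogLik, Finset.sum_add_distrib]
  ring

lemma profileLogLik_eq_elProfile :
    profileLogLik h W N m y x =
      elProfile (parametricLogLik W N m y x) fun i θ => H h θ (x i) := by
  funext η
  simp only [profileLogLik, elProfile, parametricLogLik, Finset.sum_sub_distrib]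
  ring

lemma feasible_iff_mem_elFeasible :
    Feasible h Θ x θ w ↔ (θ, w) ∈ elFeasible Θ fun i θ => H h θ (x i) :=
  ⟨fun hf => ⟨hf.mem, hf.pos, hf.total,
      (sum_smul_H_eq_zero_iff h θ x hf.total).2 ⟨hf.total_tilt, hf.moment⟩⟩,
    fun ⟨hmem, hpos, htot, hH⟩ =>
      have hmean := (sum_smul_H_eq_zero_iff h θ x htot).1 hH
      ⟨hmem, hpos, htot, hmean.1, hmean.2⟩⟩

lemma isMaximizer_iff_isMaxOn :
    IsMaximizer h Θ W N m y x θ w ↔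
      (θ, w) ∈ elFeasible Θ (fun i θ => H h θ (x i)) ∧
        IsMaxOn (elLogLik (parametricLogLik W N m y x))
          (elFeasible Θ fun i θ => H h θ (x i)) (θ, w) := by
  simp only [isMaxOn_iff, Prod.forall, ← feasible_iff_mem_elFeasible, ← objective_eq_elLogLik]
  exact ⟨fun hmax => ⟨hmax.feasible, hmax.le⟩, fun hmax => ⟨hmax.1, hmax.2⟩⟩

theorem exists_isMaximizer (hΘ : IsCompact Θ) (hf : Feasible h Θ x θ w) :
    ∃ θ w, IsMaximizer h Θ W N m y x θ w := by
  obtain ⟨z, hz, hmax⟩ := exists_isMaxOn_elLogLik hΘ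
    (contDiff_parametricLogLik (W := W) (N := N) (m := m) (y := y)).continuous
    (fun i => (contDiff_H h (x i)).continuous) ⟨_, feasible_iff_mem_elFeasible.1 hf⟩
  exact ⟨z.1, z.2, isMaximizer_iff_isMaxOn.2 ⟨hz, hmax⟩⟩

lemma IsMaximizer.isLocalMaxOn (hmax : IsMaximizer h Θ W N m y x θ w) (hθ : θ ∈ interior Θ) :
    IsLocalMaxOn (elLogLik (parametricLogLik W N m y x))
      {z | ∑ i, z.2 i = 1 ∧ ∑ i, z.2 i • H h z.1 (x i) = 0} (θ, w) := by
  have hΘ : ∀ᶠ z : Param p q × (ι → ℝ) in 𝓝 (θ, w), z.1 ∈ Θ :=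
    continuous_fst.continuousAt.eventually_mem (mem_interior_iff_mem_nhds.1 hθ)
  have hpos : ∀ᶠ z : Param p q × (ι → ℝ) in 𝓝 (θ, w), ∀ i, 0 < z.2 i :=
    eventually_all.2 fun i => Continuous.tendsto (f := fun z : Param p q × (ι → ℝ) => z.2 i)
      (by fun_prop) (θ, w) |>.eventually_const_lt (hmax.feasible.pos i)
  filter_upwards [nhdsWithin_le_nhds hΘ, nhdsWithin_le_nhds hpos, self_mem_nhdsWithin]
    with z hzΘ hzpos hz
  exact (isMaximizer_iff_isMaxOn.1 hmax).2 ⟨hzΘ, hzpos, hz⟩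

theorem IsMaximizer.exists_multiplier (hmax : IsMaximizer h Θ W N m y x θ w)
    (hθ : θ ∈ interior Θ) :
    ∃ ν : Mult q, (∀ i, w i = (Fintype.card ι : ℝ)⁻¹ * (1 + inner ℝ ν (H h θ (x i)))⁻¹) ∧
      IsStationary h W N m y x (θ, ν) := by
  have hf := hmax.feasible
  have hH0 := (sum_smul_H_eq_zero_iff h θ x hf.total).2 ⟨hf.total_tilt, hf.moment⟩
  have hA : HasStrictFDerivAt (parametricLogLik W N m y x)
      (fderiv ℝ (parametricLogLik W N m y x) θ) θ :=
    contDiff_parametricLogLik.contDiffAt.hasStrictFDerivAt (by simp)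
  have hH : ∀ i, HasStrictFDerivAt (fun θ => H h θ (x i))
      (fderiv ℝ (fun θ => H h θ (x i)) θ) θ := fun i =>
    (contDiff_H h (x i)).contDiffAt.hasStrictFDerivAt (by simp)
  obtain ⟨ν, hν, hv⟩ := exists_multiplier_of_isLocalMaxOn (g := fun i θ => H h θ (x i))
    (hmax.isLocalMaxOn hθ) hf.pos hf.total hH0 hA hH
    (surjective_sum_smul_fderiv_H h θ x hf.total hf.total_tilt)
  have hcard : ∀ _ : ι, 0 < (Fintype.card ι : ℝ) := fun i =>
    Nat.cast_pos.2 (Fintype.card_pos_iff.2 ⟨i⟩)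
  have hpos : ∀ i, 0 < 1 + inner ℝ ν (H h θ (x i)) := fun i => by
    rw [← inv_pos, hν]
    exact mul_pos (hcard i) (hf.pos i)
  refine ⟨ν, fun i => ?_, hpos, ?_⟩
  · rw [hν, inv_mul_cancel_left₀ (hcard i).ne']
  · rw [profileLogLik_eq_elProfile]
    exact hasFDerivAt_elProfile_zero hA.hasFDerivAt (fun i => (hH i).hasFDerivAt) hpos hH0 hν hv

end Maximizer

/-! ### Elementary inequalities -/

section Elementary

lemma half_mul_sq_le_of_deriv_strongly_mono {f f' : ℝ → ℝ} {c u v : ℝ}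
    (hf : ∀ w ∈ Set.uIcc v u, HasDerivAt f (f' w) w)
    (hmono : ∀ w ∈ Set.uIcc v u, c * (w - v) ^ 2 ≤ (f' w - f' v) * (w - v)) :
    c / 2 * (u - v) ^ 2 ≤ f u - f v - f' v * (u - v) := by
  set D : ℝ → ℝ := fun t => f (v + t * (u - v)) - t * (f' v * (u - v)) - c / 2 * (t * (u - v)) ^ 2
  have hmem : ∀ t ∈ Set.Icc (0 : ℝ) 1, v + t * (u - v) ∈ Set.uIcc v u := fun t ht => by
    rw [← segment_eq_uIcc, segment_eq_image']
    exact ⟨t, ht, rfl⟩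
  have hD : ∀ t ∈ Set.Icc (0 : ℝ) 1, HasDerivAt D
      (f' (v + t * (u - v)) * (u - v) - f' v * (u - v) - c * t * (u - v) ^ 2) t := fun t ht => by
    have hline : HasDerivAt (fun t => v + t * (u - v)) (u - v) t := by
      simpa using ((hasDerivAt_id t).mul_const (u - v)).const_add v
    have hlin : HasDerivAt (fun t => t * (f' v * (u - v))) (f' v * (u - v)) t := by
      simpa using (hasDerivAt_id t).mul_const (f' v * (u - v))
    have hsq : HasDerivAt (fun t => c / 2 * (t * (u - v)) ^ 2) (c * t * (u - v) ^ 2) t :=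
      ((((hasDerivAt_id' t).mul_const (u - v)).fun_pow 2).const_mul (c / 2)).congr_deriv
        (by push_cast; ring)
    exact (((hf _ (hmem t ht)).comp t hline).sub hlin).sub hsq
  obtain ⟨t, ht, hslope⟩ := exists_hasDerivAt_eq_slope D _ one_pos
    (fun t ht => (hD t ht).continuousAt.continuousWithinAt)
    fun t ht => hD t (Set.Ioo_subset_Icc_self ht)
  have hnonneg : 0 ≤ (f' (v + t * (u - v)) * (u - v) - f' v * (u - v) - c * t * (u - v) ^ 2) := by
    have := hmono _ (hmem t (Set.Ioo_subset_Icc_self ht))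
    refine nonneg_of_mul_nonneg_right (a := t) ?_ ht.1
    linarith
  simp only [hslope, D, one_mul, zero_mul, sub_zero, div_one, add_zero, add_sub_cancel,
    zero_pow two_ne_zero, mul_zero] at hnonneg
  linarith

lemma add_mul_exp_le {a b B u : ℝ} (ha : 0 ≤ a) (hb : 0 ≤ b) (hu : |u| ≤ B) :
    a + b * Real.exp u ≤ (a + b) * Real.exp B := by
  have hone : a * 1 ≤ a * Real.exp B :=
    mul_le_mul_of_nonneg_left (Real.one_le_exp ((abs_nonneg u).trans hu)) ha
  have hexp : b * Real.exp u ≤ b * Real.exp B :=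
    mul_le_mul_of_nonneg_left (Real.exp_le_exp.2 ((le_abs_self u).trans hu)) hb
  linarith

lemma exp_neg_mul_sub_le_exp_sub_exp {B u v : ℝ} (hv : |v| ≤ B) (huv : v ≤ u) :
    Real.exp (-B) * (u - v) ≤ Real.exp u - Real.exp v := by
  calc Real.exp (-B) * (u - v)
      ≤ Real.exp v * (Real.exp (u - v) - 1) :=
        mul_le_mul (Real.exp_le_exp.2 (abs_le.1 hv).1) (by linarith [Real.add_one_le_exp (u - v)])
          (by linarith) (Real.exp_pos v).le
    _ = Real.exp u - Real.exp v := by rw [mul_sub_one, ← Real.exp_add, add_sub_cancel]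

lemma logistic_strongly_mono {a b κ B u v : ℝ} (hκ : 0 < κ) (hab : 0 < a + b)
    (ha : κ * (a + b) ≤ a) (hb : κ * (a + b) ≤ b) (hu : |u| ≤ B) (hv : |v| ≤ B) :
    κ ^ 2 * Real.exp (-3 * B) * (u - v) ^ 2 ≤
      (b * Real.exp u / (a + b * Real.exp u) - b * Real.exp v / (a + b * Real.exp v)) *
        (u - v) := by
  wlog huv : v ≤ u generalizing u v
  · linarith [this hv hu (not_le.1 huv).le]
  rw [pow_two (u - v), ← mul_assoc]
  refine mul_le_mul_of_nonneg_right ?_ (sub_nonneg.2 huv)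
  have ha0 : 0 < a := (mul_pos hκ hab).trans_le ha
  have hb0 : 0 < b := (mul_pos hκ hab).trans_le hb
  have hdiff : b * Real.exp u / (a + b * Real.exp u) - b * Real.exp v / (a + b * Real.exp v) =
      a * b * (Real.exp u - Real.exp v) / ((a + b * Real.exp u) * (a + b * Real.exp v)) := by
    field_simp
    ring
  have hden : (a + b * Real.exp u) * (a + b * Real.exp v) ≤
      ((a + b) * Real.exp B) * ((a + b) * Real.exp B) :=
    mul_le_mul (add_mul_exp_le ha0.le hb0.le hu) (add_mul_exp_le ha0.le hb0.le hv) (by positivity)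
      (by positivity)
  have hexp : Real.exp (-3 * B) * (Real.exp B * Real.exp B) = Real.exp (-B) := by
    rw [← Real.exp_add, ← Real.exp_add]
    ring_nf
  rw [hdiff, le_div_iff₀ (by positivity)]
  calc κ ^ 2 * Real.exp (-3 * B) * (u - v) * ((a + b * Real.exp u) * (a + b * Real.exp v))
      ≤ κ ^ 2 * Real.exp (-3 * B) * (u - v) * (((a + b) * Real.exp B) * ((a + b) * Real.exp B)) :=
        mul_le_mul_of_nonneg_left hden (mul_nonneg (by positivity) (sub_nonneg.2 huv))
    _ = (κ * (a + b)) * (κ * (a + b)) * (Real.exp (-B) * (u - v)) := by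
        rw [← hexp]
        ring
    _ ≤ a * b * (Real.exp u - Real.exp v) :=
        mul_le_mul (mul_le_mul ha hb (by positivity) ha0.le)
          (exp_neg_mul_sub_le_exp_sub_exp hv huv)
          (mul_nonneg (Real.exp_pos _).le (sub_nonneg.2 huv)) (by positivity)

lemma log_add_mul_exp_strongly_convex {a b κ B u v : ℝ} (hκ : 0 < κ) (hab : 0 < a + b)
    (ha : κ * (a + b) ≤ a) (hb : κ * (a + b) ≤ b) (hu : |u| ≤ B) (hv : |v| ≤ B) :
    κ ^ 2 * Real.exp (-3 * B) / 2 * (u - v) ^ 2 ≤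
      Real.log (a + b * Real.exp u) - Real.log (a + b * Real.exp v)
        - b * Real.exp v / (a + b * Real.exp v) * (u - v) := by
  have ha0 : 0 < a := (mul_pos hκ hab).trans_le ha
  have hb0 : 0 < b := (mul_pos hκ hab).trans_le hb
  refine half_mul_sq_le_of_deriv_strongly_mono
    (f' := fun w => b * Real.exp w / (a + b * Real.exp w))
    (fun w _ => (((Real.hasDerivAt_exp w).const_mul b).const_add a).log (by positivity))
    fun w hw => logistic_strongly_mono hκ hab ha hb ?_ hv
  exact abs_le.2 (Set.uIcc_subset_Icc (abs_le.1 hv) (abs_le.1 hu) hw)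

lemma abs_inv_add_mul_exp_sub_le {a b : ℝ} (ha : 0 < a) (hb : 0 < b) (u v : ℝ) :
    |(a + b * Real.exp u)⁻¹ - (a + b * Real.exp v)⁻¹| ≤ a⁻¹ * |u - v| := by
  refine Convex.norm_image_sub_le_of_norm_hasDerivWithin_le (s := Set.univ)
    (f := fun w => (a + b * Real.exp w)⁻¹) (f' := fun w => -(b * Real.exp w) /
      (a + b * Real.exp w) ^ 2)
    (fun w _ => ((((Real.hasDerivAt_exp w).const_mul b).const_add a).fun_inv
      (by positivity)).hasDerivWithinAt) (fun w _ => ?_) convex_univ (Set.mem_univ v)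
    (Set.mem_univ u)
  have hw : 0 < b * Real.exp w := by positivity
  rw [Real.norm_eq_abs, neg_div, abs_neg, abs_of_pos (by positivity), inv_eq_one_div,
    div_le_div_iff₀ (by positivity) ha]
  nlinarith

lemma abs_exp_div_sub_le {a b : ℝ} (ha : 0 < a) (hb : 0 < b) (u v : ℝ) :
    |Real.exp u / (a + b * Real.exp u) - Real.exp v / (a + b * Real.exp v)| ≤
      b⁻¹ * |u - v| := by
  have hflip : ∀ w, Real.exp w / (a + b * Real.exp w) = (b + a * Real.exp (-w))⁻¹ := fun w => by
    rw [Real.exp_neg]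
    field
  rw [hflip, hflip, abs_sub_comm u v, ← neg_sub_neg u v]
  exact abs_inv_add_mul_exp_sub_le hb ha _ _

lemma abs_log_le {s : ℝ} (hs : |s - 1| ≤ 1 / 2) : |Real.log s| ≤ 2 * |s - 1| := by
  have hs0 : 0 < s := by linarith [(abs_le.1 hs).1]
  have hupper := Real.log_le_sub_one_of_pos hs0
  have hlower := Real.one_sub_inv_le_log_of_pos hs0
  have hinv : |1 - s⁻¹| ≤ 2 * |s - 1| := by
    have hsinv : s⁻¹ ≤ 2 := by
      rw [inv_le_comm₀ hs0 two_pos]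
      linarith [(abs_le.1 hs).1]
    rw [show 1 - s⁻¹ = s⁻¹ * (s - 1) by field, abs_mul, abs_of_pos (inv_pos.2 hs0)]
    exact mul_le_mul_of_nonneg_right hsinv (abs_nonneg _)
  refine abs_le.2 ⟨(abs_le.1 hinv).1.trans hlower, hupper.trans ?_⟩
  linarith [le_abs_self (s - 1), abs_nonneg (s - 1)]

lemma sq_sqrt_sub_one_le {a : ℝ} (ha : 0 < a) : (√a - 1) ^ 2 ≤ a - 1 - Real.log a := by
  have hlog := Real.log_le_sub_one_of_pos (Real.sqrt_pos.2 ha)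
  rw [Real.log_sqrt ha.le] at hlog
  linarith [Real.sq_sqrt ha.le]

lemma abs_sub_one_le_sq_add {a : ℝ} (ha : 0 ≤ a) :
    |a - 1| ≤ (√a - 1) ^ 2 + 2 * |√a - 1| := by
  have hsplit : a - 1 = (√a - 1) ^ 2 + 2 * (√a - 1) := by linarith [Real.sq_sqrt ha]
  rw [hsplit]
  refine (abs_add_le _ _).trans ?_
  rw [abs_of_nonneg (sq_nonneg _), abs_mul, abs_two]

/-- Of Pinsker type, from `∑ (√aᵢ - 1)² ≤ -∑ log aᵢ`. -/
lemma sum_abs_sub_one_mul_le {ι : Type*} [Fintype ι] {a k : ι → ℝ} {K L : ℝ}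
    (ha : ∀ i, 0 < a i) (hsum : ∑ i, a i = Fintype.card ι) (hK : -∑ i, Real.log (a i) ≤ K)
    (hk : ∀ i, 0 ≤ k i) (hL0 : 0 ≤ L) (hL : ∀ i, k i ≤ L) :
    ∑ i, |a i - 1| * k i ≤ K * L + 2 * √(K * ∑ i, k i ^ 2) := by
  have hsq : ∑ i, (√(a i) - 1) ^ 2 ≤ K := by
    calc ∑ i, (√(a i) - 1) ^ 2 ≤ ∑ i, (a i - 1 - Real.log (a i)) :=
          Finset.sum_le_sum fun i _ => sq_sqrt_sub_one_le (ha i)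
      _ = -∑ i, Real.log (a i) := by simp [Finset.sum_sub_distrib, hsum]
      _ ≤ K := hK
  have hcs : ∑ i, |√(a i) - 1| * k i ≤ √(K * ∑ i, k i ^ 2) := by
    refine Real.le_sqrt_of_sq_le ((Finset.sum_mul_sq_le_sq_mul_sq _ _ _).trans ?_)
    simp only [sq_abs]
    exact mul_le_mul_of_nonneg_right hsq (Finset.sum_nonneg fun i _ => sq_nonneg _)
  calc ∑ i, |a i - 1| * k i
      ≤ ∑ i, ((√(a i) - 1) ^ 2 * L + 2 * (|√(a i) - 1| * k i)) := by
        refine Finset.sum_le_sum fun i _ => ?_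
        have habs := mul_le_mul_of_nonneg_right (abs_sub_one_le_sq_add (ha i).le) (hk i)
        have hL' := mul_le_mul_of_nonneg_left (hL i) (sq_nonneg (√(a i) - 1))
        linarith
    _ = (∑ i, (√(a i) - 1) ^ 2) * L + 2 * ∑ i, |√(a i) - 1| * k i := by
        rw [Finset.sum_add_distrib, Finset.sum_mul, Finset.mul_sum]
    _ ≤ K * L + 2 * √(K * ∑ i, k i ^ 2) := by gcongr

end Elementary

/-! ### Calibration of the weights -/

section Blocks

lemma norm_sq_eq_blocks (θ : Param p q) :
    ‖θ‖ ^ 2 = gam θ ^ 2 + astar θ ^ 2 + ‖bet θ‖ ^ 2 + ‖mom θ‖ ^ 2 := by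
  simp only [EuclideanSpace.norm_sq_eq, Fintype.sum_sum_type, gam, astar, bet, mom,
    Finset.univ_unique, Finset.sum_singleton, PUnit.default_eq_unit, Real.norm_eq_abs, sq_abs]
  ring

lemma norm_le_sum_blocks (θ : Param p q) :
    ‖θ‖ ≤ |gam θ| + |astar θ| + ‖bet θ‖ + ‖mom θ‖ := by
  refine (abs_le_of_sq_le_sq' ?_ (by positivity)).2
  rw [norm_sq_eq_blocks, ← sq_abs (gam θ), ← sq_abs (astar θ)]
  have hga : 0 ≤ |gam θ| * |astar θ| := by positivity
  have hgb : 0 ≤ (|gam θ| + |astar θ|) * ‖bet θ‖ := by positivity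
  have hgm : 0 ≤ (|gam θ| + |astar θ| + ‖bet θ‖) * ‖mom θ‖ := by positivity
  linarith

lemma abs_gam_le (θ : Param p q) : |gam θ| ≤ ‖θ‖ := PiLp.norm_apply_le θ _

lemma abs_astar_le (θ : Param p q) : |astar θ| ≤ ‖θ‖ := PiLp.norm_apply_le θ _

lemma norm_bet_le (θ : Param p q) : ‖bet θ‖ ≤ ‖θ‖ := by
  refine (abs_le_of_sq_le_sq' ?_ (norm_nonneg _)).2
  rw [norm_sq_eq_blocks]
  linarith [sq_nonneg (gam θ), sq_nonneg (astar θ), sq_nonneg ‖mom θ‖]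

lemma gam_sub (θ θ' : Param p q) : gam (θ - θ') = gam θ - gam θ' := rfl

lemma astar_sub (θ θ' : Param p q) : astar (θ - θ') = astar θ - astar θ' := rfl

lemma bet_sub (θ θ' : Param p q) : bet (θ - θ') = bet θ - bet θ' := rfl

lemma mom_sub (θ θ' : Param p q) : mom (θ - θ') = mom θ - mom θ' := rfl

lemma tilt_pos (θ : Param p q) (x : Vec p) : 0 < tilt θ x := Real.exp_pos _

/-- The distance between the regression blocks `(α*, β)` of two parameters, on which alone the
tilt depends. -/
def regressionDist (θ θ' : Param p q) : ℝ := |astar θ - astar θ'| + ‖bet θ - bet θ'‖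

lemma regressionDist_nonneg (θ θ' : Param p q) : 0 ≤ regressionDist θ θ' := by
  unfold regressionDist
  positivity

lemma norm_sub_le_blocks (θ θ' : Param p q) :
    ‖θ - θ'‖ ≤ |gam θ - gam θ'| + regressionDist θ θ' + ‖mom θ - mom θ'‖ := by
  have hblocks := norm_le_sum_blocks (θ - θ')
  rw [gam_sub, astar_sub, bet_sub, mom_sub] at hblocks
  unfold regressionDist
  linarith

lemma abs_linPred_le {Λ : ℝ} {θ : Param p q} (hθ : ‖θ‖ ≤ Λ) (x : Vec p) :
    |astar θ + inner ℝ (bet θ) x| ≤ Λ * (1 + ‖x‖) := by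
  calc |astar θ + inner ℝ (bet θ) x| ≤ |astar θ| + ‖bet θ‖ * ‖x‖ :=
        (abs_add_le _ _).trans (add_le_add_right (abs_real_inner_le_norm _ _) _)
    _ ≤ Λ + Λ * ‖x‖ := by
        gcongr
        exacts [(abs_astar_le θ).trans hθ, (norm_bet_le θ).trans hθ]
    _ = Λ * (1 + ‖x‖) := by ring

lemma linPred_sub_linPred (θ θ' : Param p q) (x : Vec p) :
    (astar θ + inner ℝ (bet θ) x) - (astar θ' + inner ℝ (bet θ') x) =
      (astar θ - astar θ') + inner ℝ (bet θ - bet θ') x := by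
  rw [inner_sub_left]
  ring

lemma abs_linPred_sub_le (θ θ' : Param p q) (x : Vec p) :
    |(astar θ + inner ℝ (bet θ) x) - (astar θ' + inner ℝ (bet θ') x)| ≤
      regressionDist θ θ' * (1 + ‖x‖) := by
  rw [linPred_sub_linPred]
  calc |(astar θ - astar θ') + inner ℝ (bet θ - bet θ') x|
      ≤ |astar θ - astar θ'| + ‖bet θ - bet θ'‖ * ‖x‖ :=
        (abs_add_le _ _).trans (add_le_add_right (abs_real_inner_le_norm _ _) _)
    _ ≤ |astar θ - astar θ'| + ‖bet θ - bet θ'‖ * ‖x‖ +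
          (|astar θ - astar θ'| * ‖x‖ + ‖bet θ - bet θ'‖) := le_add_of_nonneg_right (by positivity)
    _ = regressionDist θ θ' * (1 + ‖x‖) := by
        unfold regressionDist
        ring

end Blocks

section PooledDensity

/-- The intensity of a sample of `n₁` cases and `n₀` controls relative to the law of the controls,
when `tilt θ` is the density of the law of the cases relative to that of the controls. -/
def pooledDensity (n₁ n₀ : ℝ) (θ : Param p q) (x : Vec p) : ℝ := n₀ + n₁ * tilt θ x

variable {n₁ n₀ : ℝ}

lemma pooledDensity_pos (h1 : 0 < n₁) (h0 : 0 < n₀) (θ : Param p q) (x : Vec p) :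
    0 < pooledDensity n₁ n₀ θ x :=
  add_pos h0 (mul_pos h1 (tilt_pos θ x))

lemma inv_pooledDensity_le (h1 : 0 < n₁) (h0 : 0 < n₀) (θ : Param p q) (x : Vec p) :
    (pooledDensity n₁ n₀ θ x)⁻¹ ≤ n₀⁻¹ :=
  inv_anti₀ h0 (le_add_of_nonneg_right (mul_pos h1 (tilt_pos θ x)).le)

lemma tilt_div_pooledDensity_le (h1 : 0 < n₁) (h0 : 0 < n₀) (θ : Param p q) (x : Vec p) :
    tilt θ x / pooledDensity n₁ n₀ θ x ≤ n₁⁻¹ := by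
  rw [div_le_iff₀ (pooledDensity_pos h1 h0 θ x), pooledDensity, mul_add,
    inv_mul_cancel_left₀ h1.ne']
  exact le_add_of_nonneg_left (by positivity)

lemma abs_inv_pooledDensity_sub_le (h1 : 0 < n₁) (h0 : 0 < n₀) (θ θ' : Param p q) (x : Vec p) :
    |(pooledDensity n₁ n₀ θ x)⁻¹ - (pooledDensity n₁ n₀ θ' x)⁻¹| ≤
      n₀⁻¹ * (regressionDist θ θ' * (1 + ‖x‖)) :=
  (abs_inv_add_mul_exp_sub_le h0 h1 _ _).trans
    (mul_le_mul_of_nonneg_left (abs_linPred_sub_le θ θ' x) (by positivity))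

lemma abs_tilt_div_pooledDensity_sub_le (h1 : 0 < n₁) (h0 : 0 < n₀) (θ θ' : Param p q)
    (x : Vec p) :
    |tilt θ x / pooledDensity n₁ n₀ θ x - tilt θ' x / pooledDensity n₁ n₀ θ' x| ≤
      n₁⁻¹ * (regressionDist θ θ' * (1 + ‖x‖)) :=
  (abs_exp_div_sub_le h0 h1 _ _).trans
    (mul_le_mul_of_nonneg_left (abs_linPred_sub_le θ θ' x) (by positivity))

variable {ι : Type*} [Fintype ι] {h : Vec p → Vec q} {Θ : Set (Param p q)} {x : ι → Vec p}
  {θ : Param p q} {w : ι → ℝ}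

lemma sum_inv_pooledDensity_add (h1 : 0 < n₁) (h0 : 0 < n₀) (θ : Param p q) (x : ι → Vec p) :
    n₀ * ∑ i, (pooledDensity n₁ n₀ θ (x i))⁻¹ +
      n₁ * ∑ i, tilt θ (x i) / pooledDensity n₁ n₀ θ (x i) = Fintype.card ι := by
  have hone : ∀ i, n₀ * (pooledDensity n₁ n₀ θ (x i))⁻¹ +
      n₁ * (tilt θ (x i) / pooledDensity n₁ n₀ θ (x i)) = 1 := fun i => by
    rw [← div_eq_mul_inv, ← mul_div_assoc, ← add_div]
    exact div_self (pooledDensity_pos h1 h0 θ (x i)).ne'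
  rw [Finset.mul_sum, Finset.mul_sum, ← Finset.sum_add_distrib]
  simp only [hone, Finset.sum_const, Finset.card_univ, nsmul_eq_mul, mul_one]

lemma Feasible.sum_mul_pooledDensity (hf : Feasible h Θ x θ w) (n₁ n₀ : ℝ) :
    ∑ i, w i * pooledDensity n₁ n₀ θ (x i) = n₀ + n₁ := by
  calc ∑ i, w i * pooledDensity n₁ n₀ θ (x i)
      = n₀ * ∑ i, w i + n₁ * ∑ i, tilt θ (x i) * w i := by
        rw [Finset.mul_sum, Finset.mul_sum, ← Finset.sum_add_distrib]
        exact Finset.sum_congr rfl fun i _ => by unfold pooledDensity; ring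
    _ = n₀ + n₁ := by rw [hf.total, hf.total_tilt, mul_one, mul_one]

lemma Feasible.mom_eq (hf : Feasible h Θ x θ w) (h1 : 0 < n₁) (h0 : 0 < n₀) :
    mom θ = (1 + Real.exp (gam θ))⁻¹ •
      (∑ i, (w i * pooledDensity n₁ n₀ θ (x i) *
          (tilt θ (x i) / pooledDensity n₁ n₀ θ (x i))) • h (x i) +
        Real.exp (gam θ) • ∑ i, (w i * pooledDensity n₁ n₀ θ (x i) *
          (pooledDensity n₁ n₀ θ (x i))⁻¹) • h (x i)) := by
  rw [← hf.moment, Finset.smul_sum, ← Finset.sum_add_distrib, Finset.smul_sum]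
  refine Finset.sum_congr rfl fun i _ => ?_
  have hd := (pooledDensity_pos h1 h0 θ (x i)).ne'
  rw [smul_smul, ← add_smul, smul_smul]
  congr 1
  field_simp

/-- The logistic log-likelihood of `θ` given the pooled covariates, up to the constant
`(∑ yᵢ) log n₁`. -/
def logisticLik (n₁ n₀ : ℝ) (y : ι → ℝ) (x : ι → Vec p) (θ : Param p q) : ℝ :=
  ∑ i, (y i * (astar θ + inner ℝ (bet θ) (x i)) - Real.log (pooledDensity n₁ n₀ θ (x i)))

lemma Feasible.objective_eq_logisticLik (hf : Feasible h Θ x θ w) (h1 : 0 < n₁) (h0 : 0 < n₀)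
    (W : Matrix (Fin q) (Fin q) ℝ) (N : ℕ) (m : Vec q) (y : ι → ℝ) :
    objective W N m y x θ w = logisticLik n₁ n₀ y x θ +
      ∑ i, Real.log (w i * pooledDensity n₁ n₀ θ (x i)) - penalty W N m (mom θ) := by
  simp only [objective, logisticLik]
  rw [← Finset.sum_add_distrib]
  congr 1
  refine Finset.sum_congr rfl fun i _ => ?_
  rw [Real.log_mul (hf.pos i).ne' (pooledDensity_pos h1 h0 θ (x i)).ne']
  ring

lemma Feasible.mono {Θ' : Set (Param p q)} (hf : Feasible h Θ x θ w) (hθ : θ ∈ Θ') :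
    Feasible h Θ' x θ w :=
  ⟨hθ, hf.pos, hf.total, hf.total_tilt, hf.moment⟩

end PooledDensity

section Calibration

variable {ι : Type*} [Fintype ι]

/-- The weights proportional to `1 / dᵢ`. -/
def calibratedWeight (d : ι → ℝ) (i : ι) : ℝ := (∑ j, (d j)⁻¹)⁻¹ * (d i)⁻¹

/-- The modification of `θ` that is feasible together with `calibratedWeight d`: the intercept and
the moment block are adjusted so as to meet the constraints exactly. -/
def calibratedParam (h : Vec p → Vec q) (x : ι → Vec p) (d : ι → ℝ) (θ : Param p q) : Param p q :=
  mkParam (gam θ)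
    (astar θ + (Real.log (∑ i, (d i)⁻¹) - Real.log (∑ i, tilt θ (x i) / d i))) (bet θ)
    ((1 + Real.exp (gam θ))⁻¹ •
      ((∑ i, tilt θ (x i) / d i)⁻¹ • ∑ i, (tilt θ (x i) / d i) • h (x i) +
        Real.exp (gam θ) • ((∑ i, (d i)⁻¹)⁻¹ • ∑ i, (d i)⁻¹ • h (x i))))

variable {h : Vec p → Vec q} {x : ι → Vec p} {d : ι → ℝ} {θ : Param p q}

lemma tilt_calibratedParam (hs : 0 < ∑ i, (d i)⁻¹) (ht : 0 < ∑ i, tilt θ (x i) / d i)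
    (z : Vec p) : tilt (calibratedParam h x d θ) z =
      (∑ i, (d i)⁻¹) / (∑ i, tilt θ (x i) / d i) * tilt θ z := by
  rw [tilt, calibratedParam, astar_mkParam, bet_mkParam, tilt, add_right_comm,
    Real.exp_add, Real.exp_sub, Real.exp_log hs, Real.exp_log ht, mul_comm]

lemma feasible_calibratedParam [Nonempty ι] (hd : ∀ i, 0 < d i) :
    Feasible h Set.univ x (calibratedParam h x d θ) (calibratedWeight d) := by
  have hs : 0 < ∑ i, (d i)⁻¹ := Finset.sum_pos (fun i _ => inv_pos.2 (hd i)) Finset.univ_nonempty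
  have ht : 0 < ∑ i, tilt θ (x i) / d i :=
    Finset.sum_pos (fun i _ => div_pos (tilt_pos _ _) (hd i)) Finset.univ_nonempty
  have htilt := tilt_calibratedParam (h := h) hs ht
  have hscale : ∀ i, tilt (calibratedParam h x d θ) (x i) * calibratedWeight d i =
      (∑ i, tilt θ (x i) / d i)⁻¹ * (tilt θ (x i) / d i) := fun i => by
    rw [htilt, calibratedWeight]
    field
  refine ⟨Set.mem_univ _, fun i => mul_pos (inv_pos.2 hs) (inv_pos.2 (hd i)), ?_, ?_, ?_⟩
  · simp only [calibratedWeight]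
    rw [← Finset.mul_sum, inv_mul_cancel₀ hs.ne']
  · simp only [hscale]
    rw [← Finset.mul_sum, inv_mul_cancel₀ ht.ne']
  · simp only [div_mul_eq_mul_div, add_mul, hscale]
    simp only [calibratedWeight, calibratedParam, gam_mkParam, mom_mkParam, Finset.smul_sum]
    rw [← Finset.sum_add_distrib, Finset.smul_sum]
    refine Finset.sum_congr rfl fun i _ => ?_
    module

lemma objective_calibratedParam [Nonempty ι] (hd : ∀ i, 0 < d i) (W : Matrix (Fin q) (Fin q) ℝ)
    (N : ℕ) (m : Vec q) (y : ι → ℝ) :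
    objective W N m y x (calibratedParam h x d θ) (calibratedWeight d) =
      ∑ i, (y i * (astar θ + inner ℝ (bet θ) (x i)) - Real.log (d i)) +
        ((∑ i, y i) * (Real.log (∑ i, (d i)⁻¹) - Real.log (∑ i, tilt θ (x i) / d i)) -
          Fintype.card ι * Real.log (∑ i, (d i)⁻¹)) -
        penalty W N m (mom (calibratedParam h x d θ)) := by
  have hs : 0 < ∑ i, (d i)⁻¹ := Finset.sum_pos (fun i _ => inv_pos.2 (hd i)) Finset.univ_nonempty
  have hlog : ∀ i, Real.log (calibratedWeight d i) =
      -Real.log (∑ i, (d i)⁻¹) - Real.log (d i) := fun i => by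
    rw [calibratedWeight, Real.log_mul (inv_ne_zero hs.ne') (inv_ne_zero (hd i).ne'),
      Real.log_inv, Real.log_inv, sub_eq_add_neg]
  rw [objective, Finset.sum_mul, ← nsmul_eq_mul, ← Finset.card_univ, ← Finset.sum_const,
    ← Finset.sum_sub_distrib, ← Finset.sum_add_distrib]
  congr 1
  refine Finset.sum_congr rfl fun i _ => ?_
  rw [hlog, calibratedParam, astar_mkParam, bet_mkParam]
  ring

end Calibration

/-! ### Regular samples -/

section RegularSample

variable {ι : Type*} [Fintype ι]

/-- The empirical averages entering the analysis of a case-control sample of `n₁` cases and `n₀`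
controls are within `ε r` of their population values, where `r = n^(-1/3)`. The vectors `E₀` and
`E₁` stand for the means of `h(X)` among controls and among cases. -/
structure RegularSample (h : Vec p → Vec q) (θ₀ : Param p q) (E₀ E₁ : Vec q) (κ M cG B : ℝ)
    (n₁ n₀ r ε : ℝ) (y : ι → ℝ) (x : ι → Vec p) : Prop where
  κ_pos : 0 < κ
  r_pos : 0 < r
  card_eq : n₀ + n₁ = Fintype.card ι
  card_mul : (Fintype.card ι : ℝ) * r ^ 3 = 1
  controls : κ * Fintype.card ι ≤ n₀
  cases : κ * Fintype.card ι ≤ n₁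
  response : ∑ i, y i = n₁
  inv_mass : |∑ i, (pooledDensity n₁ n₀ θ₀ (x i))⁻¹ - 1| ≤ ε * r
  tilt_mass : |∑ i, tilt θ₀ (x i) / pooledDensity n₁ n₀ θ₀ (x i) - 1| ≤ ε * r
  inv_summary : ‖∑ i, (pooledDensity n₁ n₀ θ₀ (x i))⁻¹ • h (x i) - E₀‖ ≤ ε * r
  tilt_summary : ‖∑ i, (tilt θ₀ (x i) / pooledDensity n₁ n₀ θ₀ (x i)) • h (x i) - E₁‖ ≤ ε * r
  score : ‖∑ i, (y i - n₁ * (tilt θ₀ (x i) / pooledDensity n₁ n₀ θ₀ (x i))) • x i‖ ≤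
    ε * (Fintype.card ι * r)
  moment : ∑ i, (1 + ‖x i‖ + ‖h (x i)‖) ^ 3 ≤ M * Fintype.card ι
  gram : ∀ (a : ℝ) (b : Vec p), cG * Fintype.card ι * (a ^ 2 + ‖b‖ ^ 2) ≤
    ∑ i, Real.exp (-B * ‖x i‖) * (a + inner ℝ b (x i)) ^ 2

namespace RegularSample

variable {h : Vec p → Vec q} {θ₀ : Param p q} {E₀ E₁ : Vec q} {κ M cG B n₁ n₀ r ε : ℝ} {y : ι → ℝ}
  {x : ι → Vec p}

section

variable (S : RegularSample h θ₀ E₀ E₁ κ M cG B n₁ n₀ r ε y x)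

include S

lemma card_pos : 0 < (Fintype.card ι : ℝ) :=
  pos_of_mul_pos_left (S.card_mul ▸ one_pos) (pow_pos S.r_pos 3).le

lemma nonempty : Nonempty ι :=
  Fintype.card_pos_iff.1 (Nat.cast_pos.1 S.card_pos)

lemma cases_pos : 0 < n₁ := (mul_pos S.κ_pos S.card_pos).trans_le S.cases

lemma controls_pos : 0 < n₀ := (mul_pos S.κ_pos S.card_pos).trans_le S.controls

lemma error_nonneg : 0 ≤ ε * r := (abs_nonneg _).trans S.inv_mass

lemma r_le_one : r ≤ 1 := by
  have hcard : (1 : ℝ) ≤ Fintype.card ι :=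
    Nat.one_le_cast.2 (Nat.cast_pos (α := ℝ).1 S.card_pos)
  refine (pow_le_one_iff_of_nonneg S.r_pos.le (n := 3) three_ne_zero).1 ?_
  exact (le_mul_of_one_le_left (pow_nonneg S.r_pos.le 3) hcard).trans_eq S.card_mul

lemma one_le_moment_bound : 1 ≤ M := by
  refine le_of_mul_le_mul_right (le_trans ?_ S.moment) S.card_pos
  rw [one_mul, ← nsmul_one, ← Finset.card_univ]
  exact Finset.card_nsmul_le_sum _ _ _ fun i _ => one_le_pow₀
    (by linarith [norm_nonneg (x i), norm_nonneg (h (x i))])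

lemma sum_le_of_le_cube {f : ι → ℝ} (hf : ∀ i, f i ≤ (1 + ‖x i‖ + ‖h (x i)‖) ^ 3) :
    ∑ i, f i ≤ M * Fintype.card ι :=
  (Finset.sum_le_sum fun i _ => hf i).trans S.moment

lemma sum_summary_le : ∑ i, (1 + ‖x i‖) * ‖h (x i)‖ ≤ M * Fintype.card ι := by
  refine S.sum_le_of_le_cube fun i => ?_
  calc (1 + ‖x i‖) * ‖h (x i)‖
      ≤ (1 + ‖x i‖ + ‖h (x i)‖) * (1 + ‖x i‖ + ‖h (x i)‖) :=
        mul_le_mul (le_add_of_nonneg_right (norm_nonneg _)) (le_add_of_nonneg_left (by positivity))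
          (norm_nonneg _) (by positivity)
    _ = (1 + ‖x i‖ + ‖h (x i)‖) ^ 2 := (sq _).symm
    _ ≤ (1 + ‖x i‖ + ‖h (x i)‖) ^ 3 := pow_le_pow_right₀
        (by linarith [norm_nonneg (x i), norm_nonneg (h (x i))]) (Nat.le_succ 2)

lemma sum_sq_summary_le : ∑ i, ‖h (x i)‖ ^ 2 ≤ M * Fintype.card ι := by
  refine S.sum_le_of_le_cube fun i => ?_
  calc ‖h (x i)‖ ^ 2 ≤ (1 + ‖x i‖ + ‖h (x i)‖) ^ 2 :=
        pow_le_pow_left₀ (norm_nonneg _) (le_add_of_nonneg_left (by positivity)) 2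
    _ ≤ (1 + ‖x i‖ + ‖h (x i)‖) ^ 3 := pow_le_pow_right₀
        (by linarith [norm_nonneg (x i), norm_nonneg (h (x i))]) (Nat.le_succ 2)

-- A single summand is at most the sum of all cubes, and `n = r⁻³`.
lemma summary_le (i : ι) : ‖h (x i)‖ ≤ M / r := by
  have hM := S.one_le_moment_bound
  have hr := S.r_pos
  have hcube : ‖h (x i)‖ ^ 3 ≤ M * Fintype.card ι := by
    calc ‖h (x i)‖ ^ 3 ≤ (1 + ‖x i‖ + ‖h (x i)‖) ^ 3 :=
          pow_le_pow_left₀ (norm_nonneg _) (le_add_of_nonneg_left (by positivity)) 3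
      _ ≤ ∑ i, (1 + ‖x i‖ + ‖h (x i)‖) ^ 3 :=
          Finset.single_le_sum (f := fun i => (1 + ‖x i‖ + ‖h (x i)‖) ^ 3)
            (fun j _ => by positivity) (Finset.mem_univ i)
      _ ≤ M * Fintype.card ι := S.moment
  rw [le_div_iff₀ hr]
  refine le_of_pow_le_pow_left₀ three_ne_zero (zero_le_one.trans hM) ?_
  calc (‖h (x i)‖ * r) ^ 3 = ‖h (x i)‖ ^ 3 * r ^ 3 := mul_pow _ _ _
    _ ≤ M * Fintype.card ι * r ^ 3 := mul_le_mul_of_nonneg_right hcube (by positivity)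
    _ = M := by rw [mul_assoc, S.card_mul, mul_one]
    _ ≤ M ^ 3 := le_self_pow₀ hM three_ne_zero

end

end RegularSample

end RegularSample

section Calibration

lemma norm_inv_smul_sub_le {E : Type*} [NormedAddCommGroup E] [NormedSpace ℝ E] {s e : ℝ}
    {u v : E} (hs : |s - 1| ≤ e) (he : e ≤ 1 / 2) (hu : ‖u - v‖ ≤ e) :
    ‖s⁻¹ • u - v‖ ≤ 2 * (1 + ‖v‖) * e := by
  have hs0 : 1 / 2 ≤ s := by linarith [(abs_le.1 hs).1]
  have hinv : s⁻¹ ≤ 2 := by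
    rw [inv_le_comm₀ (by linarith) two_pos]
    linarith
  have hinv0 : 0 ≤ s⁻¹ := inv_nonneg.2 (by linarith)
  have hsplit : s⁻¹ • u - v = s⁻¹ • ((u - v) - (s - 1) • v) := by
    rw [smul_sub, smul_smul, mul_sub, inv_mul_cancel₀ (by linarith)]
    module
  rw [hsplit, norm_smul, Real.norm_of_nonneg hinv0, mul_assoc]
  refine mul_le_mul hinv ?_ (norm_nonneg _) two_pos.le
  calc ‖(u - v) - (s - 1) • v‖ ≤ ‖u - v‖ + |s - 1| * ‖v‖ :=
        (norm_sub_le _ _).trans_eq (by rw [norm_smul, Real.norm_eq_abs])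
    _ ≤ e + e * ‖v‖ := by gcongr
    _ = (1 + ‖v‖) * e := by ring

namespace RegularSample

variable {ι : Type*} [Fintype ι] {h : Vec p → Vec q} {θ₀ : Param p q} {E₀ E₁ : Vec q}
  {κ M cG B n₁ n₀ r ε : ℝ} {y : ι → ℝ} {x : ι → Vec p}
  (S : RegularSample h θ₀ E₀ E₁ κ M cG B n₁ n₀ r ε y x)

include S

lemma norm_mom_calibratedParam_sub_le (hε : ε * r ≤ 1 / 2)
    (hμ : mom θ₀ = (1 + Real.exp (gam θ₀))⁻¹ • (E₁ + Real.exp (gam θ₀) • E₀)) :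
    ‖mom (calibratedParam h x (fun i => pooledDensity n₁ n₀ θ₀ (x i)) θ₀) - mom θ₀‖ ≤
      2 * ((1 + ‖E₀‖) + (1 + ‖E₁‖)) * (ε * r) := by
  have he := S.error_nonneg
  have hcase := norm_inv_smul_sub_le S.tilt_mass hε S.tilt_summary
  have hcontrol := norm_inv_smul_sub_le S.inv_mass hε S.inv_summary
  rw [hμ, calibratedParam, mom_mkParam, ← smul_sub, add_sub_add_comm, ← smul_sub, norm_smul,
    norm_inv, Real.norm_of_nonneg (by positivity : 0 ≤ 1 + Real.exp (gam θ₀)),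
    inv_mul_le_iff₀ (by positivity)]
  refine (norm_add_le _ _).trans ?_
  rw [norm_smul, Real.norm_of_nonneg (Real.exp_pos _).le]
  calc _ ≤ 2 * (1 + ‖E₁‖) * (ε * r) + Real.exp (gam θ₀) * (2 * (1 + ‖E₀‖) * (ε * r)) :=
        add_le_add hcase (mul_le_mul_of_nonneg_left hcontrol (Real.exp_pos _).le)
    _ ≤ 2 * (1 + ‖E₁‖) * (ε * r) + Real.exp (gam θ₀) * (2 * (1 + ‖E₀‖) * (ε * r)) +
        (2 * (1 + ‖E₀‖) * (ε * r) + Real.exp (gam θ₀) * (2 * (1 + ‖E₁‖) * (ε * r))) :=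
        le_add_of_nonneg_right (by positivity)
    _ = (1 + Real.exp (gam θ₀)) * (2 * ((1 + ‖E₀‖) + (1 + ‖E₁‖)) * (ε * r)) := by ring

lemma norm_calibratedParam_sub_le (hε : ε * r ≤ 1 / 2)
    (hμ : mom θ₀ = (1 + Real.exp (gam θ₀))⁻¹ • (E₁ + Real.exp (gam θ₀) • E₀)) :
    ‖calibratedParam h x (fun i => pooledDensity n₁ n₀ θ₀ (x i)) θ₀ - θ₀‖ ≤
      (4 + 2 * ((1 + ‖E₀‖) + (1 + ‖E₁‖))) * (ε * r) := by
  have hmom := S.norm_mom_calibratedParam_sub_le hε hμ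
  have hlog := abs_log_le (S.inv_mass.trans hε)
  have hlog' := abs_log_le (S.tilt_mass.trans hε)
  have hblocks := norm_sub_le_blocks
    (calibratedParam h x (fun i => pooledDensity n₁ n₀ θ₀ (x i)) θ₀) θ₀
  have hreg : regressionDist (calibratedParam h x (fun i => pooledDensity n₁ n₀ θ₀ (x i)) θ₀) θ₀ ≤
      4 * (ε * r) := by
    simp only [regressionDist, calibratedParam, astar_mkParam, bet_mkParam, sub_self, norm_zero,
      add_zero, add_sub_cancel_left]
    linarith [abs_sub (Real.log (∑ i, (pooledDensity n₁ n₀ θ₀ (x i))⁻¹))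
      (Real.log (∑ i, tilt θ₀ (x i) / pooledDensity n₁ n₀ θ₀ (x i))), S.inv_mass, S.tilt_mass]
  have hgam : gam (calibratedParam h x (fun i => pooledDensity n₁ n₀ θ₀ (x i)) θ₀) - gam θ₀ = 0 :=
    sub_self _
  rw [hgam, abs_zero] at hblocks
  linarith

lemma logisticLik_sub_penalty_le_objective (W : Matrix (Fin q) (Fin q) ℝ) (N : ℕ) (m : Vec q) :
    logisticLik n₁ n₀ y x θ₀ -
        penalty W N m (mom (calibratedParam h x (fun i => pooledDensity n₁ n₀ θ₀ (x i)) θ₀)) ≤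
      objective W N m y x (calibratedParam h x (fun i => pooledDensity n₁ n₀ θ₀ (x i)) θ₀)
        (calibratedWeight fun i => pooledDensity n₁ n₀ θ₀ (x i)) := by
  have := S.nonempty
  have hd := fun i => pooledDensity_pos S.cases_pos S.controls_pos θ₀ (x i)
  have htotal := sum_inv_pooledDensity_add S.cases_pos S.controls_pos θ₀ x
  have hs : 0 < ∑ i, (pooledDensity n₁ n₀ θ₀ (x i))⁻¹ :=
    Finset.sum_pos (fun i _ => inv_pos.2 (hd i)) Finset.univ_nonempty
  have ht : 0 < ∑ i, tilt θ₀ (x i) / pooledDensity n₁ n₀ θ₀ (x i) :=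
    Finset.sum_pos (fun i _ => div_pos (tilt_pos _ _) (hd i)) Finset.univ_nonempty
  rw [objective_calibratedParam hd, S.response, ← S.card_eq, logisticLik]
  rw [← S.card_eq] at htotal
  -- `n₀ log s + n₁ log t ≤ n₀ (s - 1) + n₁ (t - 1) = 0` for the two masses `s` and `t`.
  have hlogs := mul_le_mul_of_nonneg_left (Real.log_le_sub_one_of_pos hs) S.controls_pos.le
  have hlogt := mul_le_mul_of_nonneg_left (Real.log_le_sub_one_of_pos ht) S.cases_pos.le
  linarith

end RegularSample

end Calibration

/-! ### The basic inequality -/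

section BasicInequality

/-- The curvature of the logistic log-likelihood per observation on the ball of radius `Λ`, for
group proportions at least `κ` and a Gram matrix at least `cG`. -/
def curvature (κ Λ cG : ℝ) : ℝ := κ ^ 2 * Real.exp (-3 * Λ) / 2 * (cG / 2)

lemma curvature_pos {κ Λ cG : ℝ} (hκ : 0 < κ) (hcG : 0 < cG) : 0 < curvature κ Λ cG := by
  unfold curvature
  positivity

variable {ι : Type*} [Fintype ι]

lemma logisticLik_summand_le {κ Λ n₁ n₀ : ℝ} (hκ : 0 < κ) (hn : 0 < n₀ + n₁)
    (h0 : κ * (n₀ + n₁) ≤ n₀) (h1 : κ * (n₀ + n₁) ≤ n₁) {θ θ₀ : Param p q} (hθ : ‖θ‖ ≤ Λ)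
    (hθ₀ : ‖θ₀‖ ≤ Λ) (y : ℝ) (x : Vec p) :
    y * (astar θ + inner ℝ (bet θ) x) - Real.log (pooledDensity n₁ n₀ θ x) ≤
      y * (astar θ₀ + inner ℝ (bet θ₀) x) - Real.log (pooledDensity n₁ n₀ θ₀ x) +
        (y - n₁ * (tilt θ₀ x / pooledDensity n₁ n₀ θ₀ x)) *
          ((astar θ - astar θ₀) + inner ℝ (bet θ - bet θ₀) x) -
        κ ^ 2 * Real.exp (-3 * Λ) / 2 * (Real.exp (-(3 * Λ) * ‖x‖) *
          ((astar θ - astar θ₀) + inner ℝ (bet θ - bet θ₀) x) ^ 2) := by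
  have hconvex := log_add_mul_exp_strongly_convex hκ hn h0 h1 (abs_linPred_le hθ x)
    (abs_linPred_le hθ₀ x)
  have hexp : Real.exp (-3 * (Λ * (1 + ‖x‖))) =
      Real.exp (-3 * Λ) * Real.exp (-(3 * Λ) * ‖x‖) := by
    rw [← Real.exp_add]
    ring_nf
  rw [hexp, mul_div_assoc n₁] at hconvex
  rw [← linPred_sub_linPred]
  unfold pooledDensity tilt
  linarith

namespace RegularSample

variable {h : Vec p → Vec q} {θ₀ : Param p q} {E₀ E₁ : Vec q} {κ M cG B Λ n₁ n₀ r ε : ℝ}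
  {y : ι → ℝ} {x : ι → Vec p}

lemma abs_sum_residual_le (S : RegularSample h θ₀ E₀ E₁ κ M cG B n₁ n₀ r ε y x) :
    |∑ i, (y i - n₁ * (tilt θ₀ (x i) / pooledDensity n₁ n₀ θ₀ (x i)))| ≤
      Fintype.card ι * (ε * r) := by
  have hsum : ∑ i, (y i - n₁ * (tilt θ₀ (x i) / pooledDensity n₁ n₀ θ₀ (x i))) =
      -n₁ * (∑ i, tilt θ₀ (x i) / pooledDensity n₁ n₀ θ₀ (x i) - 1) := by
    rw [Finset.sum_sub_distrib, S.response, ← Finset.mul_sum]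
    ring
  rw [hsum, abs_mul, abs_neg, abs_of_pos S.cases_pos]
  exact mul_le_mul (by linarith [S.card_eq, S.controls_pos]) S.tilt_mass (abs_nonneg _)
    S.card_pos.le

lemma score_le (S : RegularSample h θ₀ E₀ E₁ κ M cG B n₁ n₀ r ε y x) (θ : Param p q) :
    ∑ i, (y i - n₁ * (tilt θ₀ (x i) / pooledDensity n₁ n₀ θ₀ (x i))) *
        ((astar θ - astar θ₀) + inner ℝ (bet θ - bet θ₀) (x i)) ≤
      Fintype.card ι * (ε * r) * regressionDist θ θ₀ := by
  set v : ι → ℝ := fun i => y i - n₁ * (tilt θ₀ (x i) / pooledDensity n₁ n₀ θ₀ (x i))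
  have hsplit : ∑ i, v i * ((astar θ - astar θ₀) + inner ℝ (bet θ - bet θ₀) (x i)) =
      (∑ i, v i) * (astar θ - astar θ₀) + inner ℝ (bet θ - bet θ₀) (∑ i, v i • x i) := by
    simp only [mul_add, Finset.sum_add_distrib, inner_sum, inner_smul_right, Finset.sum_mul]
  have hmass : (∑ i, v i) * (astar θ - astar θ₀) ≤
      Fintype.card ι * (ε * r) * |astar θ - astar θ₀| := by
    refine (le_abs_self _).trans ?_
    rw [abs_mul]
    exact mul_le_mul_of_nonneg_right S.abs_sum_residual_le (abs_nonneg _)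
  have hvec : inner ℝ (bet θ - bet θ₀) (∑ i, v i • x i) ≤
      Fintype.card ι * (ε * r) * ‖bet θ - bet θ₀‖ := by
    refine (real_inner_le_norm _ _).trans ?_
    rw [mul_comm]
    exact mul_le_mul_of_nonneg_right (S.score.trans_eq (by ring)) (norm_nonneg _)
  rw [hsplit, regressionDist, mul_add]
  exact add_le_add hmass hvec

lemma le_gram (S : RegularSample h θ₀ E₀ E₁ κ M cG B n₁ n₀ r ε y x) (hcG : 0 ≤ cG)
    (θ : Param p q) :
    cG / 2 * Fintype.card ι * regressionDist θ θ₀ ^ 2 ≤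
      ∑ i, Real.exp (-B * ‖x i‖) *
        ((astar θ - astar θ₀) + inner ℝ (bet θ - bet θ₀) (x i)) ^ 2 := by
  refine le_trans ?_ (S.gram _ _)
  have hsq : regressionDist θ θ₀ ^ 2 ≤ 2 * (|astar θ - astar θ₀| ^ 2 + ‖bet θ - bet θ₀‖ ^ 2) :=
    add_sq_le
  calc cG / 2 * Fintype.card ι * regressionDist θ θ₀ ^ 2
      ≤ cG / 2 * Fintype.card ι * (2 * (|astar θ - astar θ₀| ^ 2 + ‖bet θ - bet θ₀‖ ^ 2)) :=
        mul_le_mul_of_nonneg_left hsq (by positivity)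
    _ = cG * Fintype.card ι * ((astar θ - astar θ₀) ^ 2 + ‖bet θ - bet θ₀‖ ^ 2) := by
        rw [sq_abs]
        ring

lemma logisticLik_le (S : RegularSample h θ₀ E₀ E₁ κ M cG (3 * Λ) n₁ n₀ r ε y x)
    (hcG : 0 ≤ cG) (hθ₀ : ‖θ₀‖ ≤ Λ) {θ : Param p q} (hθ : ‖θ‖ ≤ Λ) :
    logisticLik n₁ n₀ y x θ ≤ logisticLik n₁ n₀ y x θ₀ +
      Fintype.card ι * (ε * r) * regressionDist θ θ₀ -
      curvature κ Λ cG * Fintype.card ι * regressionDist θ θ₀ ^ 2 := by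
  have hterm := Finset.sum_le_sum fun i (_ : i ∈ Finset.univ) =>
    logisticLik_summand_le S.κ_pos (S.card_eq ▸ S.card_pos) (S.card_eq ▸ S.controls)
      (S.card_eq ▸ S.cases) hθ hθ₀ (y i) (x i)
  simp only [Finset.sum_sub_distrib, Finset.sum_add_distrib, ← Finset.mul_sum] at hterm
  have hgram := mul_le_mul_of_nonneg_left (S.le_gram hcG θ)
    (by positivity : 0 ≤ κ ^ 2 * Real.exp (-3 * Λ) / 2)
  have hscore := S.score_le θ
  simp only [logisticLik, curvature, Finset.sum_sub_distrib]
  linarith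

lemma basic_inequality (S : RegularSample h θ₀ E₀ E₁ κ M cG (3 * Λ) n₁ n₀ r ε y x)
    (hcG : 0 ≤ cG) (hθ₀ : ‖θ₀‖ ≤ Λ) {θ : Param p q} (hθ : ‖θ‖ ≤ Λ) {Θ : Set (Param p q)}
    {w : ι → ℝ} (hf : Feasible h Θ x θ w) {W : Matrix (Fin q) (Fin q) ℝ} {N : ℕ} {m : Vec q}
    {δ : ℝ} (hobj : logisticLik n₁ n₀ y x θ₀ - δ ≤ objective W N m y x θ w) :
    curvature κ Λ cG * Fintype.card ι * regressionDist θ θ₀ ^ 2 +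
        -∑ i, Real.log (w i * pooledDensity n₁ n₀ θ (x i)) + penalty W N m (mom θ) ≤
      Fintype.card ι * (ε * r) * regressionDist θ θ₀ + δ := by
  have hlik := S.logisticLik_le hcG hθ₀ hθ
  rw [hf.objective_eq_logisticLik S.cases_pos S.controls_pos] at hobj
  linarith

end RegularSample

lemma Feasible.sum_log_mul_pooledDensity_nonpos {h : Vec p → Vec q} {Θ : Set (Param p q)}
    {x : ι → Vec p} {θ : Param p q} {w : ι → ℝ} (hf : Feasible h Θ x θ w) {n₁ n₀ : ℝ}
    (h1 : 0 < n₁) (h0 : 0 < n₀) (hn : n₀ + n₁ = Fintype.card ι) :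
    ∑ i, Real.log (w i * pooledDensity n₁ n₀ θ (x i)) ≤ 0 := by
  calc ∑ i, Real.log (w i * pooledDensity n₁ n₀ θ (x i))
      ≤ ∑ i, (w i * pooledDensity n₁ n₀ θ (x i) - 1) := Finset.sum_le_sum fun i _ =>
        Real.log_le_sub_one_of_pos (mul_pos (hf.pos i) (pooledDensity_pos h1 h0 θ (x i)))
    _ = 0 := by
        rw [Finset.sum_sub_distrib, hf.sum_mul_pooledDensity, hn, Finset.sum_const,
          Finset.card_univ, nsmul_one, sub_self]

lemma le_of_quadratic_le {c D e C : ℝ} (hc : 0 < c) (he : 0 ≤ e) (hC : 0 ≤ C)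
    (hquad : c * D ^ 2 ≤ e * D + C * e ^ 2) : D ≤ ((1 + C) / c + 1) * e := by
  by_contra! hlt
  have hratio : 0 ≤ (1 + C) / c * e := by positivity
  have heD : e < D := by linarith
  have hD : 0 < D := he.trans_lt heD
  have hbound : D * (c * D) ≤ D * ((1 + C) * e) := by
    calc D * (c * D) = c * D ^ 2 := by ring
      _ ≤ e * D + C * e ^ 2 := hquad
      _ ≤ e * D + C * (e * D) := by
          rw [sq]
          gcongr
      _ = D * ((1 + C) * e) := by ring
  have hcD : D ≤ (1 + C) / c * e := by
    rw [div_mul_eq_mul_div, le_div_iff₀ hc, mul_comm]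
    exact le_of_mul_le_mul_left hbound hD
  linarith

end BasicInequality

section Summaries

variable {ι : Type*} [Fintype ι]

lemma norm_sum_smul_sub_le {E : Type*} [NormedAddCommGroup E] [NormedSpace ℝ E]
    {a c c₀ k : ι → ℝ} {z : ι → E} {v : E} {L D e : ℝ} (hc0 : ∀ i, 0 ≤ c i) (hc : ∀ i, c i ≤ L)
    (hcc : ∀ i, |c i - c₀ i| ≤ L * (D * k i)) (hv : ‖∑ i, c₀ i • z i - v‖ ≤ e) :
    ‖∑ i, (a i * c i) • z i - v‖ ≤
      L * (∑ i, |a i - 1| * ‖z i‖ + D * ∑ i, k i * ‖z i‖) + e := by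
  have hsplit : ∑ i, (a i * c i) • z i - v =
      ∑ i, (((a i - 1) * c i) • z i + (c i - c₀ i) • z i) + (∑ i, c₀ i • z i - v) := by
    rw [← add_sub_assoc, ← Finset.sum_add_distrib]
    congr 1
    exact Finset.sum_congr rfl fun i _ => by module
  rw [hsplit]
  refine (norm_add_le _ _).trans (add_le_add ?_ hv)
  rw [Finset.mul_sum, ← Finset.sum_add_distrib, Finset.mul_sum]
  refine norm_sum_le_of_le _ fun i _ => ?_
  calc ‖((a i - 1) * c i) • z i + (c i - c₀ i) • z i‖
      ≤ |a i - 1| * c i * ‖z i‖ + |c i - c₀ i| * ‖z i‖ :=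
        (norm_add_le _ _).trans_eq (by
          rw [norm_smul, norm_smul, Real.norm_eq_abs, Real.norm_eq_abs, abs_mul,
            abs_of_nonneg (hc0 i)])
    _ ≤ |a i - 1| * L * ‖z i‖ + L * (D * k i) * ‖z i‖ := by
        gcongr
        exacts [hc i, hcc i]
    _ = L * (|a i - 1| * ‖z i‖ + D * (k i * ‖z i‖)) := by ring

namespace RegularSample

variable {h : Vec p → Vec q} {θ₀ : Param p q} {E₀ E₁ : Vec q} {κ M cG B n₁ n₀ r ε : ℝ}
  {y : ι → ℝ} {x : ι → Vec p}
  (S : RegularSample h θ₀ E₀ E₁ κ M cG B n₁ n₀ r ε y x)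

include S

lemma sum_abs_sub_one_mul_norm_summary_le (hε : ε ≤ 1) {a : ι → ℝ} {K : ℝ} (hK : 0 ≤ K)
    (ha : ∀ i, 0 < a i) (hsum : ∑ i, a i = Fintype.card ι)
    (hlog : -∑ i, Real.log (a i) ≤ K * (ε * r) ^ 2 * Fintype.card ι) :
    ∑ i, |a i - 1| * ‖h (x i)‖ ≤ (K * M + 2 * √(K * M)) * (ε * r) * Fintype.card ι := by
  have hr := S.r_pos
  have hM := S.one_le_moment_bound
  have he := S.error_nonneg
  have hlin : K * (ε * r) ^ 2 * Fintype.card ι * (M / r) ≤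
      K * M * (ε * r) * Fintype.card ι := by
    calc K * (ε * r) ^ 2 * Fintype.card ι * (M / r)
        = ε * (K * M * (ε * r) * Fintype.card ι) := by field
      _ ≤ K * M * (ε * r) * Fintype.card ι := mul_le_of_le_one_left (by positivity) hε
  have hsqrt : √(K * (ε * r) ^ 2 * Fintype.card ι * ∑ i, ‖h (x i)‖ ^ 2) ≤
      √(K * M) * ((ε * r) * Fintype.card ι) := by
    rw [← Real.sqrt_sq (by positivity : 0 ≤ (ε * r) * Fintype.card ι),
      ← Real.sqrt_mul (by positivity)]
    refine Real.sqrt_le_sqrt ?_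
    calc K * (ε * r) ^ 2 * Fintype.card ι * ∑ i, ‖h (x i)‖ ^ 2
        ≤ K * (ε * r) ^ 2 * Fintype.card ι * (M * Fintype.card ι) :=
          mul_le_mul_of_nonneg_left S.sum_sq_summary_le (by positivity)
      _ = K * M * ((ε * r) * Fintype.card ι) ^ 2 := by ring
  have htransport := sum_abs_sub_one_mul_le (L := M / r) ha hsum hlog
    (fun i => norm_nonneg (h (x i))) (by positivity) S.summary_le
  linarith

lemma norm_sum_smul_summary_sub_le {a c c₀ : ι → ℝ} {v : Vec q} {D C K : ℝ} (hD0 : 0 ≤ D)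
    (hD : D ≤ C * (ε * r))
    (ha : ∑ i, |a i - 1| * ‖h (x i)‖ ≤ K * (ε * r) * Fintype.card ι) (hc0 : ∀ i, 0 ≤ c i)
    (hc : ∀ i, c i ≤ (κ * Fintype.card ι)⁻¹)
    (hcc : ∀ i, |c i - c₀ i| ≤ (κ * Fintype.card ι)⁻¹ * (D * (1 + ‖x i‖)))
    (hv : ‖∑ i, c₀ i • h (x i) - v‖ ≤ ε * r) :
    ‖∑ i, (a i * c i) • h (x i) - v‖ ≤ (κ⁻¹ * (K + C * M) + 1) * (ε * r) := by
  have hκ := S.κ_pos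
  have hn := S.card_pos
  refine (norm_sum_smul_sub_le hc0 hc hcc hv).trans ?_
  have hsum : D * ∑ i, (1 + ‖x i‖) * ‖h (x i)‖ ≤ C * (ε * r) * (M * Fintype.card ι) :=
    mul_le_mul hD S.sum_summary_le (Finset.sum_nonneg fun i _ => by positivity) (hD0.trans hD)
  calc (κ * Fintype.card ι)⁻¹ * (∑ i, |a i - 1| * ‖h (x i)‖ +
          D * ∑ i, (1 + ‖x i‖) * ‖h (x i)‖) + ε * r
      ≤ (κ * Fintype.card ι)⁻¹ * (K * (ε * r) * Fintype.card ι +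
          C * (ε * r) * (M * Fintype.card ι)) + ε * r := by gcongr
    _ = (κ⁻¹ * (K + C * M) + 1) * (ε * r) := by field

lemma norm_control_mean_sub_le {a : ι → ℝ} {θ : Param p q} {C K : ℝ}
    (hθ : regressionDist θ θ₀ ≤ C * (ε * r))
    (ha : ∑ i, |a i - 1| * ‖h (x i)‖ ≤ K * (ε * r) * Fintype.card ι) :
    ‖∑ i, (a i * (pooledDensity n₁ n₀ θ (x i))⁻¹) • h (x i) - E₀‖ ≤
      (κ⁻¹ * (K + C * M) + 1) * (ε * r) := by
  have hinv : n₀⁻¹ ≤ (κ * Fintype.card ι)⁻¹ :=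
    inv_anti₀ (mul_pos S.κ_pos S.card_pos) S.controls
  have hD0 := regressionDist_nonneg θ θ₀
  refine S.norm_sum_smul_summary_sub_le hD0 hθ ha
    (fun i => (inv_pos.2 (pooledDensity_pos S.cases_pos S.controls_pos θ (x i))).le)
    (fun i => (inv_pooledDensity_le S.cases_pos S.controls_pos θ (x i)).trans hinv)
    (fun i => ?_) S.inv_summary
  exact (abs_inv_pooledDensity_sub_le S.cases_pos S.controls_pos θ θ₀ (x i)).trans
    (mul_le_mul_of_nonneg_right hinv (by positivity))

lemma norm_case_mean_sub_le {a : ι → ℝ} {θ : Param p q} {C K : ℝ}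
    (hθ : regressionDist θ θ₀ ≤ C * (ε * r))
    (ha : ∑ i, |a i - 1| * ‖h (x i)‖ ≤ K * (ε * r) * Fintype.card ι) :
    ‖∑ i, (a i * (tilt θ (x i) / pooledDensity n₁ n₀ θ (x i))) • h (x i) - E₁‖ ≤
      (κ⁻¹ * (K + C * M) + 1) * (ε * r) := by
  have hinv : n₁⁻¹ ≤ (κ * Fintype.card ι)⁻¹ := inv_anti₀ (mul_pos S.κ_pos S.card_pos) S.cases
  have hD0 := regressionDist_nonneg θ θ₀
  refine S.norm_sum_smul_summary_sub_le hD0 hθ ha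
    (fun i => (div_pos (tilt_pos θ (x i))
      (pooledDensity_pos S.cases_pos S.controls_pos θ (x i))).le)
    (fun i => (tilt_div_pooledDensity_le S.cases_pos S.controls_pos θ (x i)).trans hinv)
    (fun i => ?_) S.tilt_summary
  exact (abs_tilt_div_pooledDensity_sub_le S.cases_pos S.controls_pos θ θ₀ (x i)).trans
    (mul_le_mul_of_nonneg_right hinv (by positivity))

end RegularSample

end Summaries

/-! ### Localization of the maximizers -/

section Mixture

lemma abs_sub_mul_norm_sub_le {E : Type*} [NormedAddCommGroup E] [NormedSpace ℝ E]
    {A B a b : E} {s s₀ e : ℝ} (hs0 : 0 ≤ s) (hs1 : s ≤ 1) (hA : ‖A - a‖ ≤ e) (hB : ‖B - b‖ ≤ e)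
    (hmix : ‖((1 - s) • B + s • A) - ((1 - s₀) • b + s₀ • a)‖ ≤ e) :
    |s - s₀| * ‖a - b‖ ≤ 2 * e := by
  have hsplit : (s - s₀) • (a - b) = (((1 - s) • B + s • A) - ((1 - s₀) • b + s₀ • a)) -
      ((1 - s) • (B - b) + s • (A - a)) := by module
  have hconv : ‖(1 - s) • (B - b) + s • (A - a)‖ ≤ e := by
    calc ‖(1 - s) • (B - b) + s • (A - a)‖ ≤ (1 - s) * ‖B - b‖ + s * ‖A - a‖ :=
          (norm_add_le _ _).trans_eq (by
            rw [norm_smul, norm_smul, Real.norm_of_nonneg hs0,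
              Real.norm_of_nonneg (sub_nonneg.2 hs1)])
      _ ≤ (1 - s) * e + s * e := by gcongr
      _ = e := by ring
  rw [← Real.norm_eq_abs, ← norm_smul, hsplit]
  linarith [norm_sub_le (((1 - s) • B + s • A) - ((1 - s₀) • b + s₀ • a))
    ((1 - s) • (B - b) + s • (A - a))]

lemma abs_sub_le_abs_logistic_sub {Λ u v : ℝ} (hu : |u| ≤ Λ) (hv : |v| ≤ Λ) :
    |u - v| ≤ 4 * Real.exp (3 * Λ) *
      |Real.exp u / (1 + Real.exp u) - Real.exp v / (1 + Real.exp v)| := by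
  rcases eq_or_ne u v with rfl | hne
  · simp
  have hmono := logistic_strongly_mono (a := 1) (b := 1) (κ := 1 / 2) one_half_pos (by norm_num)
    (by norm_num) (by norm_num) hu hv
  have habs := hmono.trans ((le_abs_self _).trans_eq (abs_mul _ _))
  rw [← sq_abs (u - v), sq |u - v|, ← mul_assoc, one_mul, one_mul] at habs
  have hdiv := le_of_mul_le_mul_right habs (abs_pos.2 (sub_ne_zero.2 hne))
  calc |u - v| = 4 * Real.exp (3 * Λ) * ((1 / 2) ^ 2 * Real.exp (-3 * Λ) * |u - v|) := by
        rw [neg_mul, Real.exp_neg]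
        field
    _ ≤ _ := mul_le_mul_of_nonneg_left hdiv (by positivity)

lemma inv_one_add_exp_smul_add {E : Type*} [AddCommGroup E] [Module ℝ E] (g : ℝ) (A B : E) :
    (1 + Real.exp g)⁻¹ • (B + Real.exp g • A) =
      (1 - Real.exp g / (1 + Real.exp g)) • B + (Real.exp g / (1 + Real.exp g)) • A := by
  have hg : 1 + Real.exp g ≠ 0 := by positivity
  rw [smul_add, smul_smul, one_sub_div hg, add_sub_cancel_right, one_div, div_eq_inv_mul]

lemma abs_logit_sub_le {E : Type*} [NormedAddCommGroup E] [NormedSpace ℝ E]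
    {A B E₀ E₁ : E} {g g₀ Λ e : ℝ} (hE : E₀ ≠ E₁) (hg : |g| ≤ Λ) (hg₀ : |g₀| ≤ Λ)
    (hA : ‖A - E₀‖ ≤ e) (hB : ‖B - E₁‖ ≤ e)
    (hmix : ‖(1 + Real.exp g)⁻¹ • (B + Real.exp g • A) -
      (1 + Real.exp g₀)⁻¹ • (E₁ + Real.exp g₀ • E₀)‖ ≤ e) :
    |g - g₀| ≤ 4 * Real.exp (3 * Λ) * (2 / ‖E₀ - E₁‖) * e := by
  rw [inv_one_add_exp_smul_add, inv_one_add_exp_smul_add] at hmix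
  have hdist := abs_sub_mul_norm_sub_le (by positivity)
    (div_le_one_of_le₀ (le_add_of_nonneg_left zero_le_one) (by positivity)) hA hB hmix
  rw [← le_div_iff₀ (norm_pos_iff.2 (sub_ne_zero.2 hE))] at hdist
  calc |g - g₀| ≤ 4 * Real.exp (3 * Λ) *
        |Real.exp g / (1 + Real.exp g) - Real.exp g₀ / (1 + Real.exp g₀)| :=
        abs_sub_le_abs_logistic_sub hg hg₀
    _ ≤ 4 * Real.exp (3 * Λ) * (2 * e / ‖E₀ - E₁‖) :=
        mul_le_mul_of_nonneg_left hdist (by positivity)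
    _ = 4 * Real.exp (3 * Λ) * (2 / ‖E₀ - E₁‖) * e := by ring

end Mixture

section Localization

lemma norm_sub_le_of_mul_sq_le {E : Type*} [NormedAddCommGroup E] {m v : E}
    {cp cN C N n e P : ℝ} (hcp : 0 < cp) (hcN : 0 < cN) (hC : 0 ≤ C) (hn : 0 < n) (he : 0 ≤ e)
    (hN : cN * n ≤ N) (hlower : cp * N * ‖m - v‖ ^ 2 ≤ P) (hupper : P ≤ C * e ^ 2 * n) :
    ‖m - v‖ ≤ √(C / (cp * cN)) * e := by
  refine (abs_le_of_sq_le_sq' ?_ (by positivity)).2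
  rw [mul_pow, Real.sq_sqrt (by positivity), div_mul_eq_mul_div, le_div_iff₀ (by positivity)]
  refine le_of_mul_le_mul_right ?_ hn
  calc ‖m - v‖ ^ 2 * (cp * cN) * n = cp * (cN * n) * ‖m - v‖ ^ 2 := by ring
    _ ≤ cp * N * ‖m - v‖ ^ 2 := by gcongr
    _ ≤ C * e ^ 2 * n := hlower.trans hupper

variable {ι : Type*} [Fintype ι] {h : Vec p → Vec q} {θ₀ θ : Param p q} {E₀ E₁ : Vec q}
  {κ M cG Λ n₁ n₀ r ε C₀ : ℝ} {y : ι → ℝ} {x : ι → Vec p} {w : ι → ℝ} {Θ : Set (Param p q)}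
  {W : Matrix (Fin q) (Fin q) ℝ} {N : ℕ} {m : Vec q}

namespace RegularSample

lemma regressionDist_le (S : RegularSample h θ₀ E₀ E₁ κ M cG (3 * Λ) n₁ n₀ r ε y x)
    (hcG : 0 < cG) (hC₀ : 0 ≤ C₀) (hθ₀ : ‖θ₀‖ ≤ Λ) (hθ : ‖θ‖ ≤ Λ) (hf : Feasible h Θ x θ w)
    (hpen : 0 ≤ penalty W N m (mom θ))
    (hobj : logisticLik n₁ n₀ y x θ₀ - C₀ * (ε * r) ^ 2 * Fintype.card ι ≤
      objective W N m y x θ w) :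
    regressionDist θ θ₀ ≤ ((1 + C₀) / curvature κ Λ cG + 1) * (ε * r) := by
  have hbasic := S.basic_inequality hcG.le hθ₀ hθ hf hobj
  have hent := hf.sum_log_mul_pooledDensity_nonpos S.cases_pos S.controls_pos S.card_eq
  refine le_of_quadratic_le (curvature_pos S.κ_pos hcG) S.error_nonneg hC₀
    (le_of_mul_le_mul_right ?_ S.card_pos)
  linarith

lemma neg_sum_log_add_penalty_le
    (S : RegularSample h θ₀ E₀ E₁ κ M cG (3 * Λ) n₁ n₀ r ε y x)
    (hcG : 0 < cG) (hC₀ : 0 ≤ C₀) (hθ₀ : ‖θ₀‖ ≤ Λ) (hθ : ‖θ‖ ≤ Λ) (hf : Feasible h Θ x θ w)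
    (hpen : 0 ≤ penalty W N m (mom θ))
    (hobj : logisticLik n₁ n₀ y x θ₀ - C₀ * (ε * r) ^ 2 * Fintype.card ι ≤
      objective W N m y x θ w) :
    -∑ i, Real.log (w i * pooledDensity n₁ n₀ θ (x i)) + penalty W N m (mom θ) ≤
      ((1 + C₀) / curvature κ Λ cG + 1 + C₀) * (ε * r) ^ 2 * Fintype.card ι := by
  have hbasic := S.basic_inequality hcG.le hθ₀ hθ hf hobj
  have hdist := mul_le_mul_of_nonneg_left (S.regressionDist_le hcG hC₀ hθ₀ hθ hf hpen hobj)
    (mul_nonneg S.card_pos.le S.error_nonneg)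
  have hcurv : 0 ≤ curvature κ Λ cG * Fintype.card ι * regressionDist θ θ₀ ^ 2 :=
    mul_nonneg (mul_nonneg (curvature_pos S.κ_pos hcG).le S.card_pos.le) (sq_nonneg _)
  linarith

lemma abs_gam_sub_le (S : RegularSample h θ₀ E₀ E₁ κ M cG (3 * Λ) n₁ n₀ r ε y x)
    (hE : E₀ ≠ E₁)
    (hμ : mom θ₀ = (1 + Real.exp (gam θ₀))⁻¹ • (E₁ + Real.exp (gam θ₀) • E₀))
    (hθ₀ : ‖θ₀‖ ≤ Λ) (hθ : ‖θ‖ ≤ Λ) (hf : Feasible h Θ x θ w) {C K L : ℝ}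
    (hdist : regressionDist θ θ₀ ≤ C * (ε * r))
    (hweight : ∑ i, |w i * pooledDensity n₁ n₀ θ (x i) - 1| * ‖h (x i)‖ ≤
      K * (ε * r) * Fintype.card ι)
    (hmom : ‖mom θ - mom θ₀‖ ≤ L * (ε * r)) :
    |gam θ - gam θ₀| ≤ 4 * Real.exp (3 * Λ) * (2 / ‖E₀ - E₁‖) *
      (max (κ⁻¹ * (K + C * M) + 1) L * (ε * r)) := by
  have hle : ∀ {a b c : ℝ}, a ≤ b * (ε * r) → b ≤ c → a ≤ c * (ε * r) := fun ha hbc =>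
    ha.trans (mul_le_mul_of_nonneg_right hbc S.error_nonneg)
  rw [hf.mom_eq S.cases_pos S.controls_pos, hμ] at hmom
  exact abs_logit_sub_le hE ((abs_gam_le θ).trans hθ) ((abs_gam_le θ₀).trans hθ₀)
    (hle (S.norm_control_mean_sub_le hdist hweight) (le_max_left _ _))
    (hle (S.norm_case_mean_sub_le hdist hweight) (le_max_left _ _)) (hle hmom (le_max_right _ _))

end RegularSample

/-- The distance to the truth of a feasible parameter with almost maximal objective, in units of
the error `ε r` of a regular sample: `C₁` for `(α*, β)`, `C₃` for `μ`, and the rest for `γ`. -/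
def localizationConst (δ κ M Λ cG cp cN C₀ : ℝ) : ℝ :=
  let C₁ := (1 + C₀) / curvature κ Λ cG + 1
  let C₂ := C₁ + C₀
  let C₃ := √(C₂ / (cp * cN)) + 1
  let K := C₂ * M + 2 * √(C₂ * M)
  4 * Real.exp (3 * Λ) * (2 / δ) * max (κ⁻¹ * (K + C₁ * M) + 1) C₃ + C₁ + C₃

lemma localizationConst_pos {δ cp cN : ℝ} (hδ : 0 ≤ δ) (hκ : 0 < κ) (hM : 0 ≤ M) (hcG : 0 < cG)
    (hC₀ : 0 ≤ C₀) : 0 < localizationConst δ κ M Λ cG cp cN C₀ := by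
  have := curvature_pos hκ hcG (Λ := Λ)
  simp only [localizationConst]
  positivity

lemma RegularSample.norm_sub_le (S : RegularSample h θ₀ E₀ E₁ κ M cG (3 * Λ) n₁ n₀ r ε y x)
    (hE : E₀ ≠ E₁)
    (hμ : mom θ₀ = (1 + Real.exp (gam θ₀))⁻¹ • (E₁ + Real.exp (gam θ₀) • E₀))
    {cp cN : ℝ} (hcG : 0 < cG) (hcp : 0 < cp) (hcN : 0 < cN) (hC₀ : 0 ≤ C₀) (hε : ε ≤ 1)
    (hpen : ∀ μ, cp * N * ‖m - μ‖ ^ 2 ≤ penalty W N m μ) (hN : cN * Fintype.card ι ≤ N)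
    (hm : ‖m - mom θ₀‖ ≤ ε * r) (hθ₀ : ‖θ₀‖ ≤ Λ) (hθ : ‖θ‖ ≤ Λ) (hf : Feasible h Θ x θ w)
    (hobj : logisticLik n₁ n₀ y x θ₀ - C₀ * (ε * r) ^ 2 * Fintype.card ι ≤
      objective W N m y x θ w) :
    ‖θ - θ₀‖ ≤ localizationConst ‖E₀ - E₁‖ κ M Λ cG cp cN C₀ * (ε * r) := by
  have hC₁ : 0 ≤ (1 + C₀) / curvature κ Λ cG + 1 := by
    have := curvature_pos S.κ_pos hcG (Λ := Λ)
    positivity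
  have hpen0 : 0 ≤ penalty W N m (mom θ) := le_trans (by positivity) (hpen (mom θ))
  have hdist := S.regressionDist_le hcG hC₀ hθ₀ hθ hf hpen0 hobj
  have hsum := S.neg_sum_log_add_penalty_le hcG hC₀ hθ₀ hθ hf hpen0 hobj
  have hent := hf.sum_log_mul_pooledDensity_nonpos S.cases_pos S.controls_pos S.card_eq
  have hweight := S.sum_abs_sub_one_mul_norm_summary_le hε (add_nonneg hC₁ hC₀)
    (fun i => mul_pos (hf.pos i) (pooledDensity_pos S.cases_pos S.controls_pos θ (x i)))
    ((hf.sum_mul_pooledDensity n₁ n₀).trans S.card_eq) ((le_add_of_nonneg_right hpen0).trans hsum)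
  have hmom : ‖mom θ - mom θ₀‖ ≤ (√(((1 + C₀) / curvature κ Λ cG + 1 + C₀) / (cp * cN)) + 1) *
      (ε * r) := by
    have hmθ := norm_sub_le_of_mul_sq_le hcp hcN (add_nonneg hC₁ hC₀) S.card_pos S.error_nonneg hN
      (hpen (mom θ)) (by linarith)
    rw [norm_sub_rev] at hmθ
    linarith [norm_sub_le_norm_sub_add_norm_sub (mom θ) m (mom θ₀)]
  have hgam := S.abs_gam_sub_le hE hμ hθ₀ hθ hf hdist hweight hmom
  refine (norm_sub_le_blocks θ θ₀).trans ((add_le_add (add_le_add hgam hdist) hmom).trans_eq ?_)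
  simp only [localizationConst]
  ring

end Localization

section GoodEstimator

lemma rpow_neg_third_eq {n r : ℝ} (hr : 0 < r) (h : n * r ^ 3 = 1) :
    n ^ (-(1 / 3) : ℝ) = r := by
  rw [eq_inv_of_mul_eq_one_left h, Real.rpow_neg (by positivity), Real.inv_rpow (by positivity),
    inv_inv, ← Real.rpow_natCast, ← Real.rpow_mul hr.le]
  norm_num

lemma RegularSample.exists_feasible {ι : Type*} [Fintype ι] {h : Vec p → Vec q} {θ₀ : Param p q}
    {E₀ E₁ : Vec q} {κ M cG B n₁ n₀ r ε : ℝ} {y : ι → ℝ} {x : ι → Vec p}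
    (S : RegularSample h θ₀ E₀ E₁ κ M cG B n₁ n₀ r ε y x) (hε : ε * r ≤ 1 / 2)
    (hμ : mom θ₀ = (1 + Real.exp (gam θ₀))⁻¹ • (E₁ + Real.exp (gam θ₀) • E₀))
    {Θ : Set (Param p q)}
    (hΘ : Metric.closedBall θ₀ ((4 + 2 * ((1 + ‖E₀‖) + (1 + ‖E₁‖))) * (ε * r)) ⊆ Θ)
    {W : Matrix (Fin q) (Fin q) ℝ} {N : ℕ} {m : Vec q} {Cp CN : ℝ} (hCp : 0 ≤ Cp)
    (hpen : ∀ μ, penalty W N m μ ≤ Cp * N * ‖m - μ‖ ^ 2) (hN : N ≤ CN * Fintype.card ι)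
    (hm : ‖m - mom θ₀‖ ≤ ε * r) :
    ∃ θ w, Feasible h Θ x θ w ∧ logisticLik n₁ n₀ y x θ₀ -
      Cp * CN * (1 + 2 * ((1 + ‖E₀‖) + (1 + ‖E₁‖))) ^ 2 * (ε * r) ^ 2 * Fintype.card ι ≤
        objective W N m y x θ w := by
  have := S.nonempty
  set θ := calibratedParam h x (fun i => pooledDensity n₁ n₀ θ₀ (x i)) θ₀
  refine ⟨θ, _, (feasible_calibratedParam fun i =>
    pooledDensity_pos S.cases_pos S.controls_pos θ₀ (x i)).mono
      (hΘ (mem_closedBall_iff_norm.2 (S.norm_calibratedParam_sub_le hε hμ))),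
    le_trans (sub_le_sub_left ?_ _) (S.logisticLik_sub_penalty_le_objective W N m)⟩
  have hdist : ‖m - mom θ‖ ≤ (1 + 2 * ((1 + ‖E₀‖) + (1 + ‖E₁‖))) * (ε * r) := by
    have hmθ := S.norm_mom_calibratedParam_sub_le hε hμ
    rw [norm_sub_rev] at hmθ
    linarith [norm_sub_le_norm_sub_add_norm_sub m (mom θ₀) (mom θ)]
  have hCN : 0 ≤ CN * Fintype.card ι := N.cast_nonneg.trans hN
  calc penalty W N m (mom θ) ≤ Cp * N * ‖m - mom θ‖ ^ 2 := hpen _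
    _ ≤ Cp * (CN * Fintype.card ι) *
        ((1 + 2 * ((1 + ‖E₀‖) + (1 + ‖E₁‖))) * (ε * r)) ^ 2 := by gcongr
    _ = _ := by ring

lemma exists_pos_le_half_mul_lt {ρ : ℝ} (C K : ℝ) (hρ : 0 < ρ) :
    ∃ ε : ℝ, 0 < ε ∧ ε ≤ 1 / 2 ∧ C * ε < 1 ∧ (K + C) * ε < ρ := by
  have hlim : ∀ a b : ℝ, 0 < b → ∀ᶠ ε in 𝓝[>] (0 : ℝ), a * ε < b := fun a b hb =>
    (((continuous_const_mul a).tendsto' 0 0 (mul_zero a)).mono_left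
      nhdsWithin_le_nhds).eventually_lt_const hb
  obtain ⟨ε, ⟨⟨hε, h1⟩, h2⟩, h3⟩ := (((eventually_mem_nhdsWithin.and (hlim 2 1 one_pos)).and
    (hlim C 1 one_pos)).and (hlim (K + C) ρ hρ)).exists
  exact ⟨ε, hε, by linarith, h2, h3⟩

theorem exists_goodEstimator {h : Vec p → Vec q} {θ₀ : Param p q} {E₀ E₁ : Vec q} (hE : E₀ ≠ E₁)
    (hμ : mom θ₀ = (1 + Real.exp (gam θ₀))⁻¹ • (E₁ + Real.exp (gam θ₀) • E₀))
    {Θ : Set (Param p q)} (hΘ : IsCompact Θ) (hθ₀ : θ₀ ∈ interior Θ)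
    {W : Matrix (Fin q) (Fin q) ℝ} (hW : W.PosDef) {κ M cG Λ cN CN : ℝ} (hκ : 0 < κ) (hM : 0 ≤ M)
    (hcG : 0 < cG) (hΛ : ∀ θ ∈ Θ, ‖θ‖ ≤ Λ) (hcN : 0 < cN) (hCN : 0 ≤ CN) :
    ∃ ε : ℝ, 0 < ε ∧ ∀ {ι : Type} [Fintype ι] {n₁ n₀ r : ℝ} {y : ι → ℝ} {x : ι → Vec p},
      RegularSample h θ₀ E₀ E₁ κ M cG (3 * Λ) n₁ n₀ r ε y x →
      ∀ (N : ℕ) (m : Vec q), cN * Fintype.card ι ≤ N → N ≤ CN * Fintype.card ι →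
      ‖m - mom θ₀‖ ≤ ε * r → GoodEstimator h Θ W N m y x θ₀ := by
  obtain ⟨ρ, hρ, hball⟩ := Metric.mem_nhds_iff.1 (mem_interior_iff_mem_nhds.1 hθ₀)
  obtain ⟨cp, Cp, hcp, hCp, hpen⟩ := exists_penalty_bounds hW
  set K := 4 + 2 * ((1 + ‖E₀‖) + (1 + ‖E₁‖))
  set C₀ := Cp * CN * (1 + 2 * ((1 + ‖E₀‖) + (1 + ‖E₁‖))) ^ 2
  have hC₀ : 0 ≤ C₀ := by positivity
  set C := localizationConst ‖E₀ - E₁‖ κ M Λ cG cp cN C₀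
  have hC : 0 < C := localizationConst_pos (norm_nonneg _) hκ hM hcG hC₀
  have hK : 0 ≤ K := by positivity
  obtain ⟨ε, hε0, hε_half, hεC, hερ⟩ := exists_pos_le_half_mul_lt C K hρ
  refine ⟨ε, hε0, fun {ι _ n₁ n₀ r y x} S N m hN hN' hm => ?_⟩
  have hεr : ε * r ≤ ε := mul_le_of_le_one_right hε0.le S.r_le_one
  obtain ⟨θc, wc, hfc, hobjc⟩ := S.exists_feasible (hεr.trans hε_half) hμ
    ((Metric.closedBall_subset_ball (by nlinarith)).trans hball) hCp.le
    (fun μ => (hpen N m μ).2) hN' hm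
  refine ⟨exists_isMaximizer hΘ hfc, fun θ w hmax => ?_⟩
  have hdist : ‖θ - θ₀‖ ≤ C * (ε * r) :=
    S.norm_sub_le hE hμ hcG hcp hcN hC₀ (by linarith) (fun μ => (hpen N m μ).1) hN hm
      (hΛ θ₀ (interior_subset hθ₀)) (hΛ θ hmax.feasible.mem) hmax.feasible
      (hobjc.trans (hmax.le θc wc hfc))
  refine ⟨Metric.ball_subset_interior_closedBall ?_, hmax.exists_multiplier ?_⟩
  · rw [mem_ball_iff_norm, rpow_neg_third_eq S.r_pos S.card_mul]
    nlinarith [S.r_pos]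
  · refine interior_maximal hball Metric.isOpen_ball (mem_ball_iff_norm.2 (hdist.trans_lt ?_))
    nlinarith

end GoodEstimator

/-! ### A rate in the strong law for triangular arrays -/

/-- The localization rate `n^(-1/3)`, at which the sample averages have to converge. -/
def rate (n : ℕ) : ℝ := (n : ℝ) ^ (-(1 / 3) : ℝ)

lemma rate_nonneg (n : ℕ) : 0 ≤ rate n := by
  unfold rate; positivity

lemma rate_pos {n : ℕ} (hn : 0 < n) : 0 < rate n := by
  unfold rate; positivity

lemma mul_rate_pow {n : ℕ} (hn : 0 < n) : (n : ℝ) * rate n ^ 3 = 1 := by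
  have h : (0 : ℝ) < n := Nat.cast_pos.2 hn
  rw [rate, ← Real.rpow_natCast, ← Real.rpow_mul h.le, show -(1 / 3 : ℝ) * (3 : ℕ) = -1 by norm_num,
    Real.rpow_neg_one, mul_inv_cancel₀ h.ne']

lemma tendsto_rate : Tendsto rate atTop (𝓝 0) :=
  (tendsto_rpow_neg_atTop (by norm_num : (0 : ℝ) < 1 / 3)).comp tendsto_natCast_atTop_atTop

lemma summable_exp_neg_mul_inv_rate {c : ℝ} (hc : 0 < c) :
    Summable fun n : ℕ => Real.exp (-(c * (rate n)⁻¹)) := by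
  have hs : Summable fun n : ℕ => Nat.factorial 6 / c ^ 6 * (1 / (n : ℝ) ^ 2) :=
    (Real.summable_one_div_nat_pow.2 (by norm_num)).mul_left _
  refine hs.of_norm_bounded_eventually_nat ?_
  filter_upwards [eventually_gt_atTop 0] with n hn
  have hr := rate_pos hn
  have hpow : (c * (rate n)⁻¹) ^ 6 = c ^ 6 * (n : ℝ) ^ 2 := by
    rw [eq_inv_of_mul_eq_one_left (mul_rate_pow hn), mul_pow, inv_pow, inv_pow]
    ring
  have hexp := Real.pow_div_factorial_le_exp (c * (rate n)⁻¹) (by positivity) 6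
  rw [hpow] at hexp
  rw [Real.norm_of_nonneg (Real.exp_pos _).le, Real.exp_neg]
  calc (Real.exp (c * (rate n)⁻¹))⁻¹ ≤ (c ^ 6 * (n : ℝ) ^ 2 / Nat.factorial 6)⁻¹ :=
        inv_anti₀ (by positivity) hexp
    _ = _ := by field_simp

section Bernstein

variable {Ω : Type*} [MeasurableSpace Ω] {P : Measure Ω} [IsProbabilityMeasure P] {b l : ℝ}

lemma mgf_sub_integral_le {X : Ω → ℝ} (hX : AEStronglyMeasurable X P) (hb : ∀ ω, |X ω| ≤ b)
    (hl : 0 ≤ l) (hlb : 2 * l * b ≤ 1) :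
    mgf (fun ω => X ω - P[X]) P l ≤ Real.exp (l ^ 2 * Var[X; P]) := by
  have hX2 : MemLp X 2 P := MemLp.of_bound hX b (Eventually.of_forall hb)
  have hlin : Integrable (fun ω => l * (X ω - P[X])) P :=
    ((hX2.integrable one_le_two).sub (integrable_const _)).const_mul l
  have hsq : Integrable (fun ω => l ^ 2 * (X ω - P[X]) ^ 2) P :=
    (hX2.sub (memLp_const _)).integrable_sq.const_mul _
  have hsmall (ω : Ω) : |l * (X ω - P[X])| ≤ 1 := by
    have hmean : |P[X]| ≤ b := by
      simpa using norm_integral_le_of_norm_le_const (μ := P) (f := X) (Eventually.of_forall hb)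
    rw [abs_mul, abs_of_nonneg hl]
    nlinarith [abs_sub (X ω) P[X], hb ω]
  have hquad (ω : Ω) :
      Real.exp (l * (X ω - P[X])) ≤ 1 + (l * (X ω - P[X]) + l ^ 2 * (X ω - P[X]) ^ 2) := by
    linarith [(abs_le.1 (Real.abs_exp_sub_one_sub_id_le (hsmall ω))).2,
      mul_pow l (X ω - P[X]) 2]
  calc mgf (fun ω => X ω - P[X]) P l
      ≤ ∫ ω, (1 + (l * (X ω - P[X]) + l ^ 2 * (X ω - P[X]) ^ 2)) ∂P :=
        integral_mono_of_nonneg (Eventually.of_forall fun ω => (Real.exp_pos _).le)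
          ((integrable_const 1).add (hlin.add hsq))
          (Eventually.of_forall hquad)
    _ = l ^ 2 * Var[X; P] + 1 := by
        rw [integral_add (integrable_const _) (by exact hlin.add hsq), integral_add hlin hsq,
          integral_const_mul, integral_const_mul,
          integral_sub (hX2.integrable one_le_two) (integrable_const _),
          variance_eq_integral hX.aemeasurable]
        simp [add_comm]
    _ ≤ Real.exp (l ^ 2 * Var[X; P]) := Real.add_one_le_exp _

lemma measureReal_le_sum_sub_integral_le {I : Type*} {X : I → Ω → ℝ}
    (hX : ∀ i, Measurable (X i)) (hind : iIndepFun X P) (hb : ∀ i ω, |X i ω| ≤ b) (hl : 0 ≤ l)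
    (hlb : 2 * l * b ≤ 1) (s : Finset I) (t : ℝ) :
    P.real {ω | t ≤ ∑ i ∈ s, (X i ω - P[X i])} ≤
      Real.exp (-(l * t) + l ^ 2 * ∑ i ∈ s, Var[X i; P]) := by
  set Z : I → Ω → ℝ := fun i ω => X i ω - P[X i] with hZ
  have hZm (i : I) : Measurable (Z i) := (hX i).sub_const _
  have hZind : iIndepFun Z P :=
    hind.comp (fun i z => z - ∫ ω, X i ω ∂P) fun _ => measurable_id.sub_const _
  have hZint (i : I) : Integrable (fun ω => Real.exp (l * Z i ω)) P := by
    refine integrable_exp_mul_of_mem_Icc (a := -b - P[X i]) (b := b - P[X i]) (hZm i).aemeasurable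
      (Eventually.of_forall fun ω => ?_)
    obtain ⟨hlow, hup⟩ := abs_le.1 (hb i ω)
    exact ⟨sub_le_sub_right hlow _, sub_le_sub_right hup _⟩
  calc P.real {ω | t ≤ ∑ i ∈ s, (X i ω - P[X i])}
      = P.real {ω | t ≤ (∑ i ∈ s, Z i) ω} := by simp only [hZ, Finset.sum_apply]
    _ ≤ Real.exp (-l * t) * mgf (∑ i ∈ s, Z i) P l :=
        measure_ge_le_exp_mul_mgf t hl (hZind.integrable_exp_mul_sum hZm fun i _ => hZint i)
    _ = Real.exp (-l * t) * ∏ i ∈ s, mgf (Z i) P l := by rw [hZind.mgf_sum hZm]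
    _ ≤ Real.exp (-l * t) * ∏ i ∈ s, Real.exp (l ^ 2 * Var[X i; P]) := by
        gcongr with i
        · exact fun _ _ => mgf_nonneg
        · exact mgf_sub_integral_le (hX i).aestronglyMeasurable (hb i) hl hlb
    _ = _ := by rw [← Real.exp_sum, ← Real.exp_add, ← Finset.mul_sum, neg_mul]

end Bernstein

lemma abs_sub_indicator_le {S : Type*} {g m : S → ℝ} {s : S} (hg : |g s| ≤ m s) {r : ℝ}
    (hr : 0 < r) :
    |g s - {s | m s ≤ r⁻¹}.indicator g s| ≤ r ^ 2 * m s ^ 3 := by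
  have hm : 0 ≤ m s := (abs_nonneg _).trans hg
  by_cases hs : s ∈ {s | m s ≤ r⁻¹}
  · rw [Set.indicator_of_mem hs, sub_self, abs_zero]
    positivity
  · rw [Set.indicator_of_notMem hs, sub_zero]
    have hone : 1 ≤ m s * r := ((inv_lt_iff_one_lt_mul₀ hr).1 (not_le.1 hs)).le
    calc |g s| ≤ m s := hg
      _ ≤ m s * (m s * r) ^ 2 := le_mul_of_one_le_right hm (one_le_pow₀ hone)
      _ = r ^ 2 * m s ^ 3 := by ring

section StrongLaw

variable {S Ω : Type*} [MeasurableSpace S] [MeasurableSpace Ω] {P : Measure Ω}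
  {ξ : ℕ → Ω → S} {F : Measure S}

lemma ae_tendsto_average {H : Type*} [NormedAddCommGroup H] [NormedSpace ℝ H] [CompleteSpace H]
    [MeasurableSpace H] [BorelSpace H] (hξm : ∀ i, Measurable (ξ i)) (hind : iIndepFun ξ P)
    (hlaw : ∀ i, P.map (ξ i) = F) {f : S → H} (hf : Measurable f) (hfi : Integrable f F) :
    ∀ᵐ ω ∂P, Tendsto (fun n : ℕ => (n : ℝ)⁻¹ • ∑ i ∈ Finset.range n, f (ξ i ω)) atTop
      (𝓝 (∫ s, f s ∂F)) := by
  have hident (i : ℕ) : IdentDistrib (ξ i) (ξ 0) P P :=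
    ⟨(hξm i).aemeasurable, (hξm 0).aemeasurable, by rw [hlaw, hlaw]⟩
  have hmean : ∫ ω, f (ξ 0 ω) ∂P = ∫ s, f s ∂F := by
    rw [← hlaw 0] at hfi ⊢
    exact (integral_map (hξm 0).aemeasurable hfi.aestronglyMeasurable).symm
  rw [← hmean]
  rw [← hlaw 0] at hfi
  exact strong_law_ae (fun i ω => f (ξ i ω)) (hfi.comp_measurable (hξm 0))
    (fun i j hij => (hind.indepFun hij).comp hf hf) fun i => (hident i).comp hf

section Bounded

variable [IsProbabilityMeasure P] (hξm : ∀ i, Measurable (ξ i)) (hind : iIndepFun ξ P)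
  (hlaw : ∀ i, P.map (ξ i) = F)

include hξm hind hlaw

lemma measureReal_le_sum_comp_sub_integral_le {f : S → ℝ} (hf : Measurable f) {b v l : ℝ}
    (hb : ∀ s, |f s| ≤ b) (hv : ∫ s, f s ^ 2 ∂F ≤ v) (hl : 0 ≤ l) (hlb : 2 * l * b ≤ 1)
    (k : ℕ) (t : ℝ) :
    P.real {ω | t ≤ ∑ i ∈ Finset.range k, (f (ξ i ω) - ∫ s, f s ∂F)} ≤
      Real.exp (-(l * t) + l ^ 2 * (k * v)) := by
  have hmean (i : ℕ) : P[fun ω => f (ξ i ω)] = ∫ s, f s ∂F := by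
    rw [← hlaw i, integral_map (hξm i).aemeasurable hf.aestronglyMeasurable]
  have hvar (i : ℕ) : Var[fun ω => f (ξ i ω); P] ≤ v := by
    refine (variance_le_expectation_sq (hf.comp (hξm i)).aestronglyMeasurable).trans ?_
    rwa [← hlaw i, integral_map (hξm i).aemeasurable
      (hf.pow_const 2).aestronglyMeasurable] at hv
  have hbernstein := measureReal_le_sum_sub_integral_le (X := fun i ω => f (ξ i ω))
    (fun i => hf.comp (hξm i)) (hind.comp (fun _ => f) fun _ => hf) (fun i ω => hb (ξ i ω)) hl hlb
    (Finset.range k) t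
  simp only [hmean] at hbernstein
  refine hbernstein.trans (Real.exp_le_exp.2 ?_)
  gcongr
  exact (Finset.sum_le_card_nsmul _ _ v fun i _ => hvar i).trans_eq (by simp)

variable {f : ℕ → S → ℝ} (hf : ∀ n, Measurable (f n)) {v : ℝ}
  (hb : ∀ᶠ n in atTop, ∀ s, |f n s| ≤ (rate n)⁻¹) (hv : ∀ᶠ n in atTop, ∫ s, f n s ^ 2 ∂F ≤ v)
  {k : ℕ → ℕ} (hk : ∀ n, k n ≤ n)

include hf hb hv hk

lemma summable_measureReal_le_sum (hv0 : 0 ≤ v) {η : ℝ} (hη : 0 < η) :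
    Summable fun n => P.real {ω | η * ((rate n)⁻¹) ^ 2 ≤
      ∑ i ∈ Finset.range (k n), (f n (ξ i ω) - ∫ s, f n s ∂F)} := by
  set δ := min (1 / 2) (η / (2 * (v + 1)))
  have hδ0 : 0 < δ := by positivity
  have hδ1 : δ ≤ 1 / 2 := min_le_left _ _
  have hδ2 : δ * v ≤ η / 2 := by
    have : δ ≤ η / (2 * (v + 1)) := min_le_right _ _
    rw [le_div_iff₀ (by positivity)] at this
    nlinarith
  have hsum := summable_exp_neg_mul_inv_rate (by positivity : 0 < δ * η / 2)
  refine hsum.of_norm_bounded_eventually_nat ?_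
  filter_upwards [hb, hv, eventually_gt_atTop 0] with n hbn hvn hn
  have hr := rate_pos hn
  rw [Real.norm_of_nonneg measureReal_nonneg]
  refine (measureReal_le_sum_comp_sub_integral_le hξm hind hlaw (hf n) hbn hvn (l := δ * rate n)
    (by positivity) (by rw [mul_assoc, mul_assoc, mul_inv_cancel₀ hr.ne']; linarith) (k n) _).trans
    (Real.exp_le_exp.2 ?_)
  have hlin : δ * rate n * (η * ((rate n)⁻¹) ^ 2) = δ * η * (rate n)⁻¹ := by field_simp
  have hquad : (δ * rate n) ^ 2 * (k n * v) ≤ δ * (η / 2) * (rate n)⁻¹ :=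
    calc (δ * rate n) ^ 2 * (k n * v) ≤ (δ * rate n) ^ 2 * (n * v) := by gcongr; exact hk n
      _ = δ * (δ * v) * (n * rate n ^ 3) * (rate n)⁻¹ := by field_simp
      _ = δ * (δ * v) * (rate n)⁻¹ := by rw [mul_rate_pow hn, mul_one]
      _ ≤ δ * (η / 2) * (rate n)⁻¹ := by gcongr
  rw [hlin]
  linarith

lemma ae_eventually_sum_lt (hv0 : 0 ≤ v) {η : ℝ} (hη : 0 < η) :
    ∀ᵐ ω ∂P, ∀ᶠ n in atTop,
      rate n ^ 2 * ∑ i ∈ Finset.range (k n), (f n (ξ i ω) - ∫ s, f n s ∂F) < η := by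
  have hsum := (summable_measureReal_le_sum hξm hind hlaw hf hb hv hk hv0 hη).tsum_ofReal_ne_top
  simp only [ofReal_measureReal (measure_ne_top P _)] at hsum
  filter_upwards [ae_eventually_notMem hsum] with ω hω
  filter_upwards [hω, eventually_gt_atTop 0] with n hn hn0
  have hr := rate_pos hn0
  calc _ < rate n ^ 2 * (η * ((rate n)⁻¹) ^ 2) := by gcongr; exact not_le.1 hn
    _ = η := by field_simp

lemma ae_tendsto_rate_sum_of_bounded (hv0 : 0 ≤ v) :
    ∀ᵐ ω ∂P, Tendsto (fun n => rate n ^ 2 *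
      ∑ i ∈ Finset.range (k n), (f n (ξ i ω) - ∫ s, f n s ∂F)) atTop (𝓝 0) := by
  have hup (j : ℕ) := ae_eventually_sum_lt hξm hind hlaw hf hb hv hk hv0
    (Nat.one_div_pos_of_nat (α := ℝ) (n := j))
  have hdown (j : ℕ) := ae_eventually_sum_lt (f := fun n s => -f n s) hξm hind hlaw
    (fun n => (hf n).neg) (by simpa only [abs_neg] using hb) (by simpa only [neg_sq] using hv) hk
    hv0 (Nat.one_div_pos_of_nat (α := ℝ) (n := j))
  filter_upwards [ae_all_iff.2 hup, ae_all_iff.2 hdown] with ω hωup hωdown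
  rw [Metric.tendsto_nhds]
  intro ε hε
  obtain ⟨j, hj⟩ := exists_nat_one_div_lt hε
  filter_upwards [hωup j, hωdown j] with n hn_up hn_down
  have hneg : ∑ i ∈ Finset.range (k n), (-f n (ξ i ω) - ∫ s, -f n s ∂F)
      = -∑ i ∈ Finset.range (k n), (f n (ξ i ω) - ∫ s, f n s ∂F) := by
    rw [integral_neg, ← Finset.sum_neg_distrib]
    exact Finset.sum_congr rfl fun i _ => by ring
  rw [hneg] at hn_down
  rw [Real.dist_eq, sub_zero, abs_lt]
  constructor <;> linarith

end Bounded

lemma abs_mean_deviation_sub_le {f g u : S → ℝ} (hf : Integrable f F) (hg : Integrable g F)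
    (hu : Integrable u F) {c : ℝ} (hfg : ∀ s, |g s - f s| ≤ c * u s) {k n : ℕ} (hk : k ≤ n)
    (z : ℕ → S) :
    |∑ i ∈ Finset.range k, (g (z i) - ∫ s, g s ∂F) - ∑ i ∈ Finset.range k, (f (z i) - ∫ s, f s ∂F)|
      ≤ c * (∑ i ∈ Finset.range n, u (z i) + n * ∫ s, u s ∂F) := by
  have hint : |∫ s, g s ∂F - ∫ s, f s ∂F| ≤ c * ∫ s, u s ∂F := by
    rw [← integral_sub hg hf, ← integral_const_mul]
    exact norm_integral_le_of_norm_le (f := fun s => g s - f s) (hu.const_mul _)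
      (Eventually.of_forall hfg)
  have hterm (i : ℕ) : |g (z i) - f (z i) - (∫ s, g s ∂F - ∫ s, f s ∂F)|
      ≤ c * u (z i) + c * ∫ s, u s ∂F :=
    (abs_sub _ _).trans (add_le_add (hfg _) hint)
  calc _ = |∑ i ∈ Finset.range k, (g (z i) - f (z i) - (∫ s, g s ∂F - ∫ s, f s ∂F))| := by
        rw [← Finset.sum_sub_distrib]
        simp only [sub_sub_sub_comm]
    _ ≤ ∑ i ∈ Finset.range k, (c * u (z i) + c * ∫ s, u s ∂F) :=
        (Finset.abs_sum_le_sum_abs _ _).trans (Finset.sum_le_sum fun i _ => hterm i)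
    _ ≤ ∑ i ∈ Finset.range n, (c * u (z i) + c * ∫ s, u s ∂F) :=
        Finset.sum_le_sum_of_subset_of_nonneg (Finset.range_mono hk) fun i _ _ =>
          (abs_nonneg _).trans (hterm i)
    _ = _ := by
        rw [Finset.sum_add_distrib, ← Finset.mul_sum, Finset.sum_const, Finset.card_range,
          nsmul_eq_mul]
        ring

/-- Truncate at `rate n⁻¹`: Bernstein's inequality handles the truncated functions, and the
remainder is at most `rate n ^ 2 * m ^ 3`, whose averages are bounded by the strong law. -/
theorem ae_tendsto_rate_sum [IsProbabilityMeasure P] (hξm : ∀ i, Measurable (ξ i))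
    (hind : iIndepFun ξ P) (hlaw : ∀ i, P.map (ξ i) = F) {g : ℕ → S → ℝ}
    (hg : ∀ n, Measurable (g n)) {m : S → ℝ} (hm : Measurable m) (hm1 : ∀ s, 1 ≤ m s)
    (hm3 : Integrable (fun s => m s ^ 3) F) (hgm : ∀ᶠ n in atTop, ∀ s, |g n s| ≤ m s) {k : ℕ → ℕ}
    (hk : ∀ n, k n ≤ n) :
    ∀ᵐ ω ∂P, Tendsto (fun n => rate n ^ 2 *
      ∑ i ∈ Finset.range (k n), (g n (ξ i ω) - ∫ s, g n s ∂F)) atTop (𝓝 0) := by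
  set f : ℕ → S → ℝ := fun n => {s | m s ≤ (rate n)⁻¹}.indicator (g n) with hf
  have hfm (n : ℕ) : Measurable (f n) := (hg n).indicator (measurableSet_le hm measurable_const)
  have hm3_nonneg (s : S) : 0 ≤ m s ^ 3 := by have := hm1 s; positivity
  have hfle : ∀ᶠ n in atTop, ∀ s, |f n s| ≤ m s :=
    hgm.mono fun n hn s => (norm_indicator_le_norm_self (g n) s).trans (hn s)
  have hfb : ∀ᶠ n in atTop, ∀ s, |f n s| ≤ (rate n)⁻¹ := hgm.mono fun n hn s => by
    by_cases hs : s ∈ {s | m s ≤ (rate n)⁻¹}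
    · simp only [hf, Set.indicator_of_mem hs]
      exact (hn s).trans hs
    · simp only [hf, Set.indicator_of_notMem hs, abs_zero]
      exact inv_nonneg.2 (rate_nonneg n)
  have hfv : ∀ᶠ n in atTop, ∫ s, f n s ^ 2 ∂F ≤ ∫ s, m s ^ 3 ∂F := hfle.mono fun n hn =>
    integral_mono_of_nonneg (Eventually.of_forall fun s => sq_nonneg _) hm3
      (Eventually.of_forall fun s => (sq_le_sq.2 ((hn s).trans (le_abs_self _))).trans
        (pow_le_pow_right₀ (hm1 s) (by norm_num)))
  have hmi : Integrable m F := hm3.mono' hm.aestronglyMeasurable <| Eventually.of_forall fun s => by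
    rw [Real.norm_of_nonneg (by linarith [hm1 s])]
    exact le_self_pow₀ (hm1 s) (by norm_num)
  filter_upwards [ae_tendsto_rate_sum_of_bounded hξm hind hlaw hfm hfb hfv hk
    (integral_nonneg hm3_nonneg), ae_tendsto_average hξm hind hlaw (hm.pow_const 3) hm3]
    with ω htrunc hlln
  have hrem : Tendsto (fun n => rate n * ((n : ℝ)⁻¹ • ∑ i ∈ Finset.range n, m (ξ i ω) ^ 3
      + ∫ s, m s ^ 3 ∂F)) atTop (𝓝 0) := by
    simpa only [zero_mul] using tendsto_rate.mul (hlln.add_const (∫ s, m s ^ 3 ∂F))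
  refine tendsto_of_tendsto_of_dist htrunc (squeeze_zero_norm' ?_ hrem)
  filter_upwards [hgm, hfle, eventually_gt_atTop 0] with n hgn hfn hn0
  have hr := rate_pos hn0
  have hdev := abs_mean_deviation_sub_le
    (hmi.mono' (hfm n).aestronglyMeasurable (Eventually.of_forall hfn))
    (hmi.mono' (hg n).aestronglyMeasurable (Eventually.of_forall hgn)) hm3
    (fun s => abs_sub_indicator_le (hgn s) hr) (hk n) fun i => ξ i ω
  rw [Real.norm_of_nonneg dist_nonneg, dist_comm, Real.dist_eq, ← mul_sub, abs_mul,
    abs_of_pos (by positivity : 0 < rate n ^ 2)]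
  refine (mul_le_mul_of_nonneg_left hdev (by positivity)).trans_eq ?_
  rw [smul_eq_mul]
  field_simp
  linear_combination (∑ i ∈ Finset.range n, m (ξ i ω) ^ 3 + n * ∫ s, m s ^ 3 ∂F) * mul_rate_pow hn0

end StrongLaw

/-! ### Logistic populations -/

lemma measurable_tilt (θ : Param p q) : Measurable (tilt θ) := by
  unfold tilt; fun_prop

/-- The marginal probability `P(Y = b)`. -/
def respProb (Pop : Measure (Vec p × Bool)) (b : Bool) : ℝ := Pop.real (Prod.snd ⁻¹' {b})

/-- The probability of the response `b` given the covariate `x` in the logistic model. -/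
def logisticProb (α : ℝ) (β : Vec p) : Bool → Vec p → ℝ
  | true, x => Real.exp (α + inner ℝ β x) / (1 + Real.exp (α + inner ℝ β x))
  | false, x => 1 / (1 + Real.exp (α + inner ℝ β x))

lemma logisticProb_pos (α : ℝ) (β : Vec p) (b : Bool) (x : Vec p) : 0 < logisticProb α β b x := by
  cases b <;> simp only [logisticProb] <;> positivity

lemma logisticProb_true_add_false (α : ℝ) (β : Vec p) (x : Vec p) :
    logisticProb α β true x + logisticProb α β false x = 1 := by
  have := Real.exp_pos (α + inner ℝ β x)
  simp only [logisticProb]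
  field_simp
  ring

lemma measurable_logisticProb (α : ℝ) (β : Vec p) (b : Bool) :
    Measurable (logisticProb α β b) := by
  cases b <;> unfold logisticProb <;> simp only <;> fun_prop

lemma add_inner_eq_of_logisticProb_eq {α α' : ℝ} {β β' x : Vec p}
    (h : logisticProb α' β' true x = logisticProb α β true x) :
    α' + inner ℝ β' x = α + inner ℝ β x := by
  simp only [logisticProb] at h
  rw [div_eq_div_iff (by positivity) (by positivity)] at h
  exact Real.exp_injective (by linarith)

section Mixture

variable {Pop : Measure (Vec p × Bool)}

lemma measurableSet_snd_preimage (b : Bool) :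
    MeasurableSet (Prod.snd ⁻¹' {b} : Set (Vec p × Bool)) :=
  measurable_snd (measurableSet_singleton b)

lemma fst_apply_eq_add {A : Set (Vec p)} (hA : MeasurableSet A) :
    Pop.fst A = Pop (A ×ˢ {true}) + Pop (A ×ˢ {false}) := by
  rw [Measure.fst_apply hA, ← measure_union
    (Set.disjoint_prod.2 <| Or.inr <| Set.disjoint_singleton.2 Bool.true_eq_false_eq_False)
    (hA.prod (measurableSet_singleton _)), ← Set.prod_union, ← Set.prod_univ]
  congr 2
  ext b
  cases b <;> simp

lemma respProb_nonneg (b : Bool) : 0 ≤ respProb Pop b := measureReal_nonneg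

lemma respProb_add [IsProbabilityMeasure Pop] : respProb Pop true + respProb Pop false = 1 := by
  have hcompl : (Prod.snd ⁻¹' {false} : Set (Vec p × Bool)) = (Prod.snd ⁻¹' {true})ᶜ := by
    ext ⟨x, b⟩
    cases b <;> simp
  rw [respProb, respProb, hcompl, probReal_add_probReal_compl (measurableSet_snd_preimage true)]

variable [IsFiniteMeasure Pop]

lemma ofReal_respProb_mul_condLaw (b : Bool) {A : Set (Vec p)} (hA : MeasurableSet A) :
    ENNReal.ofReal (respProb Pop b) * condLaw Pop b A = Pop (A ×ˢ {b}) := by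
  rw [condLaw, Measure.map_apply measurable_fst hA, respProb, ofReal_measureReal, mul_comm,
    cond_mul_eq_inter (measurableSet_snd_preimage b), Set.inter_comm, Set.prod_eq]

lemma fst_eq_add_smul_condLaw :
    Pop.fst = ENNReal.ofReal (respProb Pop true) • condLaw Pop true
      + ENNReal.ofReal (respProb Pop false) • condLaw Pop false := by
  ext A hA
  simp only [Measure.coe_add, Measure.coe_smul, Pi.add_apply, Pi.smul_apply, smul_eq_mul,
    ofReal_respProb_mul_condLaw _ hA, fst_apply_eq_add hA]

lemma integrable_condLaw {b : Bool} (hb : 0 < respProb Pop b) {E : Type*} [NormedAddCommGroup E]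
    {f : Vec p → E} (hf : Integrable f Pop.fst) : Integrable f (condLaw Pop b) := by
  rw [fst_eq_add_smul_condLaw, integrable_add_measure] at hf
  refine (integrable_smul_measure (ENNReal.ofReal_pos.2 hb).ne' ENNReal.ofReal_ne_top).1 ?_
  cases b
  exacts [hf.2, hf.1]

lemma integral_fst {E : Type*} [NormedAddCommGroup E] [NormedSpace ℝ E] {f : Vec p → E}
    (hf : ∀ b, Integrable f (condLaw Pop b)) :
    ∫ x, f x ∂Pop.fst = respProb Pop true • ∫ x, f x ∂(condLaw Pop true)
      + respProb Pop false • ∫ x, f x ∂(condLaw Pop false) := by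
  rw [fst_eq_add_smul_condLaw, integral_add_measure ((hf true).smul_measure ENNReal.ofReal_ne_top)
    ((hf false).smul_measure ENNReal.ofReal_ne_top), integral_smul_measure, integral_smul_measure,
    ENNReal.toReal_ofReal (respProb_nonneg _), ENNReal.toReal_ofReal (respProb_nonneg _)]

lemma respProb_eq_of_condLaw_eq {Pop Pop' : Measure (Vec p × Bool)} [IsProbabilityMeasure Pop]
    [IsProbabilityMeasure Pop'] {E : Type*} [NormedAddCommGroup E] [NormedSpace ℝ E] {f : Vec p → E}
    (hf : ∀ b, Integrable f (condLaw Pop b))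
    (hne : ∫ x, f x ∂(condLaw Pop true) ≠ ∫ x, f x ∂(condLaw Pop false))
    (hcond : ∀ b, condLaw Pop' b = condLaw Pop b)
    (hmean : ∫ x, f x ∂Pop'.fst = ∫ x, f x ∂Pop.fst) (b : Bool) :
    respProb Pop' b = respProb Pop b := by
  have hsum := respProb_add (Pop := Pop)
  have hsum' := respProb_add (Pop := Pop')
  have htrue : respProb Pop' true = respProb Pop true := by
    rw [integral_fst hf, integral_fst (by simpa only [hcond] using hf), hcond, hcond,
      eq_sub_of_add_eq' hsum, eq_sub_of_add_eq' hsum'] at hmean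
    have hzero : (respProb Pop' true - respProb Pop true) •
        (∫ x, f x ∂(condLaw Pop true) - ∫ x, f x ∂(condLaw Pop false)) = 0 := by
      rw [← sub_eq_zero.2 hmean]
      module
    exact sub_eq_zero.1 ((smul_eq_zero.1 hzero).resolve_right (sub_ne_zero.2 hne))
  cases b
  · linarith
  · exact htrue

end Mixture

lemma memLp_of_integrable_norm_pow {Ω E : Type*} [MeasurableSpace Ω] {μ : Measure Ω}
    [NormedAddCommGroup E] {f : Ω → E} {k : ℕ} (hf : AEStronglyMeasurable f μ)
    (hint : Integrable (fun x => ‖f x‖ ^ k) μ) : MemLp f k μ := by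
  rcases eq_or_ne k 0 with rfl | hk
  · rwa [Nat.cast_zero, memLp_zero_iff_aestronglyMeasurable]
  · exact (integrable_norm_rpow_iff hf (Nat.cast_ne_zero.2 hk) (ENNReal.natCast_ne_top k)).1
      (by simpa using hint)

lemma integrable_envelope_pow {μ : Measure (Vec p)} [IsFiniteMeasure μ] {h : Vec p → Vec q}
    (hh : Measurable h) {k : ℕ} (hX : Integrable (fun x => ‖x‖ ^ k) μ)
    (hhX : Integrable (fun x => ‖h x‖ ^ k) μ) :
    Integrable (fun x => (1 + ‖x‖ + ‖h x‖) ^ k) μ := by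
  have hLp := ((memLp_const (1 : ℝ)).add
    (memLp_of_integrable_norm_pow aestronglyMeasurable_id hX).norm).add
    (memLp_of_integrable_norm_pow hh.aestronglyMeasurable hhX).norm
  refine hLp.integrable_norm_pow'.congr (Eventually.of_forall fun x => ?_)
  simp only [Pi.add_apply, id]
  rw [Real.norm_of_nonneg (by positivity)]

lemma eq_zero_of_ae_affine_eq_zero {F : Measure (Vec p)} [NeZero F]
    (hF : ∀ S : AffineSubspace ℝ (Vec p), S ≠ ⊤ → ¬ ∀ᵐ x ∂F, x ∈ S) {a : ℝ} {b : Vec p}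
    (h : ∀ᵐ x ∂F, a + inner ℝ b x = 0) : a = 0 ∧ b = 0 := by
  obtain ⟨x₀, hx₀⟩ := h.exists
  suffices hb : b = 0 by simpa [hb] using hx₀
  by_contra hb
  set S : AffineSubspace ℝ (Vec p) := AffineSubspace.mk' x₀ (LinearMap.ker (innerₗ (Vec p) b))
    with hS
  have hmem (x : Vec p) : x ∈ S ↔ inner ℝ b (x - x₀) = 0 := by
    rw [hS, AffineSubspace.mem_mk']
    simp
  refine hF S (fun htop => hb ?_) ?_
  · have : x₀ + b ∈ S := htop ▸ AffineSubspace.mem_top ℝ (Vec p) _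
    rwa [hmem, add_sub_cancel_left, inner_self_eq_zero] at this
  · filter_upwards [h] with x hx
    rw [hmem, inner_sub_right]
    linarith

namespace IsLogistic

variable {Pop : Measure (Vec p × Bool)} [IsProbabilityMeasure Pop] {α : ℝ} {β : Vec p}

lemma apply_prod_singleton (hlog : IsLogistic Pop α β) (b : Bool) {A : Set (Vec p)}
    (hA : MeasurableSet A) :
    Pop (A ×ˢ {b}) = ∫⁻ x in A, ENNReal.ofReal (logisticProb α β b x) ∂Pop.fst := by
  cases b with
  | true => exact hlog A hA
  | false =>
    have htotal : Pop (A ×ˢ {true}) + Pop (A ×ˢ {false})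
        = Pop (A ×ˢ {true}) + ∫⁻ x in A, ENNReal.ofReal (logisticProb α β false x) ∂Pop.fst :=
      calc _ = ∫⁻ _ in A, 1 ∂Pop.fst := by rw [setLIntegral_one, fst_apply_eq_add hA]
        _ = ∫⁻ x in A, (ENNReal.ofReal (logisticProb α β true x)
              + ENNReal.ofReal (logisticProb α β false x)) ∂Pop.fst := by
          refine lintegral_congr fun x => ?_
          rw [← ENNReal.ofReal_add (logisticProb_pos _ _ _ _).le (logisticProb_pos _ _ _ _).le,
            logisticProb_true_add_false, ENNReal.ofReal_one]
        _ = _ := by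
          rw [lintegral_add_left (measurable_logisticProb α β true).ennreal_ofReal, hlog A hA]
          rfl
    exact (ENNReal.add_right_inj (measure_ne_top _ _)).1 htotal

lemma respProb_pos (hlog : IsLogistic Pop α β) (b : Bool) : 0 < respProb Pop b := by
  have hsupport : (Function.support fun x => ENNReal.ofReal (logisticProb α β b x)) = Set.univ :=
    Function.support_eq_univ fun x => (ENNReal.ofReal_pos.2 (logisticProb_pos α β b x)).ne'
  have hpos : 0 < Pop (Set.univ ×ˢ {b}) := by
    rw [hlog.apply_prod_singleton b MeasurableSet.univ, setLIntegral_univ,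
      lintegral_pos_iff_support (measurable_logisticProb α β b).ennreal_ofReal, hsupport]
    simp
  rw [Set.univ_prod] at hpos
  exact ENNReal.toReal_pos hpos.ne' (measure_ne_top _ _)

lemma condLaw_eq_withDensity (hlog : IsLogistic Pop α β) (b : Bool) :
    condLaw Pop b = Pop.fst.withDensity
      fun x => ENNReal.ofReal ((respProb Pop b)⁻¹ * logisticProb α β b x) := by
  have hpos := hlog.respProb_pos b
  ext A hA
  simp only [ENNReal.ofReal_mul (inv_nonneg.2 hpos.le)]
  rw [withDensity_apply _ hA, lintegral_const_mul _ (measurable_logisticProb α β b).ennreal_ofReal,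
    ← hlog.apply_prod_singleton b hA, ← ofReal_respProb_mul_condLaw b hA, ← mul_assoc,
    ← ENNReal.ofReal_mul (inv_nonneg.2 hpos.le), inv_mul_cancel₀ hpos.ne', ENNReal.ofReal_one,
    one_mul]

lemma isProbabilityMeasure_condLaw (hlog : IsLogistic Pop α β) (b : Bool) :
    IsProbabilityMeasure (condLaw Pop b) := by
  have hne : Pop (Prod.snd ⁻¹' {b}) ≠ 0 :=
    (measureReal_ne_zero_iff (measure_ne_top _ _)).1 (hlog.respProb_pos b).ne'
  have := cond_isProbabilityMeasure hne
  exact Measure.isProbabilityMeasure_map measurable_fst.aemeasurable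

lemma ae_fst_of_ae_condLaw (hlog : IsLogistic Pop α β) (b : Bool) {s : Vec p → Prop}
    (hs : ∀ᵐ x ∂(condLaw Pop b), s x) : ∀ᵐ x ∂Pop.fst, s x := by
  rw [hlog.condLaw_eq_withDensity b, ae_withDensity_iff
    ((measurable_logisticProb α β b).const_mul _).ennreal_ofReal] at hs
  filter_upwards [hs] with x hx
  exact hx (ENNReal.ofReal_pos.2
    (mul_pos (inv_pos.2 (hlog.respProb_pos b)) (logisticProb_pos α β b x))).ne'

lemma exp_gammaTrue (hlog : IsLogistic Pop α β) :
    Real.exp (gammaTrue Pop) = respProb Pop false / respProb Pop true :=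
  Real.exp_log (div_pos (hlog.respProb_pos false) (hlog.respProb_pos true))

lemma inv_one_add_exp_gammaTrue (hlog : IsLogistic Pop α β) :
    (1 + Real.exp (gammaTrue Pop))⁻¹ = caseProp Pop := by
  rw [hlog.exp_gammaTrue, one_add_div (hlog.respProb_pos true).ne', respProb_add, one_div, inv_inv]
  rfl

lemma mom_thetaTrue (hlog : IsLogistic Pop α β) {h : Vec p → Vec q}
    (hint : ∀ b, Integrable h (condLaw Pop b)) :
    mom (thetaTrue Pop α β h) = (1 + Real.exp (gam (thetaTrue Pop α β h)))⁻¹ •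
      (∫ x, h x ∂(condLaw Pop true)
        + Real.exp (gam (thetaTrue Pop α β h)) • ∫ x, h x ∂(condLaw Pop false)) := by
  have hcase : caseProp Pop * Real.exp (gammaTrue Pop) = respProb Pop false := by
    rw [hlog.exp_gammaTrue]
    exact mul_div_cancel₀ _ (hlog.respProb_pos true).ne'
  rw [thetaTrue, mom_mkParam, gam_mkParam, hlog.inv_one_add_exp_gammaTrue, smul_add, smul_smul,
    hcase, integral_fst hint]
  rfl

lemma condLaw_true_eq_withDensity_tilt (hlog : IsLogistic Pop α β) (h : Vec p → Vec q) :
    condLaw Pop true = (condLaw Pop false).withDensity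
      fun x => ENNReal.ofReal (tilt (thetaTrue Pop α β h) x) := by
  have htilt (x : Vec p) : tilt (thetaTrue Pop α β h) x
      = respProb Pop false / respProb Pop true * Real.exp (α + inner ℝ β x) := by
    simp only [tilt, thetaTrue, astar_mkParam, bet_mkParam]
    rw [add_assoc, Real.exp_add, hlog.exp_gammaTrue]
  have htrue := hlog.respProb_pos true
  have hfalse := hlog.respProb_pos false
  rw [hlog.condLaw_eq_withDensity true, hlog.condLaw_eq_withDensity false,
    ← withDensity_mul _ ((measurable_logisticProb α β false).const_mul _).ennreal_ofReal
      (measurable_tilt _).ennreal_ofReal]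
  congr 1
  funext x
  rw [Pi.mul_apply, ← ENNReal.ofReal_mul
    (mul_nonneg (inv_nonneg.2 hfalse.le) (logisticProb_pos _ _ _ _).le), htilt]
  simp only [logisticProb]
  congr 1
  field_simp

lemma eq_of_isLogistic (hlog : IsLogistic Pop α β) {α' : ℝ} {β' : Vec p}
    (hlog' : IsLogistic Pop α' β')
    (hF : ∀ S : AffineSubspace ℝ (Vec p), S ≠ ⊤ → ¬ ∀ᵐ x ∂Pop.fst, x ∈ S) :
    α' = α ∧ β' = β := by
  have hae : (fun x => ENNReal.ofReal (logisticProb α' β' true x)) =ᵐ[Pop.fst]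
      fun x => ENNReal.ofReal (logisticProb α β true x) :=
    ae_eq_of_forall_setLIntegral_eq_of_sigmaFinite
      (measurable_logisticProb α' β' true).ennreal_ofReal
      (measurable_logisticProb α β true).ennreal_ofReal fun A hA _ => by
        rw [← hlog.apply_prod_singleton true hA, ← hlog'.apply_prod_singleton true hA]
  have hzero : ∀ᵐ x ∂Pop.fst, (α' - α) + inner ℝ (β' - β) x = 0 := by
    filter_upwards [hae] with x hx
    have := add_inner_eq_of_logisticProb_eq ((ENNReal.ofReal_eq_ofReal_iff
      (logisticProb_pos α' β' true x).le (logisticProb_pos α β true x).le).1 hx)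
    rw [inner_sub_left]
    linarith
  exact (eq_zero_of_ae_affine_eq_zero hF hzero).imp sub_eq_zero.1 sub_eq_zero.1

theorem identified (hlog : IsLogistic Pop α β) {h : Vec p → Vec q}
    (hh : Integrable h Pop.fst)
    (hne : ∫ x, h x ∂(condLaw Pop true) ≠ ∫ x, h x ∂(condLaw Pop false))
    (hF : ∀ S : AffineSubspace ℝ (Vec p), S ≠ ⊤ → ¬ ∀ᵐ x ∂Pop.fst, x ∈ S)
    {Pop' : Measure (Vec p × Bool)} [IsProbabilityMeasure Pop'] {α' : ℝ} {β' : Vec p}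
    (hlog' : IsLogistic Pop' α' β') (hcond : ∀ b, condLaw Pop' b = condLaw Pop b)
    (hmean : ∫ x, h x ∂Pop'.fst = ∫ x, h x ∂Pop.fst) :
    α' = α ∧ caseProp Pop' = caseProp Pop := by
  have hresp := respProb_eq_of_condLaw_eq
    (fun b => integrable_condLaw (hlog.respProb_pos b) hh) hne hcond hmean
  have hfst : Pop'.fst = Pop.fst := by
    simp only [fst_eq_add_smul_condLaw, hresp, hcond]
  have hlogPop' : IsLogistic Pop α' β' := fun A hA => by
    rw [← hfst, ← hlog' A hA, ← ofReal_respProb_mul_condLaw true hA,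
      ← ofReal_respProb_mul_condLaw true hA, hresp, hcond]
  exact ⟨(hlog.eq_of_isLogistic hlogPop' hF).1, hresp true⟩

end IsLogistic

/-! ### Stochastic limits -/

/-- Almost surely `E n` occurs for all large `n`, and the probability of `E n` tends to one. The
second clause is not a consequence of the first because the events need not be measurable. -/
structure HoldsEventually {Ω : Type*} [MeasurableSpace Ω] (P : Measure Ω) (E : ℕ → Set Ω) :
    Prop where
  ae : ∀ᵐ ω ∂P, ∀ᶠ n in atTop, ω ∈ E n
  prob : Tendsto (fun n => P (E n)ᶜ) atTop (𝓝 0)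

namespace HoldsEventually

variable {Ω : Type*} [MeasurableSpace Ω] {P : Measure Ω} {E E' : ℕ → Set Ω}

lemma mono (hE : HoldsEventually P E) (h : ∀ᶠ n in atTop, E n ⊆ E' n) : HoldsEventually P E' where
  ae := hE.ae.mono fun _ hω => hω.mp (h.mono fun _ hn hmem => hn hmem)
  prob := tendsto_of_tendsto_of_tendsto_of_le_of_le' tendsto_const_nhds hE.prob
    (Eventually.of_forall fun _ => zero_le)
    (h.mono fun _ hn => measure_mono (Set.compl_subset_compl.2 hn))

lemma inter (hE : HoldsEventually P E) (hE' : HoldsEventually P E') :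
    HoldsEventually P fun n => E n ∩ E' n where
  ae := by filter_upwards [hE.ae, hE'.ae] with ω hω hω' using hω.and hω'
  prob := by
    refine tendsto_of_tendsto_of_tendsto_of_le_of_le tendsto_const_nhds
      (by simpa only [add_zero] using hE.prob.add hE'.prob) (fun _ => zero_le) fun n => ?_
    simpa only [Set.compl_inter] using measure_union_le (E n)ᶜ (E' n)ᶜ

lemma biInter {J : Type*} (s : Finset J) {E : J → ℕ → Set Ω}
    (hE : ∀ j ∈ s, HoldsEventually P (E j)) : HoldsEventually P fun n => ⋂ j ∈ s, E j n := by
  classical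
  induction s using Finset.induction_on with
  | empty => exact ⟨by simp, by simp⟩
  | insert a s _ ih =>
    simp only [Finset.set_biInter_insert]
    exact (hE a (Finset.mem_insert_self _ _)).inter
      (ih fun j hj => hE j (Finset.mem_insert_of_mem hj))

lemma iInter {J : Type*} [Finite J] {E : J → ℕ → Set Ω} (hE : ∀ j, HoldsEventually P (E j)) :
    HoldsEventually P fun n => ⋂ j, E j n := by
  have := Fintype.ofFinite J
  simpa using biInter Finset.univ fun j _ => hE j

lemma comp (hE : HoldsEventually P E) {k : ℕ → ℕ} (hk : Tendsto k atTop atTop) :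
    HoldsEventually P fun n => E (k n) :=
  ⟨hE.ae.mono fun _ h => hk.eventually h, hE.prob.comp hk⟩

lemma of_tendsto [IsFiniteMeasure P] {H : Type*} [NormedAddCommGroup H] {f : ℕ → Ω → H}
    (hf : ∀ n, AEStronglyMeasurable (f n) P) {a : H}
    (h : ∀ᵐ ω ∂P, Tendsto (fun n => f n ω) atTop (𝓝 a)) {ε : ℝ} (hε : 0 < ε) :
    HoldsEventually P fun n => {ω | ‖f n ω - a‖ < ε} where
  ae := h.mono fun _ hω => (tendsto_iff_norm_sub_tendsto_zero.1 hω).eventually (gt_mem_nhds hε)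
  prob := by
    refine ((tendstoInMeasure_iff_norm.1 (tendstoInMeasure_of_tendsto_ae hf h)) ε hε).congr
      fun n => congrArg P ?_
    ext ω
    simp

end HoldsEventually

/-- `f n = o(u n)`, both almost surely and in probability. -/
def StochasticLittleO {Ω H : Type*} [MeasurableSpace Ω] [Norm H] (P : Measure Ω) (f : ℕ → Ω → H)
    (u : ℕ → ℝ) : Prop :=
  ∀ ε > 0, HoldsEventually P fun n => {ω | ‖f n ω‖ ≤ ε * u n}

namespace StochasticLittleO

variable {Ω H : Type*} [MeasurableSpace Ω] {P : Measure Ω} [NormedAddCommGroup H]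
  {f g : ℕ → Ω → H} {u v : ℕ → ℝ}

lemma of_norm_le {K : Type*} [NormedAddCommGroup K] {g : ℕ → Ω → K} (hf : StochasticLittleO P f u)
    {a : ℕ → ℝ} (ha : ∀ n, 0 ≤ a n) (hv : ∀ᶠ n in atTop, a n * u n ≤ v n)
    (hg : ∀ᶠ n in atTop, ∀ ω, ‖g n ω‖ ≤ a n * ‖f n ω‖) : StochasticLittleO P g v := by
  intro ε hε
  refine (hf ε hε).mono ?_
  filter_upwards [hv, hg] with n hvn hgn ω hω
  calc ‖g n ω‖ ≤ a n * ‖f n ω‖ := hgn ω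
    _ ≤ a n * (ε * u n) := mul_le_mul_of_nonneg_left hω (ha n)
    _ = ε * (a n * u n) := by ring
    _ ≤ ε * v n := mul_le_mul_of_nonneg_left hvn hε.le

lemma congr (hf : StochasticLittleO P f u) (hg : ∀ᶠ n in atTop, ∀ ω, g n ω = f n ω) :
    StochasticLittleO P g u :=
  hf.of_norm_le (a := fun _ => 1) (fun _ => zero_le_one)
    (Eventually.of_forall fun _ => (one_mul _).le)
    (hg.mono fun n hn ω => by rw [hn ω, one_mul])

lemma add (hf : StochasticLittleO P f u) (hg : StochasticLittleO P g u) :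
    StochasticLittleO P (fun n ω => f n ω + g n ω) u := by
  intro ε hε
  refine ((hf (ε / 2) (half_pos hε)).inter (hg (ε / 2) (half_pos hε))).mono
    (Eventually.of_forall fun n ω hω => (norm_add_le _ _).trans ?_)
  have hfω : ‖f n ω‖ ≤ ε / 2 * u n := hω.1
  have hgω : ‖g n ω‖ ≤ ε / 2 * u n := hω.2
  linarith

lemma of_forall_apply {J : Type*} [Fintype J] {f : ℕ → Ω → EuclideanSpace ℝ J}
    (hu : ∀ n, 0 ≤ u n) (h : ∀ j, StochasticLittleO P (fun n ω => f n ω j) u) :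
    StochasticLittleO P f u := by
  intro ε hε
  have hd : 0 < ε / (Fintype.card J + 1) := by positivity
  refine (HoldsEventually.iInter fun j => h j _ hd).mono (Eventually.of_forall fun n ω hω => ?_)
  have hbound (j : J) : ‖f n ω j‖ ^ 2 ≤ (ε / (Fintype.card J + 1) * u n) ^ 2 :=
    pow_le_pow_left₀ (norm_nonneg _) (Set.mem_iInter.1 hω j) 2
  refine le_of_sq_le_sq ?_ (mul_nonneg hε.le (hu n))
  calc ‖f n ω‖ ^ 2 ≤ Fintype.card J * (ε / (Fintype.card J + 1) * u n) ^ 2 := by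
        rw [EuclideanSpace.norm_sq_eq, ← nsmul_eq_mul]
        exact Finset.sum_le_card_nsmul _ _ _ fun j _ => hbound j
    _ = Fintype.card J / (Fintype.card J + 1 : ℝ) ^ 2 * (ε * u n) ^ 2 := by field_simp
    _ ≤ (ε * u n) ^ 2 := by
        refine mul_le_of_le_one_left (sq_nonneg _) (div_le_one_of_le₀ ?_ (sq_nonneg _))
        nlinarith [(Nat.cast_nonneg (Fintype.card J) : (0 : ℝ) ≤ _)]

lemma of_forall_dual [NormedSpace ℝ H] [FiniteDimensional ℝ H] (hu : ∀ n, 0 ≤ u n)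
    (h : ∀ φ : H →L[ℝ] ℝ, StochasticLittleO P (fun n ω => φ (f n ω)) u) :
    StochasticLittleO P f u := by
  let e : H ≃L[ℝ] EuclideanSpace ℝ (Fin (Module.finrank ℝ H)) := toEuclidean
  let L : EuclideanSpace ℝ (Fin (Module.finrank ℝ H)) →L[ℝ] H := e.symm
  have hcoord : StochasticLittleO P (fun n ω => ‖L‖ • e (f n ω)) u :=
    of_forall_apply hu fun j =>
      h (‖L‖ • (EuclideanSpace.proj j).comp e.toContinuousLinearMap)
  refine hcoord.of_norm_le (a := fun _ => 1) (fun _ => zero_le_one)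
    (Eventually.of_forall fun _ => (one_mul _).le) (Eventually.of_forall fun n ω => ?_)
  rw [one_mul, norm_smul, norm_norm]
  simpa [L] using L.le_opNorm (e (f n ω))

lemma of_ae_tendsto [IsFiniteMeasure P] [NormedSpace ℝ H] (hu : ∀ᶠ n in atTop, 0 < u n)
    (hf : ∀ n, AEStronglyMeasurable (f n) P)
    (h : ∀ᵐ ω ∂P, Tendsto (fun n => (u n)⁻¹ • f n ω) atTop (𝓝 0)) : StochasticLittleO P f u := by
  intro ε hε
  refine (HoldsEventually.of_tendsto (fun n => (hf n).const_smul _) h hε).mono ?_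
  filter_upwards [hu] with n hn ω hω
  have hlt : ‖(u n)⁻¹ • f n ω - 0‖ < ε := hω
  rw [sub_zero, norm_smul, norm_inv, Real.norm_of_nonneg hn.le, inv_mul_lt_iff₀ hn, mul_comm] at hlt
  exact hlt.le

end StochasticLittleO

section Gram

open InnerProductSpace

variable {V : Type*} [NormedAddCommGroup V] [InnerProductSpace ℝ V]

lemma exists_mul_sq_norm_le_inner_of_pos [FiniteDimensional ℝ V] {A : V →L[ℝ] V}
    (hA : ∀ v ≠ 0, 0 < inner ℝ v (A v)) :
    ∃ c : ℝ, 0 < c ∧ ∀ v, c * ‖v‖ ^ 2 ≤ inner ℝ v (A v) := by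
  rcases subsingleton_or_nontrivial V with _ | _
  · exact ⟨1, one_pos, fun v => by simp [Subsingleton.elim v 0]⟩
  obtain ⟨u, hu, hmin⟩ := (isCompact_sphere (0 : V) 1).exists_isMinOn
    (NormedSpace.sphere_nonempty.2 zero_le_one)
    (by fun_prop : Continuous fun v => inner ℝ v (A v)).continuousOn
  refine ⟨_, hA u (ne_zero_of_mem_unit_sphere ⟨u, hu⟩), fun v => ?_⟩
  rcases eq_or_ne v 0 with rfl | hv
  · simp
  have hnorm : ‖v‖ ≠ 0 := norm_ne_zero_iff.2 hv
  have hle : inner ℝ u (A u) ≤ inner ℝ (‖v‖⁻¹ • v) (A (‖v‖⁻¹ • v)) :=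
    hmin (by simp [norm_smul, inv_mul_cancel₀ hnorm])
  rw [map_smul, inner_smul_left, inner_smul_right, conj_trivial, ← mul_assoc, ← sq, inv_pow] at hle
  exact (le_inv_mul_iff₀' (by positivity)).1 hle

lemma inner_rankOne_self (v w : V) : inner ℝ v (rankOne ℝ w w v) = inner ℝ v w ^ 2 := by
  rw [rankOne_apply, inner_smul_right, real_inner_comm, sq]

variable {S Ω : Type*} [MeasurableSpace S] [MeasurableSpace Ω] {P : Measure Ω}
  [IsProbabilityMeasure P] {ξ : ℕ → Ω → S} {F : Measure S} [IsProbabilityMeasure F]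
  [FiniteDimensional ℝ V] [MeasurableSpace V] [BorelSpace V] {z : S → V} {K : ℝ}

lemma stronglyMeasurable_rankOne_self (hz : Measurable z) :
    StronglyMeasurable fun s => rankOne ℝ (z s) (z s) :=
  Continuous.comp_stronglyMeasurable (g := fun v : V => rankOne ℝ v v)
    ((rankOne ℝ : V →L[ℝ] V →L⋆[ℝ] V →L[ℝ] V).continuous.clm_apply continuous_id)
    hz.stronglyMeasurable

lemma integrable_rankOne_self (hz : Measurable z) (hK : ∀ s, ‖z s‖ ≤ K) :
    Integrable (fun s => rankOne ℝ (z s) (z s)) F :=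
  Integrable.of_bound (stronglyMeasurable_rankOne_self hz).aestronglyMeasurable (K ^ 2)
    (Eventually.of_forall fun s => by
      rw [norm_rankOne, ← sq]
      exact pow_le_pow_left₀ (norm_nonneg _) (hK s) 2)

lemma inner_integral_rankOne_pos (hz : Measurable z) (hK : ∀ s, ‖z s‖ ≤ K)
    (hnd : ∀ v : V, (∀ᵐ s ∂F, inner ℝ v (z s) = (0 : ℝ)) → v = 0) {v : V} (hv : v ≠ 0) :
    0 < inner ℝ v ((∫ s, rankOne ℝ (z s) (z s) ∂F) v) := by
  have hint : Integrable (fun s => rankOne ℝ (z s) (z s)) F := integrable_rankOne_self hz hK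
  have hsq : Integrable (fun s => inner ℝ v (z s) ^ 2) F := by
    simpa only [inner_rankOne_self] using (hint.apply_continuousLinearMap v).const_inner (𝕜 := ℝ) v
  rw [ContinuousLinearMap.integral_apply hint,
    ← integral_inner (𝕜 := ℝ) (hint.apply_continuousLinearMap v)]
  simp only [inner_rankOne_self]
  refine (integral_nonneg fun s => sq_nonneg _).lt_of_ne' fun hzero => hv (hnd v ?_)
  filter_upwards [(integral_eq_zero_iff_of_nonneg (fun s => sq_nonneg _) hsq).1 hzero] with s hs
  exact pow_eq_zero_iff two_ne_zero |>.1 hs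

/-- The average of the operators `z zᵀ` converges in operator norm to a positive definite one. -/
theorem exists_gram_lower_bound (hξm : ∀ i, Measurable (ξ i)) (hind : iIndepFun ξ P)
    (hlaw : ∀ i, P.map (ξ i) = F) (hz : Measurable z) (hK : ∀ s, ‖z s‖ ≤ K)
    (hnd : ∀ v : V, (∀ᵐ s ∂F, inner ℝ v (z s) = (0 : ℝ)) → v = 0) :
    ∃ c : ℝ, 0 < c ∧ HoldsEventually P fun n => {ω | ∀ v : V,
      c * n * ‖v‖ ^ 2 ≤ ∑ i ∈ Finset.range n, (inner ℝ v (z (ξ i ω)) : ℝ) ^ 2} := by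
  obtain ⟨c, hc, hlower⟩ := exists_mul_sq_norm_le_inner_of_pos fun v hv =>
    inner_integral_rankOne_pos (F := F) hz hK hnd hv
  set A : V →L[ℝ] V := ∫ s, rankOne ℝ (z s) (z s) ∂F
  set G : ℕ → Ω → V →L[ℝ] V := fun n ω =>
    (n : ℝ)⁻¹ • ∑ i ∈ Finset.range n, rankOne ℝ (z (ξ i ω)) (z (ξ i ω)) with hG
  have hclose : HoldsEventually P fun n => {ω | ‖G n ω - A‖ < c / 2} := by
    have hmeas : StronglyMeasurable fun s => rankOne ℝ (z s) (z s) :=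
      stronglyMeasurable_rankOne_self hz
    refine HoldsEventually.of_tendsto (fun n => ?_) (ae_tendsto_average hξm hind hlaw
      hmeas.measurable (integrable_rankOne_self hz hK)) (half_pos hc)
    exact ((Finset.stronglyMeasurable_fun_sum _ fun i _ =>
      hmeas.comp_measurable (hξm i)).const_smul (n : ℝ)⁻¹).aestronglyMeasurable
  refine ⟨c / 2, half_pos hc, hclose.mono ?_⟩
  filter_upwards [eventually_gt_atTop 0] with n hn ω hω v
  have hn0 : (0 : ℝ) < n := Nat.cast_pos.2 hn
  have hgram : ∑ i ∈ Finset.range n, (inner ℝ v (z (ξ i ω)) : ℝ) ^ 2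
      = n * inner ℝ v (G n ω v) := by
    simp only [hG, smul_apply, sum_apply, inner_smul_right,
      inner_sum, inner_rankOne_self, mul_inv_cancel_left₀ hn0.ne']
  have hdiff : inner ℝ v (A v) - inner ℝ v (G n ω v) ≤ c / 2 * ‖v‖ ^ 2 := by
    calc inner ℝ v (A v) - inner ℝ v (G n ω v) = -inner ℝ v ((G n ω - A) v) := by
          rw [sub_apply, inner_sub_right]
          ring
      _ ≤ ‖v‖ * ‖(G n ω - A) v‖ := (neg_le_abs _).trans (abs_real_inner_le_norm _ _)
      _ ≤ ‖v‖ * (c / 2 * ‖v‖) := by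
          gcongr
          exact (G n ω - A).le_of_opNorm_le (le_of_lt hω) v
      _ = _ := by ring
  rw [hgram]
  calc c / 2 * n * ‖v‖ ^ 2 = n * (c * ‖v‖ ^ 2 - c / 2 * ‖v‖ ^ 2) := by ring
    _ ≤ _ := by
      gcongr
      linarith [hlower v]

end Gram

/-! ### Case-control samples -/

lemma sum_covariate {Ω H : Type*} [AddCommMonoid H] (X : Bool → ℕ → Ω → Vec p) (n₁ n₀ : ℕ) (ω : Ω)
    (f : Vec p → H) : ∑ i, f (covariate X n₁ n₀ ω i)
      = ∑ i ∈ Finset.range n₁, f (X true i ω) + ∑ i ∈ Finset.range n₀, f (X false i ω) := by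
  rw [Fintype.sum_sum_type, Finset.sum_range, Finset.sum_range]
  rfl

lemma tendsto_atTop_of_eventually_mul_le {κ : ℝ} (hκ : 0 < κ) {k : ℕ → ℕ}
    (hk : ∀ᶠ n : ℕ in atTop, κ * n ≤ k n) : Tendsto k atTop atTop :=
  tendsto_natCast_atTop_iff.1
    (tendsto_atTop_mono' atTop hk (tendsto_natCast_atTop_atTop.const_mul_atTop hκ))

section Density

variable {S E : Type*} [MeasurableSpace S] [NormedAddCommGroup E] [NormedSpace ℝ E] {F : Measure S}
  {t : S → ℝ} {f : S → E}

lemma integral_withDensity_ofReal (ht : Measurable t) (ht0 : ∀ x, 0 ≤ t x) :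
    ∫ x, f x ∂F.withDensity (fun x => ENNReal.ofReal (t x)) = ∫ x, t x • f x ∂F := by
  rw [integral_withDensity_eq_integral_toReal_smul ht.ennreal_ofReal (by simp)]
  simp only [ENNReal.toReal_ofReal (ht0 _)]

lemma integrable_withDensity_ofReal_iff (ht : Measurable t) (ht0 : ∀ x, 0 ≤ t x) :
    Integrable f (F.withDensity fun x => ENNReal.ofReal (t x)) ↔
      Integrable (fun x => t x • f x) F := by
  rw [integrable_withDensity_iff_integrable_smul' ht.ennreal_ofReal (by simp)]
  simp only [ENNReal.toReal_ofReal (ht0 _)]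

end Density

/-- A growing case-control sample: `X true` and `X false` are sequences of independent cases and
controls with laws `F true` and `F false`, of which the first `n₁ n` and `n₀ n` are observed. The
tilt at `θ₀` is the density of `F true` with respect to `F false`, and `m` is an envelope with three
moments for the functions that are averaged over the sample. -/
structure CaseControlDesign {Ω : Type*} [MeasurableSpace Ω] (P : Measure Ω)
    (X : Bool → ℕ → Ω → Vec p) (F : Bool → Measure (Vec p)) (θ₀ : Param p q) (n₁ n₀ : ℕ → ℕ)
    (κ : ℝ) (m : Vec p → ℝ) : Prop where
  measurable : ∀ b i, Measurable (X b i)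
  indep : ∀ b, iIndepFun (X b) P
  law : ∀ b i, P.map (X b i) = F b
  size : ∀ n, n₁ n + n₀ n = n
  frac_pos : 0 < κ
  balanced : ∀ᶠ n : ℕ in atTop, κ * n ≤ n₁ n ∧ κ * n ≤ n₀ n
  density : F true = (F false).withDensity fun x => ENNReal.ofReal (tilt θ₀ x)
  envelope_measurable : Measurable m
  one_le_envelope : ∀ x, 1 ≤ m x
  envelope_integrable : ∀ b, Integrable (fun x => m x ^ 3) (F b)

namespace CaseControlDesign

variable {Ω : Type*} [MeasurableSpace Ω] {P : Measure Ω} {X : Bool → ℕ → Ω → Vec p}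
  {F : Bool → Measure (Vec p)} {θ₀ : Param p q} {n₁ n₀ : ℕ → ℕ} {κ : ℝ} {m : Vec p → ℝ}
  (D : CaseControlDesign P X F θ₀ n₁ n₀ κ m)

include D

lemma cases_le (n : ℕ) : n₁ n ≤ n := (Nat.le_add_right _ _).trans_eq (D.size n)

lemma controls_le (n : ℕ) : n₀ n ≤ n := (Nat.le_add_left _ _).trans_eq (D.size n)

lemma card_index (n : ℕ) : (Fintype.card (Fin (n₁ n) ⊕ Fin (n₀ n)) : ℝ) = n := by
  rw [Fintype.card_sum, Fintype.card_fin, Fintype.card_fin, D.size]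

lemma tendsto_cases : Tendsto n₁ atTop atTop :=
  tendsto_atTop_of_eventually_mul_le D.frac_pos (D.balanced.mono fun _ hn => hn.1)

lemma tendsto_controls : Tendsto n₀ atTop atTop :=
  tendsto_atTop_of_eventually_mul_le D.frac_pos (D.balanced.mono fun _ hn => hn.2)

lemma integral_cases {E : Type*} [NormedAddCommGroup E] [NormedSpace ℝ E] (f : Vec p → E) :
    ∫ x, f x ∂F true = ∫ x, tilt θ₀ x • f x ∂F false := by
  rw [D.density, integral_withDensity_ofReal (measurable_tilt θ₀) fun x => (tilt_pos θ₀ x).le]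

section Integrals

variable {E : Type*} [NormedAddCommGroup E] {f : Vec p → E}

lemma integrable_of_norm_le (hf : StronglyMeasurable f) {C : ℝ} (hC : ∀ x, ‖f x‖ ≤ C * m x)
    (b : Bool) : Integrable f (F b) := by
  have hm (x : Vec p) : 0 ≤ m x := zero_le_one.trans (D.one_le_envelope x)
  refine ((D.envelope_integrable b).const_mul |C|).mono' hf.aestronglyMeasurable
    (Eventually.of_forall fun x => ?_)
  calc ‖f x‖ ≤ C * m x := hC x
    _ ≤ |C| * m x ^ 3 := mul_le_mul (le_abs_self C)
        (le_self_pow₀ (D.one_le_envelope x) three_ne_zero) (hm x) (abs_nonneg C)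

lemma smul_integral_cases_add_smul_integral_controls [NormedSpace ℝ E]
    (hf : ∀ b, Integrable f (F b)) (a b : ℝ) :
    b • ∫ x, f x ∂F true + a • ∫ x, f x ∂F false
      = ∫ x, pooledDensity b a θ₀ x • f x ∂F false := by
  have hcases : Integrable (fun x => tilt θ₀ x • f x) (F false) := by
    have htrue := hf true
    rwa [D.density, integrable_withDensity_ofReal_iff (measurable_tilt θ₀)
      fun x => (tilt_pos θ₀ x).le] at htrue
  rw [D.integral_cases, ← integral_smul, ← integral_smul,
    ← integral_add (by exact hcases.smul b) (by exact (hf false).smul a)]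
  refine integral_congr_ae (Eventually.of_forall fun x => ?_)
  simp only [pooledDensity, add_smul, mul_smul]
  exact add_comm _ _

end Integrals

lemma eventually_cases_pos_controls_pos : ∀ᶠ n in atTop, (0 : ℝ) < n₁ n ∧ (0 : ℝ) < n₀ n := by
  filter_upwards [D.tendsto_cases.eventually_gt_atTop 0, D.tendsto_controls.eventually_gt_atTop 0]
    with n h1 h0 using ⟨Nat.cast_pos.2 h1, Nat.cast_pos.2 h0⟩

lemma eventually_mul_div_pooledDensity_le {g : Vec p → ℝ} (hg : ∀ x, g x ≤ 1 + tilt θ₀ x) :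
    ∀ᶠ n : ℕ in atTop, ∀ x, n * (g x / pooledDensity (n₁ n) (n₀ n) θ₀ x) ≤ κ⁻¹ := by
  filter_upwards [D.balanced, D.eventually_cases_pos_controls_pos] with n hn hpos x
  rw [← mul_div_assoc, div_le_iff₀ (pooledDensity_pos hpos.1 hpos.2 θ₀ x), ← div_eq_inv_mul,
    le_div_iff₀ D.frac_pos]
  calc n * g x * κ = κ * n * g x := by ring
    _ ≤ κ * n * (1 + tilt θ₀ x) :=
        mul_le_mul_of_nonneg_left (hg x) (mul_nonneg D.frac_pos.le (Nat.cast_nonneg n))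
    _ = κ * n + κ * n * tilt θ₀ x := by ring
    _ ≤ n₀ n + n₁ n * tilt θ₀ x :=
        add_le_add hn.2 (mul_le_mul_of_nonneg_right hn.1 (tilt_pos θ₀ x).le)

variable [IsProbabilityMeasure P]

lemma holdsEventually_sum_envelope_le {b : Bool} {k : ℕ → ℕ} (hk : Tendsto k atTop atTop)
    (hkn : ∀ n, k n ≤ n) : HoldsEventually P fun n =>
      {ω | ∑ i ∈ Finset.range (k n), m (X b i ω) ^ 3 ≤ (∫ x, m x ^ 3 ∂F b + 1) * n} := by
  have hm3 : Measurable fun x => m x ^ 3 := D.envelope_measurable.pow_const 3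
  have hmean : 0 ≤ ∫ x, m x ^ 3 ∂F b := integral_nonneg fun x =>
    pow_nonneg (zero_le_one.trans (D.one_le_envelope x)) 3
  refine ((HoldsEventually.of_tendsto (fun n => ?_) (ae_tendsto_average (D.measurable b)
    (D.indep b) (D.law b) hm3 (D.envelope_integrable b)) one_pos).comp hk).mono ?_
  · exact ((Finset.measurable_fun_sum _ fun i _ =>
      hm3.comp (D.measurable b i)).const_smul (n : ℝ)⁻¹).aestronglyMeasurable
  · filter_upwards [hk.eventually_gt_atTop 0] with n hn ω hω
    have hlt : (k n : ℝ)⁻¹ * ∑ i ∈ Finset.range (k n), m (X b i ω) ^ 3 < ∫ x, m x ^ 3 ∂F b + 1 :=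
      sub_lt_iff_lt_add'.1 ((le_abs_self _).trans_lt hω)
    refine ((inv_mul_lt_iff₀ (Nat.cast_pos.2 hn)).1 hlt).le.trans ?_
    rw [mul_comm]
    gcongr
    exact hkn n

lemma exists_moment_bound : ∃ M : ℝ, 0 ≤ M ∧ HoldsEventually P fun n =>
    {ω | ∑ i, m (covariate X (n₁ n) (n₀ n) ω i) ^ 3 ≤ M * n} := by
  have hmean (b : Bool) : 0 ≤ ∫ x, m x ^ 3 ∂F b := integral_nonneg fun x =>
    pow_nonneg (zero_le_one.trans (D.one_le_envelope x)) 3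
  refine ⟨(∫ x, m x ^ 3 ∂F true + 1) + (∫ x, m x ^ 3 ∂F false + 1),
    by linarith [hmean true, hmean false],
    ((D.holdsEventually_sum_envelope_le (b := true) D.tendsto_cases D.cases_le).inter
      (D.holdsEventually_sum_envelope_le (b := false) D.tendsto_controls D.controls_le)).mono
    (Eventually.of_forall fun n ω hω => ?_)⟩
  rw [Set.mem_ofPred_eq, sum_covariate X _ _ ω fun x => m x ^ 3, add_mul]
  exact add_le_add hω.1 hω.2

section Averages

variable {E : Type*} [NormedAddCommGroup E] [NormedSpace ℝ E] [FiniteDimensional ℝ E]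
  [MeasurableSpace E] [BorelSpace E]

lemma stochasticLittleO_row (b : Bool) {k : ℕ → ℕ} (hk : ∀ n, k n ≤ n) {f : ℕ → Vec p → E}
    (hf : ∀ n, Measurable (f n)) {C : ℝ} (hC : ∀ᶠ n in atTop, ∀ x, ‖f n x‖ ≤ C * m x) :
    StochasticLittleO P (fun n ω => ∑ i ∈ Finset.range (k n), f n (X b i ω) -
      (k n : ℝ) • ∫ x, f n x ∂F b) (fun n => n * rate n) := by
  refine StochasticLittleO.of_forall_dual
    (fun n => mul_nonneg (Nat.cast_nonneg n) (rate_nonneg n)) fun φ => ?_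
  have hφf (n : ℕ) : Measurable fun x => φ (f n x) := φ.continuous.measurable.comp (hf n)
  have hφm : ∀ᶠ n in atTop, ∀ x, |φ (f n x)| ≤ max 1 (‖φ‖ * C) * m x := hC.mono fun n hn x =>
    calc |φ (f n x)| ≤ ‖φ‖ * (C * m x) := φ.le_opNorm_of_le (hn x)
      _ = ‖φ‖ * C * m x := (mul_assoc _ _ _).symm
      _ ≤ max 1 (‖φ‖ * C) * m x := mul_le_mul_of_nonneg_right (le_max_right _ _)
        (zero_le_one.trans (D.one_le_envelope x))
  have hstrong := ae_tendsto_rate_sum (D.measurable b) (D.indep b) (D.law b) hφf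
    (D.envelope_measurable.const_mul (max 1 (‖φ‖ * C)))
    (fun x => one_le_mul_of_one_le_of_one_le (le_max_left _ _) (D.one_le_envelope x))
    (by simpa only [mul_pow] using (D.envelope_integrable b).const_mul _) hφm hk
  refine StochasticLittleO.of_ae_tendsto ?_ (fun n => ?_) (hstrong.mono fun ω hω => hω.congr' ?_)
  · filter_upwards [eventually_gt_atTop 0] with n hn
    exact mul_pos (Nat.cast_pos.2 hn) (rate_pos hn)
  · exact (φ.continuous.measurable.comp ((Finset.measurable_fun_sum _ fun i _ =>
      (hf n).comp (D.measurable b i)).sub_const _)).aestronglyMeasurable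
  · filter_upwards [hC, eventually_gt_atTop 0] with n hCn hn
    have hinv : ((n : ℝ) * rate n)⁻¹ = rate n ^ 2 :=
      inv_eq_of_mul_eq_one_right (by rw [← mul_rate_pow hn]; ring)
    rw [hinv, smul_eq_mul, map_sub, map_sum, map_smul, Finset.sum_sub_distrib, Finset.sum_const,
      Finset.card_range, nsmul_eq_mul, smul_eq_mul,
      ← φ.integral_comp_comm (D.integrable_of_norm_le (hf n).stronglyMeasurable hCn b)]

/-- Summing over cases and controls amounts, in mean, to integrating against `pooledDensity`, which
the weights cancel. -/
lemma stochasticLittleO_weighted {g : Vec p → ℝ} (hgm : Measurable g) (hg0 : ∀ x, 0 ≤ g x)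
    (hg : ∀ x, g x ≤ 1 + tilt θ₀ x) {z : Vec p → E} (hz : Measurable z) (hzm : ∀ x, ‖z x‖ ≤ m x) :
    StochasticLittleO P (fun n ω => ∑ i, (g (covariate X (n₁ n) (n₀ n) ω i) /
        pooledDensity (n₁ n) (n₀ n) θ₀ (covariate X (n₁ n) (n₀ n) ω i)) •
          z (covariate X (n₁ n) (n₀ n) ω i) - ∫ x, g x • z x ∂F false) rate := by
  set f : ℕ → Vec p → E := fun n x => (n * (g x / pooledDensity (n₁ n) (n₀ n) θ₀ x)) • z x with hf
  have hfm (n : ℕ) : Measurable (f n) := by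
    have hpool : Measurable (pooledDensity (n₁ n) (n₀ n) θ₀) :=
      ((measurable_tilt θ₀).const_mul _).const_add _
    exact ((hgm.div hpool).const_mul _).smul hz
  have hfC : ∀ᶠ n in atTop, ∀ x, ‖f n x‖ ≤ κ⁻¹ * m x := by
    filter_upwards [D.eventually_mul_div_pooledDensity_le hg, D.eventually_cases_pos_controls_pos]
      with n hn hpos x
    have hweight : 0 ≤ n * (g x / pooledDensity (n₁ n) (n₀ n) θ₀ x) :=
      mul_nonneg (Nat.cast_nonneg n)
        (div_nonneg (hg0 x) (pooledDensity_pos hpos.1 hpos.2 θ₀ x).le)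
    rw [hf, norm_smul, Real.norm_of_nonneg hweight]
    exact mul_le_mul (hn x) (hzm x) (norm_nonneg _) (inv_nonneg.2 D.frac_pos.le)
  refine ((D.stochasticLittleO_row true D.cases_le hfm hfC).add
    (D.stochasticLittleO_row false D.controls_le hfm hfC)).of_norm_le (a := fun n => (n : ℝ)⁻¹)
    (fun n => by positivity) ?_ ?_
  · filter_upwards [eventually_gt_atTop 0] with n hn
    rw [inv_mul_cancel_left₀ (Nat.cast_ne_zero.2 hn.ne')]
  · filter_upwards [hfC, D.eventually_cases_pos_controls_pos, eventually_gt_atTop 0]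
      with n hfn hpos hn ω
    have hn0 : (n : ℝ) ≠ 0 := Nat.cast_ne_zero.2 hn.ne'
    have hmean : (n₁ n : ℝ) • ∫ x, f n x ∂F true + (n₀ n : ℝ) • ∫ x, f n x ∂F false
        = (n : ℝ) • ∫ x, g x • z x ∂F false := by
      rw [D.smul_integral_cases_add_smul_integral_controls
        (D.integrable_of_norm_le (hfm n).stronglyMeasurable hfn), ← integral_smul]
      refine integral_congr_ae (Eventually.of_forall fun x => ?_)
      have hpool := (pooledDensity_pos hpos.1 hpos.2 θ₀ x).ne'
      simp only [hf, smul_smul]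
      congr 1
      field_simp
    rw [sub_add_sub_comm, hmean, ← sum_covariate X _ _ ω (f n)]
    simp only [hf, mul_smul, ← Finset.smul_sum]
    rw [← smul_sub, norm_smul, Real.norm_natCast, inv_mul_cancel_left₀ hn0]

end Averages

end CaseControlDesign

/-- The vector `(1, x)` of the regression design, damped so that it stays bounded; squared inner
products with it are the summands of the Gram bound in `RegularSample`. -/
def dampedDesign (B : ℝ) (x : Vec p) : WithLp 2 (ℝ × Vec p) :=
  Real.exp (-(B / 2) * ‖x‖) • WithLp.toLp 2 (1, x)

lemma measurable_dampedDesign (B : ℝ) : Measurable (dampedDesign B : Vec p → _) := by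
  have hpair : Measurable fun x : Vec p => WithLp.toLp 2 ((1 : ℝ), x) :=
    (WithLp.measurable_toLp 2 _).comp (measurable_const.prodMk measurable_id)
  exact (by fun_prop : Measurable fun x : Vec p => Real.exp (-(B / 2) * ‖x‖)).smul hpair

lemma norm_dampedDesign_le {B : ℝ} (hB : 2 ≤ B) (x : Vec p) : ‖dampedDesign B x‖ ≤ 1 := by
  have hpair : ‖WithLp.toLp 2 ((1 : ℝ), x)‖ ≤ 1 + ‖x‖ := by
    refine le_of_sq_le_sq ?_ (by positivity)
    calc ‖WithLp.toLp 2 ((1 : ℝ), x)‖ ^ 2 = 1 + ‖x‖ ^ 2 := by simp [WithLp.prod_norm_sq_eq_of_L2]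
      _ ≤ (1 + ‖x‖) ^ 2 := by nlinarith [norm_nonneg x]
  have hexp : 1 + ‖x‖ ≤ Real.exp (B / 2 * ‖x‖) := by
    nlinarith [Real.add_one_le_exp (B / 2 * ‖x‖), norm_nonneg x]
  rw [dampedDesign, norm_smul, Real.norm_of_nonneg (Real.exp_pos _).le, neg_mul, Real.exp_neg,
    inv_mul_le_iff₀ (Real.exp_pos _), mul_one]
  exact hpair.trans hexp

lemma inner_dampedDesign (B : ℝ) (v : WithLp 2 (ℝ × Vec p)) (x : Vec p) :
    inner ℝ v (dampedDesign B x) = Real.exp (-(B / 2) * ‖x‖) * (v.fst + inner ℝ v.snd x) := by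
  rw [dampedDesign, inner_smul_right, WithLp.prod_inner_apply]
  simp

lemma sq_inner_dampedDesign (B a : ℝ) (b x : Vec p) :
    (inner ℝ (WithLp.toLp 2 (a, b)) (dampedDesign B x) : ℝ) ^ 2
      = Real.exp (-B * ‖x‖) * (a + inner ℝ b x) ^ 2 := by
  rw [inner_dampedDesign, mul_pow, ← Real.exp_nat_mul]
  congr 2
  push_cast
  ring

namespace CaseControlDesign

variable {Ω : Type*} [MeasurableSpace Ω] {P : Measure Ω} [IsProbabilityMeasure P]
  {X : Bool → ℕ → Ω → Vec p} {F : Bool → Measure (Vec p)} {θ₀ : Param p q} {n₁ n₀ : ℕ → ℕ} {κ : ℝ}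

section

variable {m : Vec p → ℝ} (D : CaseControlDesign P X F θ₀ n₁ n₀ κ m)

include D

lemma exists_gram [IsProbabilityMeasure (F true)]
    (hF : ∀ (a : ℝ) (b : Vec p), (∀ᵐ x ∂F true, a + inner ℝ b x = 0) → a = 0 ∧ b = 0)
    {B : ℝ} (hB : 2 ≤ B) :
    ∃ cG : ℝ, 0 < cG ∧ HoldsEventually P fun n => {ω | ∀ (a : ℝ) (b : Vec p),
      cG * n * (a ^ 2 + ‖b‖ ^ 2) ≤ ∑ i, Real.exp (-B * ‖covariate X (n₁ n) (n₀ n) ω i‖) *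
        (a + inner ℝ b (covariate X (n₁ n) (n₀ n) ω i)) ^ 2} := by
  have hnd (v : WithLp 2 (ℝ × Vec p))
      (hv : ∀ᵐ x ∂F true, inner ℝ v (dampedDesign B x) = (0 : ℝ)) : v = 0 := by
    have hzero := hF v.fst v.snd <| hv.mono fun x hx => by
      rw [inner_dampedDesign] at hx
      exact (mul_eq_zero.1 hx).resolve_left (Real.exp_pos _).ne'
    exact (WithLp.ofLp_injective 2) (Prod.ext hzero.1 hzero.2)
  obtain ⟨c, hc, hgram⟩ := exists_gram_lower_bound (D.measurable true) (D.indep true) (D.law true)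
    (measurable_dampedDesign B) (norm_dampedDesign_le hB) hnd
  refine ⟨c * κ, mul_pos hc D.frac_pos, (hgram.comp D.tendsto_cases).mono ?_⟩
  filter_upwards [D.balanced] with n hn ω hω a b
  have hcases := hω (WithLp.toLp 2 (a, b))
  simp only [sq_inner_dampedDesign, WithLp.prod_norm_sq_eq_of_L2, Real.norm_eq_abs,
    sq_abs] at hcases
  rw [sum_covariate X _ _ ω fun x => Real.exp (-B * ‖x‖) * (a + inner ℝ b x) ^ 2]
  calc c * κ * n * (a ^ 2 + ‖b‖ ^ 2) = c * (κ * n) * (a ^ 2 + ‖b‖ ^ 2) := by ring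
    _ ≤ c * n₁ n * (a ^ 2 + ‖b‖ ^ 2) := by
        gcongr
        exact hn.1
    _ ≤ _ := hcases.trans (le_add_of_nonneg_right (Finset.sum_nonneg fun i _ => by positivity))

lemma stochasticLittleO_score {E : Type*} [NormedAddCommGroup E] [NormedSpace ℝ E]
    [FiniteDimensional ℝ E] [MeasurableSpace E] [BorelSpace E] {z : Vec p → E} (hz : Measurable z)
    (hzm : ∀ x, ‖z x‖ ≤ m x) :
    StochasticLittleO P (fun n ω => ∑ i, (response (n₁ n) (n₀ n) i - n₁ n *
        (tilt θ₀ (covariate X (n₁ n) (n₀ n) ω i) /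
          pooledDensity (n₁ n) (n₀ n) θ₀ (covariate X (n₁ n) (n₀ n) ω i))) •
            z (covariate X (n₁ n) (n₀ n) ω i)) (fun n => n * rate n) := by
  have hcases := D.stochasticLittleO_row true D.cases_le (f := fun _ => z) (fun _ => hz) (C := 1)
    (Eventually.of_forall fun _ x => (hzm x).trans_eq (one_mul _).symm)
  have htilt := (D.stochasticLittleO_weighted (measurable_tilt θ₀) (fun x => (tilt_pos θ₀ x).le)
    (fun x => le_add_of_nonneg_left zero_le_one) hz hzm).of_norm_le
    (g := fun n ω => (-(n₁ n : ℝ)) • (_ : E)) (v := fun n => n * rate n) (a := fun n => (n : ℝ))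
    (fun n => Nat.cast_nonneg n) (Eventually.of_forall fun _ => le_rfl)
    (Eventually.of_forall fun n ω => by
      rw [norm_smul, norm_neg, Real.norm_natCast]
      exact mul_le_mul_of_nonneg_right (Nat.cast_le.2 (D.cases_le n)) (norm_nonneg _))
  refine (hcases.add htilt).congr (Eventually.of_forall fun n ω => ?_)
  have hresponse : ∑ i, response (n₁ n) (n₀ n) i • z (covariate X (n₁ n) (n₀ n) ω i)
      = ∑ i ∈ Finset.range (n₁ n), z (X true i ω) := by
    rw [Fintype.sum_sum_type, Finset.sum_range]
    simp [response, covariate]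
  simp only [sub_smul, Finset.sum_sub_distrib, hresponse, mul_smul, ← Finset.smul_sum,
    ← D.integral_cases]
  module

end

theorem exists_regularSample [∀ b, IsProbabilityMeasure (F b)] {h : Vec p → Vec q}
    (D : CaseControlDesign P X F θ₀ n₁ n₀ κ fun x => 1 + ‖x‖ + ‖h x‖) (hh : Measurable h)
    (hF : ∀ (a : ℝ) (b : Vec p), (∀ᵐ x ∂F true, a + inner ℝ b x = 0) → a = 0 ∧ b = 0)
    {B : ℝ} (hB : 2 ≤ B) :
    ∃ M cG : ℝ, 0 ≤ M ∧ 0 < cG ∧ ∀ ε, 0 < ε → HoldsEventually P fun n =>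
      {ω | RegularSample h θ₀ (∫ x, h x ∂F false) (∫ x, h x ∂F true) κ M cG B (n₁ n) (n₀ n)
        (rate n) ε (response (n₁ n) (n₀ n)) (covariate X (n₁ n) (n₀ n) ω)} := by
  obtain ⟨M, hM, hmoment⟩ := D.exists_moment_bound
  obtain ⟨cG, hcG, hgram⟩ := D.exists_gram hF hB
  refine ⟨M, cG, hM, hcG, fun ε hε => ?_⟩
  have hone (x : Vec p) : ‖(1 : ℝ)‖ ≤ 1 + ‖x‖ + ‖h x‖ := norm_one.trans_le (D.one_le_envelope x)
  have hx (x : Vec p) : ‖x‖ ≤ 1 + ‖x‖ + ‖h x‖ := by linarith [norm_nonneg (h x)]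
  have hhx (x : Vec p) : ‖h x‖ ≤ 1 + ‖x‖ + ‖h x‖ := by linarith [norm_nonneg x]
  have hunit : ∫ x, tilt θ₀ x ∂F false = 1 := by
    simpa using (D.integral_cases fun _ => (1 : ℝ)).symm
  have hinv {E : Type} [NormedAddCommGroup E] [NormedSpace ℝ E] [FiniteDimensional ℝ E]
      [MeasurableSpace E] [BorelSpace E] {z : Vec p → E} (hz : Measurable z) :=
    D.stochasticLittleO_weighted (measurable_const (a := (1 : ℝ))) (fun _ => zero_le_one)
      (fun x => le_add_of_nonneg_right (tilt_pos θ₀ x).le) hz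
  have htilt {E : Type} [NormedAddCommGroup E] [NormedSpace ℝ E] [FiniteDimensional ℝ E]
      [MeasurableSpace E] [BorelSpace E] {z : Vec p → E} (hz : Measurable z) :=
    D.stochasticLittleO_weighted (measurable_tilt θ₀) (fun x => (tilt_pos θ₀ x).le)
      (fun x => le_add_of_nonneg_left zero_le_one) hz
  refine ((((((hinv measurable_const hone ε hε).inter (htilt measurable_const hone ε hε)).inter
    (hinv hh hhx ε hε)).inter (htilt hh hhx ε hε)).inter
    (D.stochasticLittleO_score measurable_id hx ε hε)).inter (hmoment.inter hgram)).mono ?_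
  filter_upwards [D.balanced, eventually_gt_atTop 0]
    with n hn hn0 ω ⟨⟨⟨⟨⟨hinvMass, htiltMass⟩, hinvSum⟩, htiltSum⟩, hscore⟩, hmoment, hgram⟩
  simp only [Set.mem_ofPred_eq, ← D.integral_cases, integral_const, probReal_univ, smul_eq_mul,
    mul_one, hunit, one_smul, one_div] at hinvMass htiltMass hinvSum htiltSum hscore hmoment hgram
  exact
    { κ_pos := D.frac_pos
      r_pos := rate_pos hn0
      card_eq := by rw [D.card_index, add_comm]; exact_mod_cast D.size n
      card_mul := by rw [D.card_index, mul_rate_pow hn0]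
      controls := by rw [D.card_index]; exact hn.2
      cases := by rw [D.card_index]; exact hn.1
      response := by simp [response]
      inv_mass := hinvMass
      tilt_mass := htiltMass
      inv_summary := hinvSum
      tilt_summary := htiltSum
      score := by rw [D.card_index]; exact hscore
      moment := by rw [D.card_index]; exact hmoment
      gram := by rw [D.card_index]; exact hgram }

end CaseControlDesign

/-! ### The external estimate -/

lemma eventually_mul_le_and_le_mul {N : ℕ → ℕ} {c : ℝ} (hc : 0 < c)
    (hN : Tendsto (fun n : ℕ => (n : ℝ) / (N n : ℝ)) atTop (𝓝 c)) :
    ∀ᶠ n : ℕ in atTop, (2 * c)⁻¹ * n ≤ N n ∧ N n ≤ 2 / c * n := by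
  filter_upwards [hN.eventually_const_lt (half_lt_self hc),
    hN.eventually_lt_const (by linarith : c < 2 * c)] with n hlow hup
  have hNpos : (0 : ℝ) < N n :=
    (Nat.cast_nonneg _).lt_of_ne' fun h0 => by rw [h0, div_zero] at hlow; linarith
  rw [lt_div_iff₀ hNpos] at hlow
  rw [div_lt_iff₀ hNpos] at hup
  constructor
  · rw [inv_mul_le_iff₀ (by positivity)]
    exact hup.le
  · rw [div_mul_eq_mul_div, le_div_iff₀ hc]
    linarith

section Convergence

variable {Ω Ω' E : Type*} [MeasurableSpace Ω] [MeasurableSpace Ω'] {P : Measure Ω}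
  [IsProbabilityMeasure P] {P' : Measure Ω'} [IsProbabilityMeasure P'] [NormedAddCommGroup E]
  [MeasurableSpace E] [BorelSpace E] {Y : ℕ → Ω → E}

lemma tendstoInMeasure_of_tendstoInDistribution_const {c : E}
    (h : TendstoInDistribution Y atTop (fun _ : Ω' => c) (fun _ => P) P') :
    TendstoInMeasure P Y atTop fun _ => c := by
  rw [tendstoInMeasure_iff_norm]
  intro ε hε
  have hclosed : IsClosed {y : E | ε ≤ ‖y - c‖} := isClosed_le (by fun_prop) (by fun_prop)
  have hlimsup := ProbabilityMeasure.limsup_measure_closed_le_of_tendsto h.tendsto hclosed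
  simp only [ProbabilityMeasure.coe_mk, Measure.map_apply_of_aemeasurable h.aemeasurable_limit
    hclosed.measurableSet, Measure.map_apply_of_aemeasurable (h.forall_aemeasurable _)
    hclosed.measurableSet] at hlimsup
  refine tendsto_of_le_liminf_of_limsup_le zero_le (hlimsup.trans_eq ?_)
  simp [hε.not_ge]

lemma tendstoInMeasure_smul_of_tendstoInDistribution [NormedSpace ℝ E]
    [SecondCountableTopology E] {Z : Ω' → E}
    (h : TendstoInDistribution Y atTop Z (fun _ => P) P') {a : ℕ → ℝ}
    (ha : Tendsto a atTop (𝓝 0)) :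
    TendstoInMeasure P (fun n ω => a n • Y n ω) atTop fun _ => 0 := by
  have hscale : TendstoInMeasure P (fun n (_ : Ω) => a n) atTop fun _ => (0 : ℝ) :=
    tendstoInMeasure_of_tendsto_ae (fun n => aestronglyMeasurable_const)
      (Eventually.of_forall fun _ => ha)
  have hprod := h.continuous_comp_prodMk_of_tendstoInMeasure_const
    (g := fun z : E × ℝ => z.2 • z.1) (by fun_prop) hscale fun n => aemeasurable_const
  simp only [zero_smul] at hprod
  exact tendstoInMeasure_of_tendstoInDistribution_const hprod

end Convergence

lemma inv_rate (n : ℕ) : (rate n)⁻¹ = (n : ℝ) ^ (1 / 3 : ℝ) := by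
  rw [rate, Real.rpow_neg (Nat.cast_nonneg n), inv_inv]

lemma tendsto_inv_rate_div_sqrt {N : ℕ → ℕ} {cN : ℝ} (hcN : 0 < cN)
    (hN : ∀ᶠ n : ℕ in atTop, cN * n ≤ N n) :
    Tendsto (fun n => (rate n)⁻¹ / √(N n : ℝ)) atTop (𝓝 0) := by
  have hsqrt : Tendsto (fun n => √(rate n / cN)) atTop (𝓝 0) := by
    simpa using (tendsto_rate.div_const cN).sqrt
  refine squeeze_zero' (Eventually.of_forall fun n =>
    div_nonneg (inv_nonneg.2 (rate_nonneg n)) (Real.sqrt_nonneg _)) ?_ hsqrt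
  filter_upwards [hN, eventually_gt_atTop 0] with n hNn hn
  have hr := rate_pos hn
  calc (rate n)⁻¹ / √(N n : ℝ) ≤ (rate n)⁻¹ / √(cN * n) := by gcongr
    _ = √((rate n)⁻¹ ^ 2 / (cN * n)) := by
        rw [Real.sqrt_div (sq_nonneg _), Real.sqrt_sq (inv_nonneg.2 hr.le)]
    _ = √(rate n / cN) := by
        congr 1
        rw [eq_inv_of_mul_eq_one_left (mul_rate_pow hn)]
        field_simp

lemma tendstoInMeasure_of_tendstoInDistribution_sqrt {Ω Ω' E : Type*} [MeasurableSpace Ω]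
    [MeasurableSpace Ω'] {P : Measure Ω} [IsProbabilityMeasure P] {P' : Measure Ω'}
    [IsProbabilityMeasure P'] [NormedAddCommGroup E] [NormedSpace ℝ E] [MeasurableSpace E]
    [BorelSpace E] [SecondCountableTopology E] {N : ℕ → ℕ} {cN : ℝ} (hcN : 0 < cN)
    (hN : ∀ᶠ n : ℕ in atTop, cN * n ≤ N n) {e : ℕ → Ω → E} {Z : Ω' → E}
    (h : TendstoInDistribution (fun n ω => √(N n : ℝ) • e n ω) atTop Z (fun _ => P) P') :
    TendstoInMeasure P (fun (n : ℕ) ω => (n : ℝ) ^ (1 / 3 : ℝ) • e n ω) atTop fun _ => 0 := by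
  refine (tendstoInMeasure_smul_of_tendstoInDistribution h
    (tendsto_inv_rate_div_sqrt hcN hN)).congr' ?_ ae_eq_rfl
  filter_upwards [hN, eventually_gt_atTop 0] with n hNn hn
  have hNpos : (0 : ℝ) < N n := (mul_pos hcN (Nat.cast_pos.2 hn)).trans_le hNn
  refine Eventually.of_forall fun ω => ?_
  simp only [smul_smul, inv_rate]
  rw [div_mul_cancel₀ _ (Real.sqrt_pos.2 hNpos).ne']

/-! ### The estimator -/

section Implication

variable {Ω E : Type*} [MeasurableSpace Ω] {P : Measure Ω} [NormedAddCommGroup E]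
  {e : ℕ → Ω → E} {ε : ℝ} {G : ℕ → Set Ω}

lemma norm_le_mul_rate {v : E} {n : ℕ} (hn : 0 < n) (h : (n : ℝ) ^ (1 / 3 : ℝ) * ‖v‖ ≤ ε) :
    ‖v‖ ≤ ε * rate n := by
  rw [← inv_rate, inv_mul_le_iff₀ (rate_pos hn)] at h
  rwa [mul_comm]

lemma HoldsEventually.ae_eventually_of_tendsto
    (h : HoldsEventually P fun n => {ω | ‖e n ω‖ ≤ ε * rate n → ω ∈ G n}) (hε : 0 < ε) :
    ∀ᵐ ω ∂P, Tendsto (fun n : ℕ => (n : ℝ) ^ (1 / 3 : ℝ) * ‖e n ω‖) atTop (𝓝 0) →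
      ∀ᶠ n in atTop, ω ∈ G n := by
  filter_upwards [h.ae] with ω hω hlim
  filter_upwards [hω, hlim.eventually_le_const hε, eventually_gt_atTop 0] with n hGn hle hn
  exact hGn (norm_le_mul_rate hn hle)

lemma HoldsEventually.tendsto_measure_compl_of_tendstoInMeasure [NormedSpace ℝ E]
    (h : HoldsEventually P fun n => {ω | ‖e n ω‖ ≤ ε * rate n → ω ∈ G n}) (hε : 0 < ε)
    (he : TendstoInMeasure P (fun (n : ℕ) ω => (n : ℝ) ^ (1 / 3 : ℝ) • e n ω) atTop fun _ => 0) :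
    Tendsto (fun n => P (G n)ᶜ) atTop (𝓝 0) := by
  refine tendsto_of_tendsto_of_tendsto_of_le_of_le' tendsto_const_nhds
    (by simpa only [add_zero] using h.prob.add (tendstoInMeasure_iff_norm.1 he ε hε))
    (Eventually.of_forall fun _ => zero_le) ?_
  filter_upwards [eventually_gt_atTop 0] with n hn
  refine (measure_mono fun ω hω => ?_).trans (measure_union_le _ _)
  refine or_iff_not_imp_right.2 fun hlt hG => hω (hG (norm_le_mul_rate hn ?_))
  have hpow : (0 : ℝ) ≤ (n : ℝ) ^ (1 / 3 : ℝ) := by positivity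
  rw [Set.mem_ofPred_eq, not_le, sub_zero, norm_smul, Real.norm_of_nonneg hpow] at hlt
  exact hlt.le

end Implication

section Consistency

variable {Ω : Type*} [MeasurableSpace Ω] {P : Measure Ω}

lemma tendstoInMeasure_comp_of_dist_le {E E' : Type*} [PseudoMetricSpace E]
    [PseudoEMetricSpace E'] {bad : ℕ → Set Ω} (hbad : Tendsto (fun n => P (bad n)) atTop (𝓝 0))
    {r : ℕ → ℝ} (hr : Tendsto r atTop (𝓝 0)) {θ : ℕ → Ω → E} {θ₀ : E}
    (h : ∀ n ω, ω ∉ bad n → dist (θ n ω) θ₀ ≤ r n) {f : E → E'} (hf : ContinuousAt f θ₀) :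
    TendstoInMeasure P (fun n ω => f (θ n ω)) atTop fun _ => f θ₀ := by
  intro ε hε
  obtain ⟨δ, hδ, hδf⟩ := Metric.mem_nhds_iff.1 (hf (Metric.eball_mem_nhds (f θ₀) hε))
  refine tendsto_of_tendsto_of_tendsto_of_le_of_le' tendsto_const_nhds hbad
    (Eventually.of_forall fun _ => zero_le) ?_
  filter_upwards [hr.eventually_lt_const hδ] with n hn
  refine measure_mono fun ω hfar => not_not.1 fun hgood => ?_
  exact (not_lt.2 hfar) (Metric.mem_eball.1 (hδf ((h n ω hgood).trans_lt hn)))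

lemma GoodEstimator.dist_le {ι : Type*} [Fintype ι] {h : Vec p → Vec q} {Θ : Set (Param p q)}
    {W : Matrix (Fin q) (Fin q) ℝ} {N : ℕ} {m : Vec q} {y : ι → ℝ} {x : ι → Vec p}
    {θ₀ θ : Param p q} {w : ι → ℝ} (hgood : GoodEstimator h Θ W N m y x θ₀)
    (hmax : IsMaximizer h Θ W N m y x θ w) : dist θ θ₀ ≤ rate (Fintype.card ι) :=
  Metric.mem_closedBall.1 (interior_subset (hgood.2 θ w hmax).1)

lemma tendstoInMeasure_comp_of_goodEstimator {h : Vec p → Vec q} {Θ : Set (Param p q)}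
    {W : Matrix (Fin q) (Fin q) ℝ} {θ₀ : Param p q} {X : Bool → ℕ → Ω → Vec p} {n₁ n₀ N : ℕ → ℕ}
    (hn : ∀ n, n₁ n + n₀ n = n) {m : ℕ → Ω → Vec q}
    (hgood : Tendsto (fun n => P {ω | ¬ GoodEstimator h Θ W (N n) (m n ω)
      (response (n₁ n) (n₀ n)) (covariate X (n₁ n) (n₀ n) ω) θ₀}) atTop (𝓝 0))
    {θhat : ℕ → Ω → Param p q}
    (hθhat : ∀ n ω, (∃ θ w, IsMaximizer h Θ W (N n) (m n ω) (response (n₁ n) (n₀ n))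
        (covariate X (n₁ n) (n₀ n) ω) θ w) →
      ∃ w, IsMaximizer h Θ W (N n) (m n ω) (response (n₁ n) (n₀ n))
        (covariate X (n₁ n) (n₀ n) ω) (θhat n ω) w)
    {E : Type*} [PseudoEMetricSpace E] {f : Param p q → E} (hf : ContinuousAt f θ₀) :
    TendstoInMeasure P (fun n ω => f (θhat n ω)) atTop fun _ => f θ₀ := by
  refine tendstoInMeasure_comp_of_dist_le hgood tendsto_rate (fun n ω hω => ?_) hf
  have hgood : GoodEstimator .. := not_not.1 hω
  obtain ⟨w, hw⟩ := hθhat n ω hgood.1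
  simpa only [Fintype.card_sum, Fintype.card_fin, hn] using hgood.dist_le hw

end Consistency

namespace IsLogistic

variable {Pop : Measure (Vec p × Bool)} [IsProbabilityMeasure Pop] {α : ℝ} {β : Vec p}
  {h : Vec p → Vec q} (hlog : IsLogistic Pop α β)

include hlog

theorem caseControlDesign (hh : Measurable h)
    (hX : Integrable (fun x => ‖x‖ ^ 3) Pop.fst) (hhX : Integrable (fun x => ‖h x‖ ^ 3) Pop.fst)
    {Ω : Type*} [MeasurableSpace Ω] {P : Measure Ω} {X : Bool → ℕ → Ω → Vec p}
    (hXm : ∀ b i, Measurable (X b i)) (hXind : ∀ b, iIndepFun (X b) P)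
    (hXlaw : ∀ b i, P.map (X b i) = condLaw Pop b) {n₁ n₀ : ℕ → ℕ} (hn : ∀ n, n₁ n + n₀ n = n)
    {κ : ℝ} (hκ : 0 < κ) (hbal : ∀ᶠ n : ℕ in atTop, κ * n ≤ n₁ n ∧ κ * n ≤ n₀ n) :
    CaseControlDesign P X (condLaw Pop) (thetaTrue Pop α β h) n₁ n₀ κ
      fun x => 1 + ‖x‖ + ‖h x‖ where
  measurable := hXm
  indep := hXind
  law := hXlaw
  size := hn
  frac_pos := hκ
  balanced := hbal
  density := hlog.condLaw_true_eq_withDensity_tilt h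
  envelope_measurable := by fun_prop
  one_le_envelope x := by linarith [norm_nonneg x, norm_nonneg (h x)]
  envelope_integrable b :=
    integrable_condLaw (hlog.respProb_pos b) (integrable_envelope_pow hh hX hhX)

theorem exists_holdsEventually_goodEstimator (hh : Measurable h)
    (hne : ∫ x, h x ∂(condLaw Pop true) ≠ ∫ x, h x ∂(condLaw Pop false))
    {Ω : Type*} [MeasurableSpace Ω] {P : Measure Ω} [IsProbabilityMeasure P]
    {X : Bool → ℕ → Ω → Vec p} {n₁ n₀ N : ℕ → ℕ} {κ : ℝ}
    (D : CaseControlDesign P X (condLaw Pop) (thetaTrue Pop α β h) n₁ n₀ κ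
      fun x => 1 + ‖x‖ + ‖h x‖) {cN CN : ℝ} (hcN : 0 < cN)
    (hN : ∀ᶠ n : ℕ in atTop, cN * n ≤ N n ∧ N n ≤ CN * n) (m : ℕ → Ω → Vec q)
    {W : Matrix (Fin q) (Fin q) ℝ} (hW : W.PosDef) {Θ : Set (Param p q)} (hΘ : IsCompact Θ)
    (hθ₀ : thetaTrue Pop α β h ∈ interior Θ) (hint : Integrable h Pop.fst)
    (hF : ∀ S : AffineSubspace ℝ (Vec p), S ≠ ⊤ → ¬ ∀ᵐ x ∂Pop.fst, x ∈ S) :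
    ∃ ε : ℝ, 0 < ε ∧ HoldsEventually P fun n =>
      {ω | ‖m n ω - ∫ x, h x ∂Pop.fst‖ ≤ ε * rate n →
        ω ∈ {ω | GoodEstimator h Θ W (N n) (m n ω) (response (n₁ n) (n₀ n))
          (covariate X (n₁ n) (n₀ n) ω) (thetaTrue Pop α β h)}} := by
  have hprob := hlog.isProbabilityMeasure_condLaw
  obtain ⟨Λ, hΛ⟩ := hΘ.isBounded.exists_norm_le
  obtain ⟨M, cG, hM, hcG, hregular⟩ := D.exists_regularSample hh
    (fun a b hab => eq_zero_of_ae_affine_eq_zero hF (hlog.ae_fst_of_ae_condLaw true hab))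
    (B := 3 * max Λ 1) (by linarith [le_max_right Λ 1])
  obtain ⟨ε, hε, hgood⟩ := exists_goodEstimator (Λ := max Λ 1) hne.symm
    (hlog.mom_thetaTrue fun b => integrable_condLaw (hlog.respProb_pos b) hint) hΘ hθ₀ hW
    D.frac_pos hM hcG (fun θ hθ => (hΛ θ hθ).trans (le_max_left _ _)) hcN (le_max_right CN 0)
  refine ⟨ε, hε, (hregular ε hε).mono ?_⟩
  filter_upwards [hN] with n hNn ω hω hm
  refine hgood hω (N n) (m n ω) ?_ ?_ ?_
  · rw [D.card_index]
    exact hNn.1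
  · rw [D.card_index]
    exact hNn.2.trans (mul_le_mul_of_nonneg_right (le_max_left _ _) (Nat.cast_nonneg n))
  · rwa [thetaTrue, mom_mkParam]

end IsLogistic

end CaseControl

end

open CaseControl in
theorem theorem1_general {p q : ℕ}
    (Pop : Measure (Vec p × Bool)) [IsProbabilityMeasure Pop] (α₀ : ℝ) (β₀ : Vec p)
    (hlog : IsLogistic Pop α₀ β₀) (h : Vec p → Vec q) (hh : Measurable h)
    (hne : ∫ x, h x ∂(condLaw Pop true) ≠ ∫ x, h x ∂(condLaw Pop false))
    {Ω : Type*} [MeasurableSpace Ω] (P : Measure Ω) [IsProbabilityMeasure P]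
    (X : Bool → ℕ → Ω → Vec p) (hXm : ∀ b i, Measurable (X b i))
    (hXind : ∀ b, iIndepFun (X b) P) (hXlaw : ∀ b i, P.map (X b i) = condLaw Pop b)
    (n₁ n₀ N : ℕ → ℕ) (hn : ∀ n, n₁ n + n₀ n = n)
    (hbal : ∃ κ : ℝ, 0 < κ ∧ ∀ᶠ n : ℕ in atTop, κ * n ≤ n₁ n ∧ κ * n ≤ n₀ n)
    (hN : ∃ c C : ℝ, 0 < c ∧ ∀ᶠ n : ℕ in atTop, c * n ≤ N n ∧ N n ≤ C * n)
    (mtilde : ℕ → Ω → Vec q) (W : Matrix (Fin q) (Fin q) ℝ) (hW : W.PosDef)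
    (Θ : Set (Param p q)) (hΘ : IsCompact Θ) (hθ₀ : thetaTrue Pop α₀ β₀ h ∈ interior Θ)
    (hX3 : Integrable (fun x => ‖x‖ ^ 3) Pop.fst) (hh3 : Integrable (fun x => ‖h x‖ ^ 3) Pop.fst)
    (hF : ∀ S : AffineSubspace ℝ (Vec p), S ≠ ⊤ → ¬ ∀ᵐ x ∂Pop.fst, x ∈ S)
    (hext : TendstoInMeasure P
      (fun (n : ℕ) ω => (n : ℝ) ^ (1 / 3 : ℝ) • (mtilde n ω - ∫ x, h x ∂Pop.fst)) atTop
      fun _ => 0) :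
    Tendsto (fun n : ℕ => P {ω | ¬ GoodEstimator h Θ W (N n) (mtilde n ω)
      (response (n₁ n) (n₀ n)) (covariate X (n₁ n) (n₀ n) ω) (thetaTrue Pop α₀ β₀ h)}) atTop (𝓝 0) ∧
    (∀ᵐ ω ∂P, Tendsto (fun n : ℕ => (n : ℝ) ^ (1 / 3 : ℝ) *
        ‖mtilde n ω - ∫ x, h x ∂Pop.fst‖) atTop (𝓝 0) →
      ∀ᶠ n : ℕ in atTop, GoodEstimator h Θ W (N n) (mtilde n ω)
        (response (n₁ n) (n₀ n)) (covariate X (n₁ n) (n₀ n) ω) (thetaTrue Pop α₀ β₀ h)) ∧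
    (∀ θhat : ℕ → Ω → Param p q,
      (∀ n ω, (∃ θ w, IsMaximizer h Θ W (N n) (mtilde n ω)
          (response (n₁ n) (n₀ n)) (covariate X (n₁ n) (n₀ n) ω) θ w) →
        ∃ w, IsMaximizer h Θ W (N n) (mtilde n ω)
          (response (n₁ n) (n₀ n)) (covariate X (n₁ n) (n₀ n) ω) (θhat n ω) w) →
      TendstoInMeasure P θhat atTop (fun _ => thetaTrue Pop α₀ β₀ h) ∧
      TendstoInMeasure P (fun n ω => astar (θhat n ω) - gam (θhat n ω)) atTop (fun _ => α₀) ∧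
      TendstoInMeasure P (fun n ω => 1 / (1 + Real.exp (gam (θhat n ω)))) atTop
        (fun _ => caseProp Pop)) ∧
    (∀ (Pop' : Measure (Vec p × Bool)) (α' : ℝ) (β' : Vec p),
      IsProbabilityMeasure Pop' → IsLogistic Pop' α' β' →
      (∀ b, condLaw Pop' b = condLaw Pop b) →
      ∫ x, h x ∂Pop'.fst = ∫ x, h x ∂Pop.fst →
      α' = α₀ ∧ caseProp Pop' = caseProp Pop) := by
  obtain ⟨κ, hκ, hbal⟩ := hbal
  obtain ⟨c, C, hc, hN⟩ := hN
  have hint : Integrable h Pop.fst :=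
    (memLp_of_integrable_norm_pow hh.aestronglyMeasurable hh3).integrable (by norm_num)
  obtain ⟨ε, hε, hgood⟩ := hlog.exists_holdsEventually_goodEstimator hh hne
    (hlog.caseControlDesign hh hX3 hh3 hXm hXind hXlaw hn hκ hbal) hc hN mtilde hW hΘ hθ₀ hint hF
  have hprob := hgood.tendsto_measure_compl_of_tendstoInMeasure hε hext
  have hgam : Continuous (gam : Param p q → ℝ) := contDiff_gam.continuous
  have hastar : Continuous (astar : Param p q → ℝ) := contDiff_astar.continuous
  refine ⟨hprob, hgood.ae_eventually_of_tendsto hε, fun θhat hθhat => ?_,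
    fun Pop' α' β' _ hlog' => hlog.identified hint hne hF hlog'⟩
  have hcons {f : Param p q → ℝ} (hf : Continuous f) :=
    tendstoInMeasure_comp_of_goodEstimator hn hprob hθhat hf.continuousAt
  refine ⟨tendstoInMeasure_comp_of_goodEstimator hn hprob hθhat continuousAt_id, ?_, ?_⟩
  · simpa [thetaTrue] using hcons (hastar.sub hgam)
  · have hcase := hcons (f := fun θ => (1 + Real.exp (gam θ))⁻¹)
      (by fun_prop (disch := intro; positivity))
    simpa only [thetaTrue, gam_mkParam, hlog.inv_one_add_exp_gammaTrue, one_div] using hcase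

theorem theorem1 {p q : ℕ}
    -- population: joint law of the covariate and the response, logistic model
    (Pop : Measure (CaseControl.Vec p × Bool)) [IsProbabilityMeasure Pop]
    (α₀ : ℝ) (β₀ : CaseControl.Vec p) (hlog : CaseControl.IsLogistic Pop α₀ β₀)
    -- the summary function; its means in the two sub-populations differ
    (h : CaseControl.Vec p → CaseControl.Vec q) (hh : Measurable h)
    (hne : ∫ x, h x ∂(CaseControl.condLaw Pop true) ≠ ∫ x, h x ∂(CaseControl.condLaw Pop false))
    -- internal data: independent random samples from the cases and from the controls
    {Ω : Type*} [MeasurableSpace Ω] (P : Measure Ω) [IsProbabilityMeasure P]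
    (X : Bool → ℕ → Ω → CaseControl.Vec p)
    (hXm : ∀ b i, Measurable (X b i))
    (hXind : iIndepFun (fun k : Bool × ℕ => X k.1 k.2) P)
    (hXlaw : ∀ b i, P.map (X b i) = CaseControl.condLaw Pop b)
    -- sample sizes; cases and controls both make up a non-vanishing fraction
    (n₁ n₀ N : ℕ → ℕ) (hn : ∀ n, n₁ n + n₀ n = n)
    (hbal : ∃ κ : ℝ, 0 < κ ∧ ∀ᶠ n : ℕ in atTop, κ * n ≤ n₁ n ∧ κ * n ≤ n₀ n)
    (c : ℝ) (hc : 0 < c) (hN : Tendsto (fun n : ℕ => (n : ℝ) / (N n : ℝ)) atTop (𝓝 c))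
    -- external summary estimate and weight matrix
    (mtilde : ℕ → Ω → CaseControl.Vec q)
    (W : Matrix (Fin q) (Fin q) ℝ) (hW : W.PosDef)
    -- Condition 1
    (Θ : Set (CaseControl.Param p q)) (hΘ : IsCompact Θ)
    (hcond1 : CaseControl.thetaTrue Pop α₀ β₀ h ∈ interior Θ)
    -- Condition 2
    (hcond2 : ∀ μ : CaseControl.Vec q,
      ∫ x, CaseControl.H h (CaseControl.mkParam (CaseControl.gammaTrue Pop)
        (CaseControl.gammaTrue Pop + α₀) β₀ μ) x ∂(CaseControl.condLaw Pop false) = 0 ↔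
      μ = ∫ x, h x ∂Pop.fst)
    -- Condition 3
    (hcond3a : Integrable (fun x => ‖x‖ ^ 3) Pop.fst)
    (hcond3b : Integrable (fun x => ‖h x‖ ^ 3) Pop.fst)
    (hcond3c : ∀ S : AffineSubspace ℝ (CaseControl.Vec p), S ≠ ⊤ → ¬ ∀ᵐ x ∂Pop.fst, x ∈ S)
    -- Condition 4
    (V : Matrix (Fin q) (Fin q) ℝ) (hV : V.PosSemidef)
    (hcond4 : TendstoInDistribution
      (fun (n : ℕ) ω => √(N n : ℝ) • (mtilde n ω - ∫ x, h x ∂Pop.fst)) atTop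
      (id : CaseControl.Vec q → CaseControl.Vec q) (fun _ => P) (multivariateGaussian 0 V)) :
    -- with probability tending to one, the estimator is a stationary point in the small ball
    Tendsto (fun n : ℕ => P {ω | ¬ CaseControl.GoodEstimator h Θ W (N n) (mtilde n ω)
      (CaseControl.response (n₁ n) (n₀ n)) (CaseControl.covariate X (n₁ n) (n₀ n) ω)
      (CaseControl.thetaTrue Pop α₀ β₀ h)}) atTop (𝓝 0) ∧
    -- almost surely, this holds for all large `n` if the external error is `o(n^(-1/3))`
    (∀ᵐ ω ∂P, Tendsto (fun n : ℕ => (n : ℝ) ^ (1 / 3 : ℝ) *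
        ‖mtilde n ω - ∫ x, h x ∂Pop.fst‖) atTop (𝓝 0) →
      ∀ᶠ n : ℕ in atTop, CaseControl.GoodEstimator h Θ W (N n) (mtilde n ω)
        (CaseControl.response (n₁ n) (n₀ n)) (CaseControl.covariate X (n₁ n) (n₀ n) ω)
        (CaseControl.thetaTrue Pop α₀ β₀ h)) ∧
    -- consistency of the estimators of `θ`, of the intercept and of the case proportion
    (∀ θhat : ℕ → Ω → CaseControl.Param p q,
      (∀ n ω, (∃ θ w, CaseControl.IsMaximizer h Θ W (N n) (mtilde n ω)
          (CaseControl.response (n₁ n) (n₀ n)) (CaseControl.covariate X (n₁ n) (n₀ n) ω) θ w) →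
        ∃ w, CaseControl.IsMaximizer h Θ W (N n) (mtilde n ω)
          (CaseControl.response (n₁ n) (n₀ n)) (CaseControl.covariate X (n₁ n) (n₀ n) ω)
          (θhat n ω) w) →
      TendstoInMeasure P θhat atTop (fun _ => CaseControl.thetaTrue Pop α₀ β₀ h) ∧
      TendstoInMeasure P
        (fun n ω => CaseControl.astar (θhat n ω) - CaseControl.gam (θhat n ω)) atTop
        (fun _ => α₀) ∧
      TendstoInMeasure P (fun n ω => 1 / (1 + Real.exp (CaseControl.gam (θhat n ω)))) atTop
        (fun _ => CaseControl.caseProp Pop)) ∧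
    -- identifiability of the intercept and of the case proportion
    (∀ (Pop' : Measure (CaseControl.Vec p × Bool)) (α' : ℝ) (β' : CaseControl.Vec p),
      IsProbabilityMeasure Pop' → CaseControl.IsLogistic Pop' α' β' →
      (∀ b, CaseControl.condLaw Pop' b = CaseControl.condLaw Pop b) →
      ∫ x, h x ∂Pop'.fst = ∫ x, h x ∂Pop.fst →
      α' = α₀ ∧ CaseControl.caseProp Pop' = CaseControl.caseProp Pop) := by
  have hNn := CaseControl.eventually_mul_le_and_le_mul hc hN
  refine theorem1_general Pop α₀ β₀ hlog h hh hne P X hXm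
    (fun b => hXind.precomp (g := fun i => (b, i)) fun i j hij => (Prod.mk.inj hij).2) hXlaw n₁ n₀ N
    hn hbal ⟨_, _, by positivity, hNn⟩ mtilde W hW Θ hΘ hcond1 hcond3a hcond3b hcond3c ?_
  exact CaseControl.tendstoInMeasure_of_tendstoInDistribution_sqrt
    (cN := (2 * c)⁻¹) (by positivity) (hNn.mono fun n hn => hn.1) hcond4
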